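/- **Setting.** A GMM in $\mathbb{R}^d$ with $K\ge 2$ components has weights $\pi_i^*>0$, $\sum_i\pi_i^*=1$, means $\mu_i^*$ and law $\sum_{i}\pi_i^*\,\mathcal N(\mu_i^*,I_d)$. Put $\pi_{\min}=\min_i\pi_i^*$, $\rho_\pi=\max_i\pi_i^*/\min_i\pi_i^*$, $R_{\min}=\min_{i\ne j}\|\mu_i^*-\mu_j^*\|$, $R_{\max}=\max_{i\neq j}\|\mu_i^*-\mu_j^*\|\vee\max_i\|\mu_i^*\|$. *Transformers.* A layer maps a sequence $h_1,\dots,h_N\in\mathbb{R}^D$ first to $\tilde h_i=h_i+\sum_{m}\sum_{j}\mathrm{SoftMax}\big(((Q_mh_i)^\top K_mh_l)_{l\in[N]}\big)_jV_mh_j$, the sum over $m$ running over the heads, and then to $\tilde h_i+W_2\,\mathrm{ReLU}(W_1\tilde h_i)$. Let $\|\Theta\|$ be the maximum over the layers of $\max_m\{\|Q_m\|_2,\|K_m\|_2,\|V_m\|_2\}+\|W_1\|_2+\|W_2\|_2$ (operator norms), and let $\mathcal F(L',D,D',M,B)$ be the class of $L'$-layer transformers on $\mathbb{R}^D$ with at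 most $M$ heads and at most $D'$ hidden MLP units in each layer and with $\|\Theta\|\le B$. *Input.* Let $d\le d_0$, $K\le K_0$, $K\mid N$, $N\ge1$. Given samples $X_1,\dots,X_N\in\mathbb{R}^d$ and initial values $\pi^{(0)}_i\in\mathbb{R}$, $\mu_i^{(0)}\in\mathbb{R}^d$ ($i\in[K]$), token $j$ of the input is, from top to bottom: $X_j$ padded by zeros to $\mathbb{R}^{d_0}$; $\log\pi^{(0)}$ padded to $\mathbb{R}^{K_0}$; $\mu^{(0)}_{j\%K}$ padded to $\mathbb{R}^{d_0}$; $\|\mu^{(0)}_{j\%K}\|^2$; $0_{3K_0}$; $0_{\tilde D}$; $1$; $e_{j\%K}\in\mathbb{R}^{K_0}$. Here $j\%K\in[K]$ is the residue of $j$ modulo $K$, and $D=2d_0+5K_0+2+\tilde D$. *Output.* For an output sequence $(h_j)$ let $e(h_j)\in\mathbb R^K$, $p(h_j)\in\mathbb R^K$ and $m(h_j)\in\mathbb R^d$ be the first $K$, $K$ and $d$ entries of, respectively, the last block (that of $e_{j\%K}$), the third of the three zero blocks of length $K_0$ that make up $0_{3K_0}$, and the block of $\mu^{(0)}_{j\%K}$.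 The read-out is $o_i=\frac KN\sum_{j}e(h_j)_i\binom{p(h_j)}{m(h_j)}\in\mathbb{R}^{K+d}$, $i\in[K]$; the estimate $\mu_i^{\tt TF}$ is the last $d$ entries of $o_i$, and $\pi_k^{\tt TF}=\frac1K\sum_{i}(o_i)_k$. Set $$D^{\tt TF}_\Theta=\max_{i\in[K]}\Big\{\|\mu_i^{\tt TF}-\mu_i^*\|\vee\frac{|\pi_i^{\tt TF}-\pi_i^*|}{\pi_i^*}\Big\}.$$ *Assumption (A1) with constant $C$.* $R_{\min}\ge C\sqrt{\log(\rho_\pi K)}$, and for all $i$: $\|\mu_i^{(0)}-\mu_i^*\|\le R_{\min}/16$ and $|\pi_i^{(0)}-\pi_i^*|\le\pi_i^*/2$. **Theorem C.1.** There are universal constants $\tilde c_1,\dots,\tilde c_4,c>0$ and $q\in\mathbb{N}$, and for all $1/2<a<1$ and $0<\beta<1$ a constant $C=C(a,\beta)\ge128$, such that the following holds. Let $0<\delta<1$, $d_0,K_0\ge1$, $L\ge0$, $R\ge1$ and $0<\varepsilon\le1/(100K_0)$, and put $\Lambda=\log\frac{d_0K_0R}{\varepsilon\delta}$. Then there is a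 $2(L+1)$-layer transformer $\mathrm{TF}_\Theta\in\mathcal F(2(L+1),D,D',M,B_\Theta)$ with $$D\le c(d_0+K_0),\quad D'\le c\,K_0R(R+d_0)\varepsilon^{-1}\Lambda^q,\quad M\le c,\quad\log B_\Theta\le c\,K_0R(R+d_0)\Lambda^q,$$ such that, with this one $\Theta$, for all $1\le d\le d_0$, all $2\le K\le K_0$, all $N\geq 1$ divisible by $K$, every GMM in $\mathbb{R}^d$ with $K$ components and $R_{\max}\le R$, and all initial values satisfying (A1) with constant $C$: if $$\frac{\tilde c_1}{(1-a)\pi_{\min}}\sqrt{\frac{R_{\max}(R_{\max}\vee d)\log(24K/\delta)}{N}}+\tilde c_2\Big(R_{\max}+d\Big(1+\sqrt{\tfrac{2\log(4N/\delta)}{d}}\Big)\Big)N\varepsilon<\frac12\Big(a-\frac12\Big)$$ and $$\epsilon(N,\varepsilon,\delta,a):=\frac{\tilde c_3}{(1-a)\pi_{\min}}\sqrt{\frac{Kd\log(\tilde CN/\delta)}{N}}+\tilde c_4\Big(\frac1{\pi_{\min}}+N\big(R_{\max}+d+\sqrt{2d\log(4N/\delta)}\big)\Big)\varepsilon<a(1-\beta),$$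 where $\tilde C=288K^2\big(\sqrt d+2R_{\max}+\frac1{1-a}\big)^2$, then for $N$ i.i.d. samples of the GMM, with probability at least $1-\delta$, $$D_\Theta^{\tt TF}\le a\beta^L+\frac1{1-\beta}\,\epsilon(N,\varepsilon,\delta,a).$$ -/

import Mathlib

open MeasureTheory ProbabilityTheory
open scoped Matrix Matrix.Norms.L2Operator

noncomputable section

namespace TGMM

/-! ### Transformers

Token coordinates are indexed by a finite type `ι`, so that tokens live in `ℝ^D` with
`D = Fintype.card ι`.  A sequence `H = [h_1, …, h_N]` is the family `H : Fin N → ι → ℝ` of its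
columns.  Matrices carry the `ℓ²` operator norm. -/

/-- `SoftMax v = (exp v_j / ∑ exp v_i)_j`. -/
def softmax {N : ℕ} (v : Fin N → ℝ) (j : Fin N) : ℝ :=
  Real.exp (v j) / ∑ i, Real.exp (v i)

/-- The value, query and key matrices of an attention head. -/
structure Head (ι : Type) where
  V : Matrix ι ι ℝ
  Q : Matrix ι ι ℝ
  K : Matrix ι ι ℝ

/-- One transformer layer: an attention layer with `heads` heads followed by a token-wise ReLU
network with `width` hidden units. -/
structure Layer (ι : Type) where
  heads : ℕ
  head : Fin heads → Head ι
  width : ℕ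
  W₁ : Matrix (Fin width) ι ℝ
  W₂ : Matrix ι (Fin width) ℝ

section Transformer

variable {ι : Type} [Fintype ι]

/-- `h_i ↦ h_i + ∑_m ∑_j SoftMax(((Q_m h_i)ᵀ (K_m h_j))_j)_j V_m h_j`. -/
def Layer.attn (T : Layer ι) {N : ℕ} (H : Fin N → ι → ℝ) : Fin N → ι → ℝ := fun i =>
  H i + ∑ m, ∑ j,
    softmax (fun l => ((T.head m).Q *ᵥ H i) ⬝ᵥ ((T.head m).K *ᵥ H l)) j • ((T.head m).V *ᵥ H j)

/-- `h_i ↦ h_i + W₂ σ(W₁ h_i)` with `σ` the ReLU function. -/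
def Layer.mlp (T : Layer ι) {N : ℕ} (H : Fin N → ι → ℝ) : Fin N → ι → ℝ := fun i =>
  H i + T.W₂ *ᵥ (fun r => max ((T.W₁ *ᵥ H i) r) 0)

/-- The transformer with the given list of layers, the head of the list being applied first. -/
def transformer (Θ : List (Layer ι)) {N : ℕ} (H : Fin N → ι → ℝ) : Fin N → ι → ℝ :=
  Θ.foldl (fun G T => T.mlp (T.attn G)) H

variable [DecidableEq ι]

/-- `max_m {‖Q_m‖, ‖K_m‖, ‖V_m‖} + ‖W₁‖ + ‖W₂‖` (the maximum is `0` if there are no heads). -/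
def Layer.norm (T : Layer ι) : ℝ :=
  (⨆ m, max (max ‖(T.head m).Q‖ ‖(T.head m).K‖) ‖(T.head m).V‖) + ‖T.W₁‖ + ‖T.W₂‖

/-- The maximum of the layer norms. -/
def transformerNorm (Θ : List (Layer ι)) : ℝ :=
  (Θ.map Layer.norm).foldr max 0

/-- The class `𝓕(L, D, D', M, B)` of `L`-layer transformers, with `D = Fintype.card ι`. -/
structure InClass (Θ : List (Layer ι)) (L D' M : ℕ) (B : ℝ) : Prop where
  length_eq : Θ.length = L
  norm_le : transformerNorm Θ ≤ B
  width_le : ∀ T ∈ Θ, T.width ≤ D'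
  heads_le : ∀ T ∈ Θ, T.heads ≤ M

end Transformer

/-! ### Gaussian mixtures -/

/-- Parameters of a unit-variance isotropic Gaussian mixture in `ℝ^d` with `K` components. -/
structure GMM (d K : ℕ) where
  weight : Fin K → ℝ
  mean : Fin K → EuclideanSpace ℝ (Fin d)
  weight_pos : ∀ i, 0 < weight i
  weight_sum : ∑ i, weight i = 1

namespace GMM

variable {d K : ℕ} (g : GMM d K)

/-- The law `∑_k π_k N(μ_k, I_d)`. -/
def law : Measure (EuclideanSpace ℝ (Fin d)) :=
  ∑ k, ENNReal.ofReal (g.weight k) •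
    (stdGaussian (EuclideanSpace ℝ (Fin d))).map (fun z => g.mean k + z)

/-- The law of `N` independent samples of the mixture. -/
def sampleLaw (N : ℕ) : Measure (Fin N → EuclideanSpace ℝ (Fin d)) :=
  Measure.pi fun _ => (g.law)

instance : IsProbabilityMeasure g.law := by
  constructor
  have h : ∀ k, (stdGaussian (EuclideanSpace ℝ (Fin d))).map (fun z => g.mean k + z)
      Set.univ = 1 := fun k => by
    rw [Measure.map_apply (by fun_prop) MeasurableSet.univ]
    simp
  simp only [law, Measure.coe_finsetSum, Finset.sum_apply, Measure.smul_apply, h, smul_eq_mul,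
    mul_one]
  rw [← ENNReal.ofReal_sum_of_nonneg fun i _ => (g.weight_pos i).le, g.weight_sum,
    ENNReal.ofReal_one]

/-- `π_min = min_i π_i`. -/
def piMin : ℝ := ⨅ i, g.weight i

/-- `ρ_π = max_i π_i / min_i π_i`. -/
def rho : ℝ := (⨆ i, g.weight i) / ⨅ i, g.weight i

/-- `R_min = min_{i ≠ j} ‖μ_i - μ_j‖`. -/
def Rmin : ℝ := ⨅ p : {p : Fin K × Fin K // p.1 ≠ p.2}, ‖g.mean p.1.1 - g.mean p.1.2‖

/-- `R_max = max_{i ≠ j} ‖μ_i - μ_j‖ ∨ max_i ‖μ_i‖`. -/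
def Rmax : ℝ :=
  max (⨆ p : {p : Fin K × Fin K // p.1 ≠ p.2}, ‖g.mean p.1.1 - g.mean p.1.2‖) (⨆ i, ‖g.mean i‖)

/-- Separation with constant `C`, and initial weights `π₀` and means `μ₀` close to the truth. -/
structure InitAssumption (C : ℝ) (π₀ : Fin K → ℝ) (μ₀ : Fin K → EuclideanSpace ℝ (Fin d)) :
    Prop where
  separation : C * √(Real.log (g.rho * K)) ≤ g.Rmin
  mean_init : ∀ i, ‖μ₀ i - g.mean i‖ ≤ g.Rmin / 16
  weight_init : ∀ i, |π₀ i - g.weight i| ≤ g.weight i / 2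

/-- The left-hand side of the first smallness condition. -/
def firstStepError (c₁ c₂ : ℝ) (N : ℕ) (ε δ a : ℝ) : ℝ :=
  c₁ / ((1 - a) * g.piMin) * √(g.Rmax * max g.Rmax d * Real.log (24 * K / δ) / N)
    + c₂ * (g.Rmax + d * (1 + √(2 * Real.log (4 * N / δ) / d))) * N * ε

/-- `C̃ = 288 K² (√d + 2 R_max + 1/(1-a))²`. -/
def logConst (a : ℝ) : ℝ := 288 * (K : ℝ) ^ 2 * (√d + 2 * g.Rmax + 1 / (1 - a)) ^ 2

/-- The error `ϵ(N, ε, δ, a)`. -/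
def stepError (c₃ c₄ : ℝ) (N : ℕ) (ε δ a : ℝ) : ℝ :=
  c₃ / ((1 - a) * g.piMin) * √(K * d * Real.log (g.logConst a * N / δ) / N)
    + c₄ * (1 / g.piMin + N * (g.Rmax + d + √(2 * d * Real.log (4 * N / δ)))) * ε

/-- `max_i {‖μ̂_i - μ_i‖ ∨ (|π̂_i - π_i| / π_i)}`. -/
def estimationError (πhat : Fin K → ℝ) (μhat : Fin K → EuclideanSpace ℝ (Fin d)) : ℝ :=
  ⨆ i, max ‖μhat i - g.mean i‖ (|πhat i - g.weight i| / g.weight i)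

end GMM

/-! ### Encoding of a task and read-out -/

/-- The coordinates of a token, listed from top to bottom: the padded sample, the log-weights, a
padded mean, its squared norm, three blocks of scratch space of length `K₀` (the last one is where
the weights are read out), `Dpad` further zeros, the constant `1`, and the unit vector of the
component that the token carries.  The dimension is `D = 2 d₀ + 5 K₀ + 2 + Dpad`. -/
inductive Row (d₀ K₀ Dpad : ℕ) : Type
  | x (i : Fin d₀)
  | logWeight (k : Fin K₀)
  | mean (i : Fin d₀)
  | sqNorm
  | resp (k : Fin K₀)
  | logResp (k : Fin K₀)
  | weight (k : Fin K₀)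
  | pad (i : Fin Dpad)
  | one
  | pos (k : Fin K₀)
  deriving DecidableEq, Fintype

variable {d₀ K₀ Dpad d K N : ℕ}

/-- The component carried by token `j`. -/
def comp (hK : 0 < K) (j : Fin N) : Fin K := ⟨j % K, Nat.mod_lt _ hK⟩

/-- The input sequence built from the samples `X` and the initial parameters `π₀`, `μ₀`. -/
def encode (hK : 0 < K) (π₀ : Fin K → ℝ) (μ₀ : Fin K → EuclideanSpace ℝ (Fin d))
    (X : Fin N → EuclideanSpace ℝ (Fin d)) (j : Fin N) : Row d₀ K₀ Dpad → ℝ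
  | .x i => if h : (i : ℕ) < d then X j ⟨i, h⟩ else 0
  | .logWeight k => if h : (k : ℕ) < K then Real.log (π₀ ⟨k, h⟩) else 0
  | .mean i => if h : (i : ℕ) < d then μ₀ (comp hK j) ⟨i, h⟩ else 0
  | .sqNorm => ‖μ₀ (comp hK j)‖ ^ 2
  | .resp _ => 0
  | .logResp _ => 0
  | .weight _ => 0
  | .pad _ => 0
  | .one => 1
  | .pos k => if (k : ℕ) = comp hK j then 1 else 0

/-- The columns of `Q_o`: `q_i = (K e_i, 0)`. -/
def readoutQuery (i : Fin K) : Fin K ⊕ Fin d → ℝ :=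
  Sum.elim (fun k => if k = i then (K : ℝ) else 0) (fun _ => 0)

/-- `K_o h`: the first `K` entries of the position block of `h`, followed by zeros. -/
def readoutKey (hK : K ≤ K₀) (h : Row d₀ K₀ Dpad → ℝ) : Fin K ⊕ Fin d → ℝ :=
  Sum.elim (fun k => h (.pos (Fin.castLE hK k))) (fun _ => 0)

/-- `V_o h`: the first `K` entries of the weight block and the first `d` of the mean block. -/
def readoutValue (hd : d ≤ d₀) (hK : K ≤ K₀) (h : Row d₀ K₀ Dpad → ℝ) : Fin K ⊕ Fin d → ℝ :=
  Sum.elim (fun k => h (.weight (Fin.castLE hK k))) (fun i => h (.mean (Fin.castLE hd i)))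

/-- The linear attentive pooling `O = (1/N) (V_o H) ((K_o H)ᵀ Q_o)`, of size `(K + d) × K`. -/
def pooled (hd : d ≤ d₀) (hK : K ≤ K₀) (H : Fin N → Row d₀ K₀ Dpad → ℝ) :
    Matrix (Fin K ⊕ Fin d) (Fin K) ℝ := fun r i =>
  1 / (N : ℝ) * ∑ j, readoutValue hd hK (H j) r *
    (readoutKey (d := d) hK (H j) ⬝ᵥ readoutQuery i)

/-- The estimated weights: the row means of the first `K` rows of the pooled matrix. -/
def readoutWeight (hd : d ≤ d₀) (hK : K ≤ K₀) (H : Fin N → Row d₀ K₀ Dpad → ℝ) (k : Fin K) : ℝ :=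
  1 / (K : ℝ) * ∑ i, pooled hd hK H (Sum.inl k) i

/-- The estimated means: the columns of the last `d` rows of the pooled matrix. -/
def readoutMean (hd : d ≤ d₀) (hK : K ≤ K₀) (H : Fin N → Row d₀ K₀ Dpad → ℝ) (k : Fin K) :
    EuclideanSpace ℝ (Fin d) :=
  WithLp.toLp 2 fun i => pooled hd hK H (Sum.inr i) k

/-- The error `D_Θ^TF` of the transformer `Θ` on the data `X` of the mixture `g`, when it is
initialized at `π₀`, `μ₀`. -/
def tfError (Θ : List (Layer (Row d₀ K₀ Dpad))) (g : GMM d K) (hd : d ≤ d₀) (hK : K ≤ K₀)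
    (hK' : 0 < K) (π₀ : Fin K → ℝ) (μ₀ : Fin K → EuclideanSpace ℝ (Fin d))
    (X : Fin N → EuclideanSpace ℝ (Fin d)) : ℝ :=
  g.estimationError
    (readoutWeight hd hK (transformer Θ (encode hK' π₀ μ₀ X)))
    (readoutMean hd hK (transformer Θ (encode hK' π₀ μ₀ X)))

end TGMM

end

/-! The transformer runs EM with two layers per step, and EM contracts when the mixture is well
separated.

Attention from the token of a sample `x` to a token carrying component `k` has score `log π_k +
⟪μ_k, x⟫ - ‖μ_k‖² / 2`, the log-posterior up to a term independent of `k`, so the softmax produces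
responsibilities. Since `K ∣ N`, every component sits on equally many tokens and the multiplicities
cancel. The ReLU network then takes logarithms. In the second layer a softmax over the samples
exponentiates them back and normalizes, which gives the new means, while a head with constant score
averages the responsibilities into the new weights. The only approximation is the replacement of
logarithm and square by piecewise linear interpolants; with these, the action on tokens is an exact
identity (`EMState.Carries.step`).

Population EM: a difference of softmaxes is a sum of cross products over pairs `k ≠ i`
(`abs_softmax_sub_le`). Weighting the mixture by the true responsibility of `k` restores the
Gaussian component `k` (`GMM.integral_trueResp_mul`), so each cross term is mass leaking between
components `i` and `k`, exponentially small in their squared distance, times a logit discrepancy of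
order `D`, the current error. The EM moments are therefore off by at most `D * π_i * leakage`
(`GMM.Near.abs_integral_resp_sub_le`), and a large separation constant makes `leakage ≤ β / 16`.

Sampling: later iterates depend on the data, so concentration has to hold uniformly in the
parameters. It follows from a polynomially fine grid in `K (d + 1)` dimensions, a finite net of
directions and Chernoff bounds. The exponential moments have a universal bound because
responsibilities suppress far away points (`GMM.Near.integral_exp_two_abs_le`). The initial value
may be far from the truth, but it is deterministic and costs a single extra grid point
(`GMM.le_sampleLaw_conc`).

The first step brings the error below `1 / 2 < a`; from then on `D` is replaced by at most `η + β
D`, and the geometric series gives the bound (`EMState.Approx.accurate_iterate`). -/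

noncomputable section

namespace TGMM

open scoped RealInnerProductSpace

/-! ### Gaussian integrals -/

section Gaussian

variable {d : ℕ}

/-- The standard Gaussian measure on `ℝ^d`. -/
abbrev gauss (d : ℕ) : Measure (EuclideanSpace ℝ (Fin d)) := stdGaussian _

lemma integral_cexp_pi_gaussian (c : Fin d → ℂ) :
    ∫ x : Fin d → ℝ, ∏ i, Complex.exp (c i * x i) ∂(Measure.pi fun _ => gaussianReal 0 1)
      = Complex.exp (∑ i, c i ^ 2 / 2) := by
  rw [integral_fintype_prod_eq_prod (f := fun i (x : ℝ) => Complex.exp (c i * x)), Complex.exp_sum]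
  refine Finset.prod_congr rfl fun i _ => ?_
  have := complexMGF_id_gaussianReal (μ := 0) (v := 1) (c i)
  simpa [complexMGF] using this

/-- A real tilt `v` and a frequency `t` together: `t = 0` yields the moment generating function, and
general `t` the characteristic function of the tilted measure, which is what the Cameron-Martin
formula compares. -/
lemma integral_cexp_stdGaussian (v t : EuclideanSpace ℝ (Fin d)) :
    ∫ x, Complex.exp (⟪v, x⟫ + ⟪x, t⟫ * Complex.I) ∂(gauss d)
      = Complex.exp (∑ i, ((v i : ℂ) + t i * Complex.I) ^ 2 / 2) := by
  rw [gauss, ← map_pi_eq_stdGaussian, integral_map (by fun_prop) (by fun_prop),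
    ← integral_cexp_pi_gaussian]
  congr 1 with x
  rw [← Complex.exp_sum]
  congr 1
  simp only [PiLp.inner_apply, RCLike.inner_apply, conj_trivial, Complex.ofReal_sum,
    Complex.ofReal_mul, Finset.sum_mul, ← Finset.sum_add_distrib]
  exact Finset.sum_congr rfl fun i _ => by ring

lemma integrable_exp_inner (v : EuclideanSpace ℝ (Fin d)) :
    Integrable (fun z => Real.exp ⟪v, z⟫) (gauss d) := by
  rw [gauss, ← map_pi_eq_stdGaussian, integrable_map_measure (by fun_prop) (by fun_prop)]
  have : ((fun z : EuclideanSpace ℝ (Fin d) => Real.exp ⟪v, z⟫) ∘ WithLp.toLp 2)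
      = fun x : Fin d → ℝ => ∏ i, Real.exp (v i * x i) := by
    ext x
    rw [← Real.exp_sum]
    simp [PiLp.inner_apply, mul_comm]
  rw [this]
  exact Integrable.fintype_prod (f := fun i (x : ℝ) => Real.exp (v i * x))
    fun i => integrable_exp_mul_gaussianReal (v i)

lemma integral_exp_inner (v : EuclideanSpace ℝ (Fin d)) :
    ∫ z, Real.exp ⟪v, z⟫ ∂(gauss d) = Real.exp (‖v‖ ^ 2 / 2) := by
  have h := integral_cexp_stdGaussian v 0
  have e : ∀ x : EuclideanSpace ℝ (Fin d),
      Complex.exp (⟪v, x⟫ + ⟪x, (0 : EuclideanSpace ℝ (Fin d))⟫ * Complex.I)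
        = ((Real.exp ⟪v, x⟫ : ℝ) : ℂ) := fun x => by simp
  simp_rw [e, integral_complex_ofReal] at h
  rw [EuclideanSpace.real_norm_sq_eq, Finset.sum_div]
  apply Complex.ofReal_injective
  rw [h]
  simp

/-- The Cameron-Martin formula in finite dimension. -/
lemma stdGaussian_map_const_add (v : EuclideanSpace ℝ (Fin d)) :
    (gauss d).map (fun z => v + z)
      = (gauss d).withDensity (fun x => ENNReal.ofReal (Real.exp (⟪v, x⟫ - ‖v‖ ^ 2 / 2))) := by
  have hint : Integrable (fun x => Real.exp (⟪v, x⟫ - ‖v‖ ^ 2 / 2)) (gauss d) := by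
    simp_rw [Real.exp_sub]
    exact (integrable_exp_inner v).div_const _
  have : IsFiniteMeasure ((gauss d).withDensity
      (fun x => ENNReal.ofReal (Real.exp (⟪v, x⟫ - ‖v‖ ^ 2 / 2)))) :=
    isFiniteMeasure_withDensity_ofReal hint.2
  have : IsProbabilityMeasure ((gauss d).map (fun z => v + z)) :=
    Measure.isProbabilityMeasure_map (by fun_prop)
  apply Measure.ext_of_charFun (E := EuclideanSpace ℝ (Fin d))
  ext t
  rw [charFun_apply, charFun_apply, integral_map (by fun_prop) (by fun_prop),
    integral_withDensity_eq_integral_toReal_smul (by fun_prop) (by simp)]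
  have h1 := integral_cexp_stdGaussian 0 t
  have h2 := integral_cexp_stdGaussian v t
  simp only [inner_zero_left, Complex.ofReal_zero, zero_add] at h1
  have e1 : ∀ z, Complex.exp (⟪v + z, t⟫ * Complex.I)
      = Complex.exp (⟪v, t⟫ * Complex.I) * Complex.exp (⟪z, t⟫ * Complex.I) := fun z => by
    rw [inner_add_left, ← Complex.exp_add]; push_cast; ring_nf
  have e2 : ∀ x, (ENNReal.ofReal (Real.exp (⟪v, x⟫ - ‖v‖ ^ 2 / 2))).toReal •
      Complex.exp (⟪x, t⟫ * Complex.I)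
      = Complex.exp (-(‖v‖ ^ 2 / 2 : ℝ)) * Complex.exp (⟪v, x⟫ + ⟪x, t⟫ * Complex.I) := fun x => by
    rw [ENNReal.toReal_ofReal (Real.exp_pos _).le, Complex.real_smul, Complex.ofReal_exp,
      ← Complex.exp_add, ← Complex.exp_add]
    push_cast; ring_nf
  simp_rw [e1, e2, integral_const_mul]
  rw [h1, h2, ← Complex.exp_add, ← Complex.exp_add]
  congr 1
  rw [EuclideanSpace.real_norm_sq_eq]
  simp only [PiLp.inner_apply, RCLike.inner_apply, conj_trivial, Complex.ofReal_sum,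
    Complex.ofReal_mul, Finset.sum_mul, Finset.sum_div, ← Finset.sum_neg_distrib,
    ← Finset.sum_add_distrib, Complex.ofReal_div, Complex.ofReal_pow]
  refine Finset.sum_congr rfl fun i _ => ?_
  simp only [mul_pow, add_sq, Complex.I_sq, PiLp.zero_apply]
  push_cast
  ring

/-- Hyperbolic cosines dominate `|⟪a, z⟫|` and, up to a factor `2`, `exp |⟪a, z⟫|`, yet are sums of
exponentials of linear forms. Bounds phrased with them reduce every Gaussian expectation to
`integral_exp_inner`. -/
lemma exp_mul_cosh_mul_cosh (v a b z : EuclideanSpace ℝ (Fin d)) :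
    Real.exp ⟪v, z⟫ * (Real.cosh ⟪a, z⟫ * Real.cosh ⟪b, z⟫)
      = 1 / 4 * (Real.exp ⟪v + a + b, z⟫ + Real.exp ⟪v + a - b, z⟫
        + Real.exp ⟪v - a + b, z⟫ + Real.exp ⟪v - a - b, z⟫) := by
  simp only [Real.cosh_eq, inner_add_left, sub_eq_add_neg, inner_neg_left,
    Real.exp_add]
  ring

lemma integrable_exp_cosh_cosh (v a b : EuclideanSpace ℝ (Fin d)) :
    Integrable (fun z => Real.exp ⟪v, z⟫ * (Real.cosh ⟪a, z⟫ * Real.cosh ⟪b, z⟫)) (gauss d) := by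
  simp_rw [exp_mul_cosh_mul_cosh]
  exact ((((integrable_exp_inner _).add (integrable_exp_inner _)).add
    (integrable_exp_inner _)).add (integrable_exp_inner _)).const_mul _

lemma integral_exp_cosh_cosh_le (v a b : EuclideanSpace ℝ (Fin d)) :
    ∫ z, Real.exp ⟪v, z⟫ * (Real.cosh ⟪a, z⟫ * Real.cosh ⟪b, z⟫) ∂(gauss d)
      ≤ Real.exp ((‖v‖ + ‖a‖ + ‖b‖) ^ 2 / 2) := by
  have key : ∀ u : EuclideanSpace ℝ (Fin d), ‖u‖ ≤ ‖v‖ + ‖a‖ + ‖b‖ →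
      Real.exp (‖u‖ ^ 2 / 2) ≤ Real.exp ((‖v‖ + ‖a‖ + ‖b‖) ^ 2 / 2) := fun u hu => by gcongr
  have i := fun u : EuclideanSpace ℝ (Fin d) => integrable_exp_inner u
  simp_rw [exp_mul_cosh_mul_cosh]
  rw [integral_const_mul, integral_add (by exact ((i _).add (i _)).add (i _)) (i _),
    integral_add (by exact (i _).add (i _)) (i _), integral_add (i _) (i _)]
  simp only [integral_exp_inner]
  have h1 := key (v + a + b) (norm_add₃_le)
  have h2 := key (v + a - b) ((norm_sub_le _ _).trans (by gcongr; exact norm_add_le _ _))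
  have h3 := key (v - a + b) ((norm_add_le _ _).trans (by gcongr; exact norm_sub_le _ _))
  have h4 := key (v - a - b) ((norm_sub_le _ _).trans (by gcongr; exact norm_sub_le _ _))
  linarith

lemma abs_le_cosh (y : ℝ) : |y| ≤ Real.cosh y := by
  rw [← Real.cosh_abs]
  have h1 := Real.self_le_sinh_iff.2 (abs_nonneg y)
  exact h1.trans (Real.sinh_lt_cosh _).le

lemma exp_abs_le_cosh (y : ℝ) : Real.exp |y| ≤ 2 * Real.cosh y := by
  rw [← Real.cosh_abs, Real.cosh_eq]
  have := Real.exp_pos (-|y|)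
  linarith

end Gaussian

/-! ### Softmax -/

section Softmax

variable {K : ℕ} (ℓ ℓ' : Fin K → ℝ)

lemma sum_exp_pos (i : Fin K) : 0 < ∑ k, Real.exp (ℓ k) :=
  Finset.sum_pos (fun _ _ => Real.exp_pos _) ⟨i, Finset.mem_univ i⟩

lemma softmax_pos (i : Fin K) : 0 < softmax ℓ i :=
  div_pos (Real.exp_pos _) (sum_exp_pos ℓ i)

lemma sum_softmax (i : Fin K) : ∑ k, softmax ℓ k = 1 := by
  simp only [softmax, ← Finset.sum_div]
  exact div_self (sum_exp_pos ℓ i).ne'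

lemma softmax_le_one (i : Fin K) : softmax ℓ i ≤ 1 := by
  rw [← sum_softmax ℓ i]
  exact Finset.single_le_sum (fun k _ => (softmax_pos ℓ k).le) (Finset.mem_univ i)

lemma softmax_eq_exp_sub_mul (i k : Fin K) :
    softmax ℓ i = Real.exp (ℓ i - ℓ k) * softmax ℓ k := by
  rw [softmax, softmax, Real.exp_sub]
  field_simp

lemma softmax_le_exp_sub (i k : Fin K) : softmax ℓ i ≤ Real.exp (ℓ i - ℓ k) := by
  rw [softmax_eq_exp_sub_mul ℓ i k]
  exact mul_le_of_le_one_right (Real.exp_pos _).le (softmax_le_one ℓ k)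

/-- A number in `[0, 1]` is at most its square root. Halving the exponent is essential: the Gaussian
integral of `exp ⟪v, z⟫` costs `‖v‖² / 2`, which would exceed the gain `3 / 7 * ‖v‖²` of
`Near.logit_sub_le`, whereas `v / 2` costs only `‖v‖² / 8` against half the gain. -/
lemma softmax_le_exp_half_sub (i k : Fin K) :
    softmax ℓ i ≤ Real.exp ((ℓ i - ℓ k) / 2) := by
  have h0 := (softmax_pos ℓ i).le
  have h1 := softmax_le_one ℓ i
  have h2 := softmax_le_exp_sub ℓ i k
  refine le_of_sq_le_sq ?_ (Real.exp_pos _).le |>.trans le_rfl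
  rw [← Real.exp_nat_mul]
  calc softmax ℓ i ^ 2 ≤ softmax ℓ i := by nlinarith
    _ ≤ _ := h2.trans_eq (by push_cast; ring_nf)

/-- The cap by `1` keeps the bound useful when nothing is known about `y`; the factor `exp y + 1`
becomes a sum of two cross products of softmaxes. -/
lemma abs_exp_sub_one_le (y : ℝ) : |Real.exp y - 1| ≤ min 1 |y| * (Real.exp y + 1) := by
  have h1 := Real.add_one_le_exp y
  have h2 := Real.add_one_le_exp (-y)
  have h3 := Real.exp_pos y
  have h4 : Real.exp (-y) * Real.exp y = 1 := by rw [← Real.exp_add]; simp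
  rcases le_total 0 y with hy | hy
  · have h5 : 1 ≤ Real.exp y := by linarith
    rw [abs_of_nonneg (by linarith), abs_of_nonneg hy, min_mul_of_nonneg _ _ (by linarith)]
    refine le_min (by linarith) ?_
    nlinarith
  · have h5 : Real.exp y ≤ 1 := Real.exp_le_one_iff.2 hy
    rw [abs_of_nonpos (by linarith), abs_of_nonpos hy, min_mul_of_nonneg _ _ (by linarith)]
    refine le_min (by linarith) ?_
    nlinarith

/-- The normalizations cancel in the ratio of the two cross products, which is the exponential of a
difference of logit discrepancies. -/
lemma abs_softmax_mul_sub_le (i k : Fin K) :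
    |softmax ℓ i * softmax ℓ' k - softmax ℓ k * softmax ℓ' i|
      ≤ min 1 |(ℓ i - ℓ' i) - (ℓ k - ℓ' k)| *
        (softmax ℓ i * softmax ℓ' k + softmax ℓ k * softmax ℓ' i) := by
  have hp : 0 < softmax ℓ k * softmax ℓ' i := mul_pos (softmax_pos _ _) (softmax_pos _ _)
  have e : softmax ℓ i * softmax ℓ' k
      = Real.exp ((ℓ i - ℓ' i) - (ℓ k - ℓ' k)) * (softmax ℓ k * softmax ℓ' i) := by
    rw [softmax_eq_exp_sub_mul ℓ i k, softmax_eq_exp_sub_mul ℓ' k i]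
    rw [show (ℓ i - ℓ' i) - (ℓ k - ℓ' k) = (ℓ i - ℓ k) + (ℓ' k - ℓ' i) by ring, Real.exp_add]
    ring
  rw [e, ← sub_one_mul, ← add_one_mul, abs_mul, abs_of_pos hp, ← mul_assoc (min _ _)]
  exact mul_le_mul_of_nonneg_right (abs_exp_sub_one_le _) hp.le

/-- Multiply each softmax by the total mass `1` of the other; the diagonal term cancels, and only
products pairing `i` with another index survive. These are small for separated components. -/
lemma softmax_sub_eq_sum (i : Fin K) :
    softmax ℓ i - softmax ℓ' i
      = ∑ k ∈ Finset.univ.erase i,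
        (softmax ℓ i * softmax ℓ' k - softmax ℓ k * softmax ℓ' i) := by
  have : softmax ℓ i - softmax ℓ' i
      = ∑ k, (softmax ℓ i * softmax ℓ' k - softmax ℓ k * softmax ℓ' i) := by
    rw [Finset.sum_sub_distrib, ← Finset.mul_sum, ← Finset.sum_mul, sum_softmax ℓ i,
      sum_softmax ℓ' i]
    ring
  rw [this, ← Finset.add_sum_erase _ _ (Finset.mem_univ i)]
  ring

lemma abs_softmax_sub_le (i : Fin K) :
    |softmax ℓ i - softmax ℓ' i|
      ≤ ∑ k ∈ Finset.univ.erase i, min 1 |(ℓ i - ℓ' i) - (ℓ k - ℓ' k)| *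
        (softmax ℓ i * softmax ℓ' k + softmax ℓ k * softmax ℓ' i) := by
  rw [softmax_sub_eq_sum]
  exact (Finset.abs_sum_le_sum_abs _ _).trans
    (Finset.sum_le_sum fun k _ => abs_softmax_mul_sub_le ℓ ℓ' i k)

lemma abs_softmax_sub_le_of_forall {η : ℝ} (h : ∀ k, |ℓ k - ℓ' k| ≤ η) (i : Fin K) :
    |softmax ℓ i - softmax ℓ' i| ≤ 4 * η := by
  have hη : 0 ≤ η := (abs_nonneg _).trans (h i)
  have hp := fun k => (softmax_pos ℓ k).le
  have hp' := fun k => (softmax_pos ℓ' k).le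
  calc |softmax ℓ i - softmax ℓ' i|
      ≤ ∑ k ∈ Finset.univ.erase i, min 1 |(ℓ i - ℓ' i) - (ℓ k - ℓ' k)| *
        (softmax ℓ i * softmax ℓ' k + softmax ℓ k * softmax ℓ' i) := abs_softmax_sub_le _ _ _
    _ ≤ ∑ k ∈ Finset.univ.erase i, (2 * η) *
        (softmax ℓ i * softmax ℓ' k + softmax ℓ k * softmax ℓ' i) := by
      refine Finset.sum_le_sum fun k _ => mul_le_mul_of_nonneg_right ?_
        (add_nonneg (mul_nonneg (hp _) (hp' _)) (mul_nonneg (hp _) (hp' _)))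
      refine (min_le_right _ _).trans ((abs_sub _ _).trans ?_)
      linarith [h i, h k]
    _ ≤ ∑ k, (2 * η) * (softmax ℓ i * softmax ℓ' k + softmax ℓ k * softmax ℓ' i) :=
      Finset.sum_le_sum_of_subset_of_nonneg (Finset.erase_subset _ _) fun k _ _ =>
        mul_nonneg (by linarith)
          (add_nonneg (mul_nonneg (hp _) (hp' _)) (mul_nonneg (hp _) (hp' _)))
    _ = 2 * η * (softmax ℓ i + softmax ℓ' i) := by
      rw [← Finset.mul_sum, Finset.sum_add_distrib, ← Finset.mul_sum, ← Finset.sum_mul,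
        sum_softmax ℓ i, sum_softmax ℓ' i]
      ring
    _ ≤ 4 * η := by nlinarith [softmax_le_one ℓ i, softmax_le_one ℓ' i]

end Softmax

/-! ### Responsibilities -/

section Resp

variable {d K : ℕ}

/-- The unnormalized log-posterior of the components given `x`. -/
def logit (lam : Fin K → ℝ) (m : Fin K → EuclideanSpace ℝ (Fin d)) (x : EuclideanSpace ℝ (Fin d))
    (k : Fin K) : ℝ :=
  lam k + ⟪m k, x⟫ - ‖m k‖ ^ 2 / 2

/-- The responsibility of component `i` for `x` under log-weights `lam` and means `m`. -/
def resp (lam : Fin K → ℝ) (m : Fin K → EuclideanSpace ℝ (Fin d)) (i : Fin K)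
    (x : EuclideanSpace ℝ (Fin d)) : ℝ :=
  softmax (logit lam m x) i

lemma continuous_resp (lam : Fin K → ℝ) (m : Fin K → EuclideanSpace ℝ (Fin d)) (i : Fin K) :
    Continuous (resp lam m i) := by
  unfold resp softmax logit
  refine Continuous.div (by fun_prop) (by fun_prop) fun x => ?_
  exact (sum_exp_pos (fun k => lam k + ⟪m k, x⟫ - ‖m k‖ ^ 2 / 2) i).ne'

lemma resp_pos (lam : Fin K → ℝ) (m : Fin K → EuclideanSpace ℝ (Fin d)) (i : Fin K)
    (x : EuclideanSpace ℝ (Fin d)) : 0 < resp lam m i x := softmax_pos _ _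

lemma resp_le_one (lam : Fin K → ℝ) (m : Fin K → EuclideanSpace ℝ (Fin d)) (i : Fin K)
    (x : EuclideanSpace ℝ (Fin d)) : resp lam m i x ≤ 1 := softmax_le_one _ _

end Resp

/-! ### Integrals against the mixture and change of measure to its components. -/

namespace GMM

variable {d K : ℕ} (g : GMM d K)

/-- The logarithms of the weights. -/
def logWeight (k : Fin K) : ℝ := Real.log (g.weight k)

/-- The responsibilities under the true parameters. -/
def trueResp (i : Fin K) (x : EuclideanSpace ℝ (Fin d)) : ℝ := resp g.logWeight g.mean i x

lemma integrable_law {F : EuclideanSpace ℝ (Fin d) → ℝ} (hF : Continuous F)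
    (h : ∀ k, Integrable (fun z => F (g.mean k + z)) (gauss d)) : Integrable F g.law := by
  rw [law, integrable_finsetSum_measure]
  refine fun k _ => Integrable.smul_measure ?_ ENNReal.ofReal_ne_top
  rw [integrable_map_measure hF.aestronglyMeasurable (by fun_prop)]
  exact h k

lemma integral_law {F : EuclideanSpace ℝ (Fin d) → ℝ} (hF : Continuous F)
    (h : ∀ k, Integrable (fun z => F (g.mean k + z)) (gauss d)) :
    ∫ x, F x ∂g.law = ∑ k, g.weight k * ∫ z, F (g.mean k + z) ∂(gauss d) := by
  rw [law, integral_finsetSum_measure]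
  · refine Finset.sum_congr rfl fun k _ => ?_
    rw [integral_smul_measure, integral_map (by fun_prop) hF.aestronglyMeasurable,
      ENNReal.toReal_ofReal (g.weight_pos k).le, smul_eq_mul]
  · refine fun k _ => Integrable.smul_measure ?_ ENNReal.ofReal_ne_top
    rw [integrable_map_measure hF.aestronglyMeasurable (by fun_prop)]
    exact h k

lemma exp_logit_true (x : EuclideanSpace ℝ (Fin d)) (k : Fin K) :
    Real.exp (logit g.logWeight g.mean x k)
      = g.weight k * Real.exp (⟪g.mean k, x⟫ - ‖g.mean k‖ ^ 2 / 2) := by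
  rw [logit, add_sub_assoc, Real.exp_add, logWeight, Real.exp_log (g.weight_pos k)]

/-- By Cameron-Martin, the density with respect to the standard Gaussian is the normalizing sum in
the softmax of the true responsibilities. -/
lemma law_eq_withDensity :
    g.law = (gauss d).withDensity
      (fun x => ENNReal.ofReal (∑ k, Real.exp (logit g.logWeight g.mean x k))) := by
  have h : (fun x => ENNReal.ofReal (∑ k, Real.exp (logit g.logWeight g.mean x k)))
      = ∑ k, fun x => ENNReal.ofReal (g.weight k) *
        ENNReal.ofReal (Real.exp (⟪g.mean k, x⟫ - ‖g.mean k‖ ^ 2 / 2)) := by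
    ext x
    rw [ENNReal.ofReal_sum_of_nonneg fun k _ => (Real.exp_pos _).le, Finset.sum_apply]
    refine Finset.sum_congr rfl fun k _ => ?_
    rw [exp_logit_true, ENNReal.ofReal_mul (g.weight_pos k).le]
  rw [h, law]
  ext s hs
  rw [withDensity_apply _ hs]
  simp only [Finset.sum_apply]
  rw [lintegral_finsetSum _ (fun k _ => by fun_prop)]
  simp only [Measure.coe_finsetSum, Finset.sum_apply, Measure.smul_apply, smul_eq_mul]
  refine Finset.sum_congr rfl fun k _ => ?_
  rw [stdGaussian_map_const_add, withDensity_apply _ hs, lintegral_const_mul _ (by fun_prop)]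

/-- Weighting the mixture by a true responsibility singles out that component. -/
lemma integral_trueResp_mul (k : Fin K) (F : EuclideanSpace ℝ (Fin d) → ℝ) (hF : Continuous F) :
    ∫ x, g.trueResp k x * F x ∂g.law = g.weight k * ∫ z, F (g.mean k + z) ∂(gauss d) := by
  have hc : Continuous fun x => ∑ k, Real.exp (logit g.logWeight g.mean x k) := by
    unfold logit; fun_prop
  -- The mixture density is the denominator of `trueResp`, so their product is the `k`-th
  -- exponential alone, the density of component `k` times its weight. Both integrands agree
  -- pointwise, so no integrability is needed.
  rw [law_eq_withDensity, integral_withDensity_eq_integral_toReal_smul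
    (by exact hc.measurable.ennreal_ofReal) (by simp)]
  rw [← integral_map (φ := fun z => g.mean k + z) (by fun_prop) hF.aestronglyMeasurable,
    stdGaussian_map_const_add, integral_withDensity_eq_integral_toReal_smul
    (by fun_prop) (by simp), ← integral_const_mul]
  congr 1 with x
  rw [ENNReal.toReal_ofReal (sum_exp_pos _ k).le, ENNReal.toReal_ofReal (Real.exp_pos _).le,
    smul_eq_mul, smul_eq_mul, ← mul_assoc, ← mul_assoc, ← exp_logit_true, trueResp, resp, softmax,
    mul_div_cancel₀ _ (sum_exp_pos _ k).ne']

end GMM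

namespace GMM

variable {d K : ℕ} (g : GMM d K)

/-! ### Elementary facts about the parameters of a mixture -/

lemma piMin_le (i : Fin K) : g.piMin ≤ g.weight i :=
  ciInf_le (Set.finite_range _).bddBelow i

lemma piMin_pos (i : Fin K) : 0 < g.piMin := by
  have : Nonempty (Fin K) := ⟨i⟩
  obtain ⟨j, hj⟩ := exists_eq_ciInf_of_finite (f := g.weight)
  rw [piMin, ← hj]
  exact g.weight_pos j

lemma weight_le_one (i : Fin K) : g.weight i ≤ 1 := by
  rw [← g.weight_sum]
  exact Finset.single_le_sum (fun k _ => (g.weight_pos k).le) (Finset.mem_univ i)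

lemma weight_le_rho_mul (i k : Fin K) : g.weight k ≤ g.rho * g.weight i := by
  have h1 : g.weight k ≤ ⨆ j, g.weight j := le_ciSup (Set.finite_range _).bddAbove k
  have h2 := g.piMin_pos i
  have h3 := g.piMin_le i
  have h4 : (⨆ j, g.weight j) = g.rho * g.piMin := by
    rw [rho, ← piMin, div_mul_cancel₀ _ h2.ne']
  have h5 : 0 ≤ g.rho := by
    by_contra! h
    have := g.weight_pos k
    nlinarith
  nlinarith

lemma one_le_rho (i : Fin K) : 1 ≤ g.rho := by
  have := g.weight_le_rho_mul i i
  have := g.weight_pos i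
  by_contra! h
  nlinarith

lemma Rmin_le {i k : Fin K} (h : i ≠ k) : g.Rmin ≤ ‖g.mean i - g.mean k‖ :=
  ciInf_le (f := fun p : {p : Fin K × Fin K // p.1 ≠ p.2} => ‖g.mean p.1.1 - g.mean p.1.2‖)
    (Set.finite_range _).bddBelow ⟨(i, k), h⟩

lemma norm_mean_le_Rmax (i : Fin K) : ‖g.mean i‖ ≤ g.Rmax :=
  (le_ciSup (f := fun i => ‖g.mean i‖) (Set.finite_range _).bddAbove i).trans (le_max_right _ _)

variable {g}

lemma InitAssumption.log_le {C : ℝ} {π₀ : Fin K → ℝ} {μ₀ : Fin K → EuclideanSpace ℝ (Fin d)}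
    (h : g.InitAssumption C π₀ μ₀) (hK : 2 ≤ K) (hC : 0 ≤ C) :
    C ^ 2 * Real.log (g.rho * K) ≤ g.Rmin ^ 2 ∧ Real.log 2 ≤ Real.log (g.rho * K) ∧
      0 ≤ g.Rmin := by
  have i : Fin K := ⟨0, by omega⟩
  have hρ := g.one_le_rho i
  have hK' : (2 : ℝ) ≤ K := by exact_mod_cast hK
  have h2 : Real.log 2 ≤ Real.log (g.rho * K) :=
    Real.log_le_log (by norm_num) (by nlinarith)
  have h0 : 0 ≤ Real.log (g.rho * K) := (Real.log_nonneg (by norm_num)).trans h2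
  have h3 := h.separation
  have h4 : 0 ≤ C * √(Real.log (g.rho * K)) := by positivity
  refine ⟨?_, h2, h4.trans h3⟩
  calc C ^ 2 * Real.log (g.rho * K) = (C * √(Real.log (g.rho * K))) ^ 2 := by
        rw [mul_pow, Real.sq_sqrt h0]
    _ ≤ _ := by gcongr

/-- Because `log (ρ K) ≥ log 2` and `128² * log 2 > 100²`. -/
lemma InitAssumption.hundred_le_Rmin {C : ℝ} {π₀ : Fin K → ℝ}
    {μ₀ : Fin K → EuclideanSpace ℝ (Fin d)}
    (h : g.InitAssumption C π₀ μ₀) (hK : 2 ≤ K) (hC : 128 ≤ C) : 100 ≤ g.Rmin := by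
  obtain ⟨h1, h2, h3⟩ := h.log_le hK (by linarith)
  have := Real.log_two_gt_d9
  nlinarith

/-- The factor by which the population EM operator contracts. -/
def leakage (g : GMM d K) : ℝ := 12 * (g.rho * K * Real.exp (-g.Rmin ^ 2 / 40))

/-- `R_min² / 40 ≥ 3.2 * C * log (ρ K)` swallows the factor `ρ K` and still leaves `exp (-C) ≤ 1 /
C`, so the separation constant depends only on the wanted contraction factor. -/
lemma InitAssumption.leakage_le {C b : ℝ} {π₀ : Fin K → ℝ} {μ₀ : Fin K → EuclideanSpace ℝ (Fin d)}
    (h : g.InitAssumption C π₀ μ₀) (hK : 2 ≤ K) (hC : 128 ≤ C) (hb : 0 < b) (hC' : 12 / b ≤ C) :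
    g.leakage ≤ b := by
  obtain ⟨h1, h2, h3⟩ := h.log_le hK (by linarith)
  have hl := Real.log_two_gt_d9
  have i : Fin K := ⟨0, by omega⟩
  have hρ := g.one_le_rho i
  have hK' : (2 : ℝ) ≤ K := by exact_mod_cast hK
  have hp : 0 < g.rho * K := by nlinarith
  have e : g.rho * K * Real.exp (-g.Rmin ^ 2 / 40) ≤ Real.exp (-C) := by
    nth_rewrite 1 [← Real.exp_log hp]
    rw [← Real.exp_add]
    apply Real.exp_le_exp.2
    have h4 : 128 * C * Real.log (g.rho * K) ≤ C ^ 2 * Real.log (g.rho * K) := by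
      rw [sq]; gcongr; linarith
    have h5 : C * (1 / 2) ≤ C * Real.log (g.rho * K) := by gcongr; linarith
    have h6 : 1 * Real.log (g.rho * K) ≤ C * Real.log (g.rho * K) := by
      gcongr <;> linarith
    nlinarith
  have h5 : Real.exp (-C) ≤ 1 / C := by
    rw [Real.exp_neg, ← one_div]
    exact one_div_le_one_div_of_le (by linarith) (by linarith [Real.add_one_le_exp C])
  have h6 : 12 / C ≤ b := by
    rw [div_le_iff₀ (by linarith)]
    rw [div_le_iff₀ hb] at hC'
    linarith
  calc g.leakage ≤ 12 * (1 / C) := by unfold leakage; linarith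
    _ ≤ b := by rw [mul_one_div]; exact h6

/-- Parameters close enough to the truth for the responsibilities to separate the components. -/
structure Near (g : GMM d K) (lam : Fin K → ℝ) (m : Fin K → EuclideanSpace ℝ (Fin d)) : Prop where
  hundred_le_Rmin : 100 ≤ g.Rmin
  mean : ∀ k, ‖m k - g.mean k‖ ≤ g.Rmin / 16
  logWeight : ∀ k, |lam k - g.logWeight k| ≤ 1

lemma logit_sub_logit (lam : Fin K → ℝ) (m : Fin K → EuclideanSpace ℝ (Fin d)) (i k : Fin K)
    (μ z : EuclideanSpace ℝ (Fin d)) :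
    logit lam m (μ + z) i - logit lam m (μ + z) k
      = (lam i - lam k) + ⟪m i - m k, z⟫ - ‖m i - m k‖ ^ 2 / 2 + ⟪m i - m k, μ - m k⟫ := by
  simp only [logit, inner_add_right, inner_sub_left, inner_sub_right, norm_sub_sq_real,
    real_inner_self_eq_norm_sq]
  ring

/-! ### Contraction of the population EM operator. -/

section Near

variable {lam : Fin K → ℝ} {m : Fin K → EuclideanSpace ℝ (Fin d)}

lemma Near.dist_lower (h : g.Near lam m) {i k : Fin K} (hik : i ≠ k) :
    7 / 8 * ‖g.mean i - g.mean k‖ ≤ ‖m i - m k‖ := by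
  have h1 := h.mean i
  have h2 := h.mean k
  have h3 := g.Rmin_le hik
  have h4 : g.mean i - g.mean k = (m i - m k) - (m i - g.mean i) + (m k - g.mean k) := by abel
  have h5 : ‖g.mean i - g.mean k‖ ≤ ‖m i - m k‖ + ‖m i - g.mean i‖ + ‖m k - g.mean k‖ := by
    rw [h4]
    exact (norm_add_le _ _).trans (by gcongr; exact norm_sub_le _ _)
  linarith

lemma Near.logit_sub_le (h : g.Near lam m) {i k : Fin K} (hik : i ≠ k)
    (z : EuclideanSpace ℝ (Fin d)) :
    logit lam m (g.mean k + z) i - logit lam m (g.mean k + z) k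
      ≤ (g.logWeight i - g.logWeight k + 2) + ⟪m i - m k, z⟫ - 3 / 7 * ‖m i - m k‖ ^ 2 := by
  rw [logit_sub_logit]
  have h1 := h.dist_lower hik
  have h2 := h.mean k
  have h3 := g.Rmin_le hik
  have h4 := abs_le.1 (h.logWeight i)
  have h5 := abs_le.1 (h.logWeight k)
  -- `R_min / 16` is at most `‖m i - m k‖ / 14` by `dist_lower`, and `1/2 - 1/14 = 3/7`.
  have h6 : ⟪m i - m k, g.mean k - m k⟫ ≤ ‖m i - m k‖ * (‖m i - m k‖ / 14) := by
    refine (real_inner_le_norm _ _).trans ?_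
    rw [norm_sub_rev (g.mean k)]
    gcongr
    linarith
  linarith

/-- The responsibility of a wrong component, with the cosines as room for test functions of linear
or exponential growth: half the logit gain beats the cost of the Gaussian integral. -/
lemma Near.integral_resp_le (h : g.Near lam m) {i k : Fin K} (hik : i ≠ k)
    {a b : EuclideanSpace ℝ (Fin d)} (ha : ‖a‖ ≤ 1) (hb : ‖b‖ ≤ 1) :
    ∫ z, resp lam m i (g.mean k + z) * (Real.cosh ⟪a, z⟫ * Real.cosh ⟪b, z⟫) ∂(gauss d)
      ≤ Real.exp (1 + (g.logWeight i - g.logWeight k) / 2)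
        * Real.exp (-‖g.mean i - g.mean k‖ ^ 2 / 20) := by
  set V := ‖m i - m k‖ with hV
  set R := ‖g.mean i - g.mean k‖ with hR
  set c := 1 + (g.logWeight i - g.logWeight k) / 2 with hc
  have hcosh : ∀ z, 0 ≤ Real.cosh ⟪a, z⟫ * Real.cosh ⟪b, z⟫ := fun z =>
    mul_nonneg (Real.cosh_pos _).le (Real.cosh_pos _).le
  have pt : ∀ z, resp lam m i (g.mean k + z) * (Real.cosh ⟪a, z⟫ * Real.cosh ⟪b, z⟫)
      ≤ Real.exp (c - 3 / 14 * V ^ 2) * (Real.exp ⟪(1 / 2 : ℝ) • (m i - m k), z⟫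
        * (Real.cosh ⟪a, z⟫ * Real.cosh ⟪b, z⟫)) := fun z => by
    rw [← mul_assoc (Real.exp _), ← Real.exp_add]
    refine mul_le_mul_of_nonneg_right ?_ (hcosh z)
    refine (softmax_le_exp_half_sub _ i k).trans (Real.exp_le_exp.2 ?_)
    have := h.logit_sub_le hik z
    rw [real_inner_smul_left]
    linarith
  calc _ ≤ ∫ z, Real.exp (c - 3 / 14 * V ^ 2) * (Real.exp ⟪(1 / 2 : ℝ) • (m i - m k), z⟫
        * (Real.cosh ⟪a, z⟫ * Real.cosh ⟪b, z⟫)) ∂(gauss d) :=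
        integral_mono_of_nonneg (.of_forall fun z => mul_nonneg (resp_pos _ _ _ _).le (hcosh z))
          ((integrable_exp_cosh_cosh _ _ _).const_mul _) (.of_forall pt)
    _ ≤ Real.exp (c - 3 / 14 * V ^ 2) * Real.exp ((1 / 2 * V + 1 + 1) ^ 2 / 2) := by
        rw [integral_const_mul]
        refine mul_le_mul_of_nonneg_left ((integral_exp_cosh_cosh_le _ _ _).trans ?_)
          (Real.exp_pos _).le
        rw [norm_smul, ← hV]
        norm_num
        gcongr
    _ ≤ _ := by
        rw [← Real.exp_add, ← Real.exp_add]
        apply Real.exp_le_exp.2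
        -- The quadratic part is `-(3/14 - 1/8) * V² ≤ -(5/56) * (49/64) * R²`, about `-0.068 * R²`;
        -- the linear remainder fits below `-R² / 20` since `R ≥ 100`.
        have h1 : 7 / 8 * R ≤ V := h.dist_lower hik
        have h2 : 100 ≤ R := h.hundred_le_Rmin.trans (g.Rmin_le hik)
        nlinarith

/-- Up to the factor `exp 1`, both left-hand sides are the geometric mean of the two weights.
Bounding it by a multiple of `π_i`, whichever weight is the larger, is what makes the final errors
relative to `π_i`. -/
lemma weight_mul_exp_half_le (i k : Fin K) :
    g.weight i * Real.exp (1 + (g.logWeight k - g.logWeight i) / 2)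
        ≤ Real.exp 1 * (g.weight i * g.rho) ∧
      g.weight k * Real.exp (1 + (g.logWeight i - g.logWeight k) / 2)
        ≤ Real.exp 1 * (g.weight i * g.rho) := by
  have hi := g.weight_pos i
  have hk := g.weight_pos k
  have hρ := g.one_le_rho i
  have e : g.logWeight k - g.logWeight i ≤ Real.log g.rho := by
    rw [logWeight, logWeight, ← Real.log_div hk.ne' hi.ne']
    refine Real.log_le_log (by positivity) ?_
    rw [div_le_iff₀ hi]
    exact g.weight_le_rho_mul i k
  have e1 : Real.exp ((g.logWeight k - g.logWeight i) / 2) ≤ g.rho := by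
    rw [← Real.log_le_log_iff (Real.exp_pos _) (by linarith), Real.log_exp]
    have := Real.log_nonneg hρ
    linarith
  have e2 : g.weight k * Real.exp (1 + (g.logWeight i - g.logWeight k) / 2)
      = g.weight i * Real.exp (1 + (g.logWeight k - g.logWeight i) / 2) := by
    rw [← Real.exp_log hi, ← Real.exp_log hk, ← Real.exp_add, ← Real.exp_add]
    simp only [logWeight]
    ring_nf
  have e3 : g.weight i * Real.exp (1 + (g.logWeight k - g.logWeight i) / 2)
      ≤ Real.exp 1 * (g.weight i * g.rho) := by
    rw [Real.exp_add]
    have : 0 < Real.exp 1 * g.weight i := by positivity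
    nlinarith
  exact ⟨e3, e2 ▸ e3⟩

lemma integrable_cosh (u : EuclideanSpace ℝ (Fin d)) :
    Integrable (fun z => Real.cosh ⟪u, z⟫) (gauss d) := by
  simpa using integrable_exp_cosh_cosh 0 u 0

/-- One-sided term in the comparison of responsibilities: the mass that component `k` gives
to component `i`. -/
lemma Near.integral_resp_mul_le (h : g.Near lam m) {i k : Fin K} (hik : i ≠ k)
    {a b u : EuclideanSpace ℝ (Fin d)} (ha : ‖a‖ ≤ 1) (hb : ‖b‖ ≤ 1) (hu : ‖u‖ ≤ 1) {D : ℝ}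
    (hD : 0 ≤ D) {F : EuclideanSpace ℝ (Fin d) → ℝ} (hF0 : ∀ z, 0 ≤ F z)
    (hF : ∀ z, F z ≤ D * (5 + ‖g.mean i - g.mean k‖) * (Real.cosh ⟪a, z⟫ + Real.cosh ⟪b, z⟫) *
      ((1 + ‖g.mean i - g.mean k‖) * Real.cosh ⟪u, z⟫)) :
    ∫ z, resp lam m i (g.mean k + z) * F z ∂(gauss d)
      ≤ 2 * D * Real.exp (1 + (g.logWeight i - g.logWeight k) / 2)
        * Real.exp (-g.Rmin ^ 2 / 40) := by
  set R := ‖g.mean i - g.mean k‖ with hR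
  have hRm : g.Rmin ≤ R := g.Rmin_le hik
  have h100 := h.hundred_le_Rmin
  have hint : ∀ a u : EuclideanSpace ℝ (Fin d), Integrable (fun z => resp lam m i (g.mean k + z) *
      (Real.cosh ⟪a, z⟫ * Real.cosh ⟪u, z⟫)) (gauss d) := fun a u => by
    have := integrable_exp_cosh_cosh 0 a u
    simp only [inner_zero_left, Real.exp_zero, one_mul] at this
    refine this.bdd_mul (c := 1) ?_ (.of_forall fun z => ?_)
    · exact ((continuous_resp lam m i).comp (by fun_prop)).aestronglyMeasurable
    · rw [Real.norm_of_nonneg (resp_pos _ _ _ _).le]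
      exact resp_le_one _ _ _ _
  calc ∫ z, resp lam m i (g.mean k + z) * F z ∂(gauss d)
      ≤ ∫ z, D * (5 + R) * (1 + R) *
        (resp lam m i (g.mean k + z) * (Real.cosh ⟪a, z⟫ * Real.cosh ⟪u, z⟫)
          + resp lam m i (g.mean k + z) * (Real.cosh ⟪b, z⟫ * Real.cosh ⟪u, z⟫)) ∂(gauss d) := by
        refine integral_mono_of_nonneg
          (.of_forall fun z => mul_nonneg (resp_pos _ _ _ _).le (hF0 z))
          (((hint a u).add (hint b u)).const_mul _) (.of_forall fun z => ?_)
        refine (mul_le_mul_of_nonneg_left (hF z) (resp_pos _ _ _ _).le).trans_eq ?_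
        ring
    _ ≤ D * (5 + R) * (1 + R) * (Real.exp (1 + (g.logWeight i - g.logWeight k) / 2)
        * Real.exp (-R ^ 2 / 20) + Real.exp (1 + (g.logWeight i - g.logWeight k) / 2)
        * Real.exp (-R ^ 2 / 20)) := by
        rw [integral_const_mul, integral_add (hint a u) (hint b u)]
        gcongr
        · exact h.integral_resp_le hik ha hu
        · exact h.integral_resp_le hik hb hu
    _ = 2 * D * Real.exp (1 + (g.logWeight i - g.logWeight k) / 2) *
        ((5 + R) * (1 + R) * Real.exp (-R ^ 2 / 20)) := by ring
    _ ≤ _ := by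
        refine mul_le_mul_of_nonneg_left ?_ (by positivity)
        -- The polynomial factors are absorbed by half of the Gaussian decay: `4 + 2 * R ≤ R² / 40`
        -- for `R ≥ 100`.
        have e1 : 5 + R ≤ Real.exp (4 + R) := by linarith [Real.add_one_le_exp (4 + R)]
        have e2 : 1 + R ≤ Real.exp R := by linarith [Real.add_one_le_exp R]
        calc (5 + R) * (1 + R) * Real.exp (-R ^ 2 / 20)
            ≤ Real.exp (4 + R) * Real.exp R * Real.exp (-R ^ 2 / 20) := by gcongr
          _ ≤ _ := by
            rw [← Real.exp_add, ← Real.exp_add]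
            apply Real.exp_le_exp.2
            nlinarith

/-- The differences of logits deviate from their true values by at most a multiple of `D`, with
Gaussian fluctuations. -/
def LogitGap (g : GMM d K) (lam : Fin K → ℝ) (m : Fin K → EuclideanSpace ℝ (Fin d))
    (D : ℝ) : Prop :=
  ∀ i k, i ≠ k → ∃ a b : EuclideanSpace ℝ (Fin d), ‖a‖ ≤ 1 ∧ ‖b‖ ≤ 1 ∧
    ∀ j, j = i ∨ j = k → ∀ z,
      min 1 |(logit lam m (g.mean j + z) i - logit g.logWeight g.mean (g.mean j + z) i) -
        (logit lam m (g.mean j + z) k - logit g.logWeight g.mean (g.mean j + z) k)|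
      ≤ D * (5 + ‖g.mean i - g.mean k‖) * (Real.cosh ⟪a, z⟫ + Real.cosh ⟪b, z⟫)

/-- The expectation of a responsibility-weighted function compared to its value under the true
responsibilities. -/
lemma Near.abs_integral_resp_sub_le (h : g.Near lam m) (i : Fin K)
    {G : EuclideanSpace ℝ (Fin d) → ℝ} (hGc : Continuous G) {u : EuclideanSpace ℝ (Fin d)}
    (hu : ‖u‖ ≤ 1)
    (hG : ∀ k z, |G (g.mean k + z)| ≤ (1 + ‖g.mean i - g.mean k‖) * Real.cosh ⟪u, z⟫)
    {D : ℝ} (hD : 0 ≤ D) (hψ : g.LogitGap lam m D) :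
    |∫ x, resp lam m i x * G x ∂g.law - g.weight i * ∫ z, G (g.mean i + z) ∂(gauss d)|
      ≤ D * g.weight i * g.leakage := by
  set ψ : Fin K → EuclideanSpace ℝ (Fin d) → ℝ := fun k x =>
    min 1 |(logit lam m x i - logit g.logWeight g.mean x i) -
      (logit lam m x k - logit g.logWeight g.mean x k)| with hψdef
  have hψ0 : ∀ k x, 0 ≤ ψ k x := fun k x => le_min zero_le_one (abs_nonneg _)
  have hψ1 : ∀ k x, ψ k x ≤ 1 := fun k x => min_le_left _ _
  have hψc : ∀ k, Continuous (ψ k) := fun k => by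
    simp only [hψdef, logit]; fun_prop
  have hw := continuous_resp lam m
  have hw' : ∀ k, Continuous (g.trueResp k) := fun k => continuous_resp _ _ _
  have hGi : Integrable G g.law := g.integrable_law hGc fun k =>
    ((integrable_cosh u).const_mul _).mono' (hGc.comp (by fun_prop)).aestronglyMeasurable
      (.of_forall fun z => hG k z)
  have bdd : ∀ {f : EuclideanSpace ℝ (Fin d) → ℝ}, Continuous f → (∀ x, 0 ≤ f x) →
      (∀ x, f x ≤ 1) → Integrable (fun x => f x * |G x|) g.law := fun hf h0 h1 =>
    hGi.abs.bdd_mul (c := 1) hf.aestronglyMeasurable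
      (.of_forall fun x => by rw [Real.norm_of_nonneg (h0 x)]; exact h1 x)
  have bddG : ∀ {f : EuclideanSpace ℝ (Fin d) → ℝ}, Continuous f → (∀ x, 0 ≤ f x) →
      (∀ x, f x ≤ 1) → Integrable (fun x => f x * G x) g.law := fun hf h0 h1 =>
    hGi.bdd_mul (c := 1) hf.aestronglyMeasurable
      (.of_forall fun x => by rw [Real.norm_of_nonneg (h0 x)]; exact h1 x)
  have p := fun k x => resp_pos lam m k x
  have p' : ∀ k x, 0 < g.trueResp k x := fun k x => resp_pos _ _ _ _
  have q := fun k x => resp_le_one lam m k x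
  have q' : ∀ k x, g.trueResp k x ≤ 1 := fun k x => resp_le_one _ _ _ _
  have i3 : ∀ k l, Integrable (fun x => g.trueResp k x * (ψ l x * resp lam m i x * |G x|)) g.law ∧
      Integrable (fun x => g.trueResp i x * (ψ l x * resp lam m k x * |G x|)) g.law := by
    intro k l
    have key : ∀ s t, Integrable (fun x => g.trueResp s x * (ψ l x * resp lam m t x * |G x|))
        g.law := fun s t => by
      have := bdd (f := fun x => g.trueResp s x * (ψ l x * resp lam m t x))
        ((hw' s).mul ((hψc l).mul (hw t)))
        (fun x => mul_nonneg (p' s x).le (mul_nonneg (hψ0 l x) (p t x).le))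
        (fun x => mul_le_one₀ (q' s x) (mul_nonneg (hψ0 l x) (p t x).le)
          (mul_le_one₀ (hψ1 l x) (p t x).le (q t x)))
      simpa only [mul_assoc] using this
    exact ⟨key k i, key i k⟩
  -- The target value is the same integral with the true responsibility, so only a difference of
  -- responsibilities has to be bounded.
  rw [← g.integral_trueResp_mul i G hGc, ← integral_sub
    (bddG (hw i) (fun x => (p i x).le) (q i)) (bddG (hw' i) (fun x => (p' i x).le) (q' i))]
  calc |∫ x, resp lam m i x * G x - g.trueResp i x * G x ∂g.law|
      ≤ ∫ x, |resp lam m i x * G x - g.trueResp i x * G x| ∂g.law := abs_integral_le_integral_abs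
    -- Each cross product contains exactly one true responsibility, so the change of measure moves
    -- the term to component `k` or to component `i`.
    _ ≤ ∫ x, ∑ k ∈ Finset.univ.erase i, (g.trueResp k x * (ψ k x * resp lam m i x * |G x|) +
          g.trueResp i x * (ψ k x * resp lam m k x * |G x|)) ∂g.law := by
        refine integral_mono_of_nonneg (.of_forall fun x => abs_nonneg _)
          (integrable_finsetSum _ fun k _ => (i3 k k).1.add (i3 k k).2) (.of_forall fun x => ?_)
        simp only
        rw [← sub_mul, abs_mul]
        refine (mul_le_mul_of_nonneg_right (abs_softmax_sub_le (logit lam m x)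
          (logit g.logWeight g.mean x) i) (abs_nonneg (G x))).trans_eq ?_
        rw [Finset.sum_mul]
        refine Finset.sum_congr rfl fun k _ => ?_
        simp only [hψdef, resp, trueResp]
        ring
    _ = ∑ k ∈ Finset.univ.erase i,
          (g.weight k * ∫ z, ψ k (g.mean k + z) * resp lam m i (g.mean k + z) *
            |G (g.mean k + z)| ∂(gauss d) +
          g.weight i * ∫ z, ψ k (g.mean i + z) * resp lam m k (g.mean i + z) *
            |G (g.mean i + z)| ∂(gauss d)) := by
        rw [integral_finsetSum _ fun k _ => by exact (i3 k k).1.add (i3 k k).2]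
        refine Finset.sum_congr rfl fun k _ => ?_
        rw [integral_add (i3 k k).1 (i3 k k).2,
          g.integral_trueResp_mul k (fun x => ψ k x * resp lam m i x * |G x|)
            (((hψc k).mul (hw i)).mul hGc.abs),
          g.integral_trueResp_mul i (fun x => ψ k x * resp lam m k x * |G x|)
            (((hψc k).mul (hw k)).mul hGc.abs)]
    _ ≤ ∑ _k ∈ Finset.univ.erase i, 4 * D * (Real.exp 1 * (g.weight i * g.rho)) *
          Real.exp (-g.Rmin ^ 2 / 40) := by
        refine Finset.sum_le_sum fun k hk => ?_
        have hik : i ≠ k := (Finset.ne_of_mem_erase hk).symm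
        obtain ⟨a, b, ha, hb, hab⟩ := hψ i k hik
        obtain ⟨e1, e2⟩ := weight_mul_exp_half_le (g := g) i k
        have t1 : ∫ z, ψ k (g.mean k + z) * resp lam m i (g.mean k + z) *
            |G (g.mean k + z)| ∂(gauss d) ≤ 2 * D *
              Real.exp (1 + (g.logWeight i - g.logWeight k) / 2) *
              Real.exp (-g.Rmin ^ 2 / 40) := by
          refine le_trans (le_of_eq ?_) (h.integral_resp_mul_le hik ha hb hu hD
            (F := fun z => ψ k (g.mean k + z) * |G (g.mean k + z)|)
            (fun z => mul_nonneg (hψ0 _ _) (abs_nonneg _)) fun z => ?_)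
          · congr 1 with z; ring
          · exact mul_le_mul (hab k (.inr rfl) z) (hG k z) (abs_nonneg _)
              ((hψ0 _ _).trans (hab k (.inr rfl) z))
        have t2 : ∫ z, ψ k (g.mean i + z) * resp lam m k (g.mean i + z) *
            |G (g.mean i + z)| ∂(gauss d) ≤ 2 * D *
              Real.exp (1 + (g.logWeight k - g.logWeight i) / 2) *
              Real.exp (-g.Rmin ^ 2 / 40) := by
          refine le_trans (le_of_eq ?_) (h.integral_resp_mul_le hik.symm ha hb hu hD
            (F := fun z => ψ k (g.mean i + z) * |G (g.mean i + z)|)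
            (fun z => mul_nonneg (hψ0 _ _) (abs_nonneg _)) fun z => ?_)
          · congr 1 with z; ring
          · rw [norm_sub_rev (g.mean k)]
            refine mul_le_mul (hab i (.inl rfl) z) ((hG i z).trans ?_) (abs_nonneg _)
              ((hψ0 _ _).trans (hab i (.inl rfl) z))
            gcongr
            simp
        have := g.weight_pos i
        have := g.weight_pos k
        calc _ ≤ g.weight k * (2 * D * Real.exp (1 + (g.logWeight i - g.logWeight k) / 2) *
              Real.exp (-g.Rmin ^ 2 / 40)) + g.weight i * (2 * D *
              Real.exp (1 + (g.logWeight k - g.logWeight i) / 2) *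
              Real.exp (-g.Rmin ^ 2 / 40)) := by gcongr
          _ = (2 * D * Real.exp (-g.Rmin ^ 2 / 40)) *
              (g.weight k * Real.exp (1 + (g.logWeight i - g.logWeight k) / 2)
                + g.weight i * Real.exp (1 + (g.logWeight k - g.logWeight i) / 2)) := by ring
          _ ≤ (2 * D * Real.exp (-g.Rmin ^ 2 / 40)) *
              (Real.exp 1 * (g.weight i * g.rho) + Real.exp 1 * (g.weight i * g.rho)) := by
              gcongr
          _ = _ := by ring
    _ ≤ D * g.weight i * g.leakage := by
        have hρ := g.one_le_rho i
        have := g.weight_pos i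
        have he := Real.exp_one_lt_d9
        rw [Finset.sum_const, Finset.card_erase_of_mem (Finset.mem_univ i), Finset.card_univ,
          Fintype.card_fin, nsmul_eq_mul, leakage]
        have hK : (((K - 1 : ℕ) : ℕ) : ℝ) ≤ K := by exact_mod_cast Nat.sub_le _ _
        -- Bounding `exp 1` by `3` gives the factor `12 = 4 * 3` of `leakage`.
        calc _ ≤ (K : ℝ) * (4 * D * (3 * (g.weight i * g.rho)) * Real.exp (-g.Rmin ^ 2 / 40)) := by
              gcongr
              linarith
          _ = _ := by ring

lemma Near.abs_integral_resp_sub_weight_le (h : g.Near lam m) {D : ℝ} (hD : 0 ≤ D)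
    (hψ : g.LogitGap lam m D) (i : Fin K) :
    |∫ x, resp lam m i x ∂g.law - g.weight i| ≤ D * g.weight i * g.leakage := by
  have := h.abs_integral_resp_sub_le i (G := fun _ => 1) continuous_const (u := 0) (by simp)
    (fun k z => by simp) hD hψ
  simpa using this

lemma integral_inner_gauss (u : EuclideanSpace ℝ (Fin d)) : ∫ z, ⟪u, z⟫ ∂(gauss d) = 0 :=
  integral_strongDual_stdGaussian (innerSL ℝ u)

lemma abs_inner_sub_mean_le (i k : Fin K) {u : EuclideanSpace ℝ (Fin d)} (hu : ‖u‖ ≤ 1)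
    (z : EuclideanSpace ℝ (Fin d)) :
    |⟪u, g.mean k + z - g.mean i⟫| ≤ ‖g.mean i - g.mean k‖ + |⟪u, z⟫| := by
  rw [show g.mean k + z - g.mean i = (g.mean k - g.mean i) + z by abel, inner_add_right]
  refine (abs_add_le _ _).trans ?_
  gcongr
  refine (abs_real_inner_le_norm _ _).trans ?_
  rw [norm_sub_rev (g.mean i)]
  exact mul_le_of_le_one_left (norm_nonneg _) hu

/-- Centring the test function at the true mean makes its expectation under component `i` vanish, so
the whole moment is an error term. -/
lemma Near.abs_integral_resp_inner_le (h : g.Near lam m) {D : ℝ} (hD : 0 ≤ D)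
    (hψ : g.LogitGap lam m D) (i : Fin K) {u : EuclideanSpace ℝ (Fin d)} (hu : ‖u‖ ≤ 1) :
    |∫ x, resp lam m i x * ⟪u, x - g.mean i⟫ ∂g.law| ≤ D * g.weight i * g.leakage := by
  have := h.abs_integral_resp_sub_le i (G := fun x => ⟪u, x - g.mean i⟫) (by fun_prop) (u := u) hu
    (fun k z => by
      refine (abs_inner_sub_mean_le i k hu z).trans ?_
      have h1 := abs_le_cosh ⟪u, z⟫
      have h2 := Real.one_le_cosh ⟪u, z⟫
      nlinarith [norm_nonneg (g.mean i - g.mean k)]) hD hψ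
  simpa [integral_inner_gauss] using this

/-- Thanks to the cap by `1`, no closeness is needed. This serves the first EM step, where the means
are known only up to a fraction of the separation. -/
lemma logitGap_one : g.LogitGap lam m 1 := by
  refine fun i k _ => ⟨0, 0, by simp, by simp, fun j _ z => (min_le_left _ _).trans ?_⟩
  simp only [inner_zero_left, Real.cosh_zero]
  linarith [norm_nonneg (g.mean i - g.mean k)]

/-- Parameters within distance `D` of the truth. -/
structure Within (g : GMM d K) (D : ℝ) (lam : Fin K → ℝ) (m : Fin K → EuclideanSpace ℝ (Fin d)) :
    Prop where
  nonneg : 0 ≤ D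
  le_half : D ≤ 1 / 2
  mean : ∀ k, ‖m k - g.mean k‖ ≤ D
  logWeight : ∀ k, |lam k - g.logWeight k| ≤ 2 * D

lemma Within.near {D : ℝ} (h : g.Within D lam m) (hR : 100 ≤ g.Rmin) : g.Near lam m :=
  ⟨hR, fun k => (h.mean k).trans (by linarith [h.le_half]),
    fun k => (h.logWeight k).trans (by linarith [h.le_half])⟩

lemma Within.abs_logit_sub_le {D : ℝ} (h : g.Within D lam m) (i j : Fin K)
    (z : EuclideanSpace ℝ (Fin d)) :
    |logit lam m (g.mean j + z) i - logit g.logWeight g.mean (g.mean j + z) i|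
      ≤ D * (9 / 4 + ‖g.mean i - g.mean j‖ + Real.cosh ⟪D⁻¹ • (m i - g.mean i), z⟫) := by
  have e : logit lam m (g.mean j + z) i - logit g.logWeight g.mean (g.mean j + z) i
      = (lam i - g.logWeight i) + ⟪m i - g.mean i, g.mean j - g.mean i⟫ +
        ⟪m i - g.mean i, z⟫ - ‖m i - g.mean i‖ ^ 2 / 2 := by
    simp only [logit, inner_add_right, inner_sub_left, inner_sub_right, norm_sub_sq_real,
      real_inner_self_eq_norm_sq, real_inner_comm (g.mean i) (m i)]
    ring
  have hD := h.nonneg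
  have h1 := h.logWeight i
  have h2 : |⟪m i - g.mean i, g.mean j - g.mean i⟫| ≤ D * ‖g.mean i - g.mean j‖ := by
    refine (abs_real_inner_le_norm _ _).trans ?_
    rw [norm_sub_rev (g.mean i) (g.mean j)]
    gcongr
    exact h.mean i
  have h3 : |⟪m i - g.mean i, z⟫| ≤ D * Real.cosh ⟪D⁻¹ • (m i - g.mean i), z⟫ := by
    -- For `D = 0` the rescaling by `D⁻¹ = 0` is degenerate, but then `m i = g.mean i` and both
    -- sides vanish.
    rcases hD.eq_or_lt with h0 | h0
    · have := h.mean i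
      rw [← h0, norm_le_zero_iff] at this
      simp [this, ← h0]
    · have e : ⟪m i - g.mean i, z⟫ = D * ⟪D⁻¹ • (m i - g.mean i), z⟫ := by
        rw [real_inner_smul_left, mul_inv_cancel_left₀ h0.ne']
      rw [e, abs_mul, abs_of_pos h0]
      exact mul_le_mul_of_nonneg_left (abs_le_cosh _) h0.le
  have h4 : |‖m i - g.mean i‖ ^ 2 / 2| ≤ D / 4 := by
    rw [abs_of_nonneg (by positivity)]
    have := h.mean i
    nlinarith [norm_nonneg (m i - g.mean i), h.le_half]
  rw [e]
  refine (abs_sub _ _).trans ((add_le_add ((abs_add_le _ _).trans (add_le_add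
    (abs_add_le _ _) le_rfl)) le_rfl).trans ?_)
  linarith

/-- The displacements of the means divided by `D` have norm at most `1`; they are the directions of
the Gaussian fluctuation. -/
lemma Within.logitGap {D : ℝ} (h : g.Within D lam m) : g.LogitGap lam m D := by
  have hn : ∀ i, ‖D⁻¹ • (m i - g.mean i)‖ ≤ 1 := fun i => by
    rw [norm_smul, norm_inv, Real.norm_of_nonneg h.nonneg]
    exact inv_mul_le_one_of_le₀ (h.mean i) h.nonneg
  refine fun i k _ => ⟨D⁻¹ • (m i - g.mean i), D⁻¹ • (m k - g.mean k), hn i, hn k,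
    fun j hj z => (min_le_right _ _).trans ((abs_sub _ _).trans ?_)⟩
  have h1 := h.abs_logit_sub_le i j z
  have h2 := h.abs_logit_sub_le k j z
  have c1 := Real.one_le_cosh ⟪D⁻¹ • (m i - g.mean i), z⟫
  have c2 := Real.one_le_cosh ⟪D⁻¹ • (m k - g.mean k), z⟫
  set a := Real.cosh ⟪D⁻¹ • (m i - g.mean i), z⟫
  set b := Real.cosh ⟪D⁻¹ • (m k - g.mean k), z⟫
  set R := ‖g.mean i - g.mean k‖ with hR
  have hR0 : 0 ≤ R := norm_nonneg _
  have h3 : ‖g.mean i - g.mean j‖ ≤ R ∧ ‖g.mean k - g.mean j‖ ≤ R := by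
    rcases hj with rfl | rfl
    · simp [hR, norm_sub_rev (g.mean k)]
    · simp [hR]
  have hD := h.nonneg
  have h4 : 9 / 4 + ‖g.mean i - g.mean j‖ + a + (9 / 4 + ‖g.mean k - g.mean j‖ + b)
      ≤ (5 + R) * (a + b) := by nlinarith [h3.1, h3.2]
  nlinarith

end Near

end GMM

/-! ### Concentration of empirical means -/

section Chernoff

lemma sq_le_exp {y : ℝ} (hy : 0 ≤ y) : y ^ 2 ≤ Real.exp y := by
  have h1 := Real.add_one_le_exp (y / 4)
  have h2 : y ≤ Real.exp (y / 4) ^ 2 := by nlinarith [sq_nonneg (1 - y / 4)]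
  calc y ^ 2 ≤ (Real.exp (y / 4) ^ 2) ^ 2 := by gcongr
    _ = Real.exp y := by rw [← pow_mul, ← Real.exp_nat_mul]; congr 1; push_cast; ring

lemma exp_le_one_add_add_sq_mul (x : ℝ) : Real.exp x ≤ 1 + x + x ^ 2 * Real.exp |x| := by
  have h1 : 1 ≤ Real.exp |x| := Real.one_le_exp (abs_nonneg x)
  rcases le_or_gt |x| 1 with h | h
  · have := (abs_le.1 (Real.abs_exp_sub_one_sub_id_le h)).2
    nlinarith [sq_nonneg x]
  · rcases le_total 0 x with hx | hx
    · rw [abs_of_nonneg hx] at *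
      have h2 : 1 * Real.exp x ≤ x ^ 2 * Real.exp x := by gcongr; nlinarith
      linarith
    · rw [abs_of_nonpos hx] at *
      have := Real.exp_le_one_iff.2 hx
      nlinarith

variable {Ω : Type*} [MeasurableSpace Ω] {P : Measure Ω} {f : Ω → ℝ} {A : ℝ}

lemma abs_le_exp_two_mul_abs (y : ℝ) : |y| ≤ Real.exp (2 * |y|) := by
  have := Real.add_one_le_exp (2 * |y|)
  linarith [abs_nonneg y]

lemma integrable_of_exp_two_mul_abs (hf : AEStronglyMeasurable f P)
    (hi : Integrable (fun x => Real.exp (2 * |f x|)) P) : Integrable f P :=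
  hi.mono' hf (.of_forall fun x => abs_le_exp_two_mul_abs (f x))

lemma integrable_exp_mul_of_abs_le_one (hf : AEStronglyMeasurable f P)
    (hi : Integrable (fun x => Real.exp (2 * |f x|)) P) {s : ℝ} (hs : |s| ≤ 1) :
    Integrable (fun x => Real.exp (s * f x)) P := by
  refine hi.mono' (Real.continuous_exp.comp_aestronglyMeasurable (hf.const_mul s))
    (.of_forall fun x => ?_)
  rw [Real.norm_of_nonneg (Real.exp_pos _).le]
  refine Real.exp_le_exp.2 ((le_abs_self _).trans ?_)
  rw [abs_mul]
  nlinarith [abs_nonneg (f x)]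

variable [IsProbabilityMeasure P]

/-- For `|s| ≤ 1` the second-order remainder `s² f² exp |s f|` is at most `s² exp (2 |f|)`, so one
exponential moment plays the role of the variance. -/
lemma integral_exp_mul_le (hf : AEStronglyMeasurable f P)
    (hi : Integrable (fun x => Real.exp (2 * |f x|)) P)
    (hA : ∫ x, Real.exp (2 * |f x|) ∂P ≤ A) {s : ℝ} (hs : |s| ≤ 1) :
    ∫ x, Real.exp (s * f x) ∂P ≤ Real.exp (s * ∫ x, f x ∂P + s ^ 2 * A) := by
  have hfi := integrable_of_exp_two_mul_abs hf hi
  have i1 : Integrable (fun x => 1 + s * f x) P := (integrable_const 1).add (hfi.const_mul s)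
  calc ∫ x, Real.exp (s * f x) ∂P
      ≤ ∫ x, (1 + s * f x) + s ^ 2 * Real.exp (2 * |f x|) ∂P := by
        refine integral_mono (integrable_exp_mul_of_abs_le_one hf hi hs)
          (i1.add (hi.const_mul _)) fun x => ?_
        refine (exp_le_one_add_add_sq_mul _).trans ?_
        have h1 : |s * f x| ≤ |f x| := by
          rw [abs_mul]; exact mul_le_of_le_one_left (abs_nonneg _) hs
        have h2 := sq_le_exp (abs_nonneg (f x))
        rw [sq_abs] at h2
        have h3 : Real.exp |s * f x| ≤ Real.exp |f x| := Real.exp_le_exp.2 h1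
        have h4 : Real.exp (2 * |f x|) = Real.exp |f x| * Real.exp |f x| := by
          rw [← Real.exp_add]; ring_nf
        have h5 : f x ^ 2 * Real.exp |s * f x| ≤ Real.exp (2 * |f x|) := by
          rw [h4]; exact mul_le_mul h2 h3 (Real.exp_pos _).le (Real.exp_pos _).le
        have := mul_le_mul_of_nonneg_left h5 (sq_nonneg s)
        linarith
    _ = 1 + s * ∫ x, f x ∂P + s ^ 2 * ∫ x, Real.exp (2 * |f x|) ∂P := by
        rw [integral_add i1 (hi.const_mul _), integral_add (integrable_const 1) (hfi.const_mul s),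
          integral_const_mul, integral_const_mul]
        simp
    _ ≤ 1 + (s * ∫ x, f x ∂P + s ^ 2 * A) := by nlinarith [sq_nonneg s]
    _ ≤ _ := by linarith [Real.add_one_le_exp (s * ∫ x, f x ∂P + s ^ 2 * A)]

/-- The empirical mean of `f` over the sample `X`. -/
def avg {N : ℕ} (f : Ω → ℝ) (X : Fin N → Ω) : ℝ := 1 / (N : ℝ) * ∑ j, f (X j)

lemma measureReal_avg_sub_ge_le (hf : Measurable f)
    (hi : Integrable (fun x => Real.exp (2 * |f x|)) P)
    (hA : ∫ x, Real.exp (2 * |f x|) ∂P ≤ A) {N : ℕ} (hN : 0 < N) {t : ℝ} (ht : 0 ≤ t)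
    (htA : t ≤ 2 * A) :
    (Measure.pi fun _ : Fin N => P).real {X | t ≤ avg f X - ∫ x, f x ∂P}
      ≤ Real.exp (-(N * t ^ 2 / (4 * A))) := by
  have hA1 : 1 ≤ A := by
    refine le_trans ?_ hA
    have := integral_mono (integrable_const (μ := P) (1 : ℝ)) hi
      fun x => Real.one_le_exp (by positivity : (0 : ℝ) ≤ 2 * |f x|)
    simpa using this
  have hN' : (0 : ℝ) < N := by exact_mod_cast hN
  -- The minimizer of `-s t + s² A`; the assumption `t ≤ 2 A` keeps it in the range `|s| ≤ 1`.
  set s := t / (2 * A) with hs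
  have hs0 : 0 ≤ s := by positivity
  have hs1 : |s| ≤ 1 := by
    rw [abs_of_nonneg hs0, hs, div_le_one (by positivity)]; exact htA
  have hsum : ∀ X : Fin N → Ω, Real.exp (s * ∑ j, f (X j)) = ∏ j, Real.exp (s * f (X j)) :=
    fun X => by rw [← Real.exp_sum, Finset.mul_sum]
  have hset : {X : Fin N → Ω | t ≤ avg f X - ∫ x, f x ∂P}
      = {X | N * (t + ∫ x, f x ∂P) ≤ ∑ j, f (X j)} := by
    ext X
    simp only [Set.mem_ofPred_eq, avg]
    rw [le_sub_iff_add_le, one_div_mul_eq_div, le_div_iff₀ hN', mul_comm]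
  have hint : Integrable (fun X : Fin N → Ω => Real.exp (s * ∑ j, f (X j)))
      (Measure.pi fun _ : Fin N => P) := by
    simp_rw [hsum]
    exact Integrable.fintype_prod (f := fun _ x => Real.exp (s * f x)) fun _ =>
      integrable_exp_mul_of_abs_le_one hf.aestronglyMeasurable hi hs1
  rw [hset]
  refine (measure_ge_le_exp_mul_mgf _ hs0 hint).trans ?_
  have hm : mgf (fun X : Fin N → Ω => ∑ j, f (X j)) (Measure.pi fun _ : Fin N => P) s
      ≤ Real.exp (s * ∫ x, f x ∂P + s ^ 2 * A) ^ N := by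
    rw [mgf]
    simp_rw [hsum]
    rw [integral_fintype_prod_eq_pow (fun x => Real.exp (s * f x)), Fintype.card_fin]
    refine pow_le_pow_left₀ (integral_nonneg fun x => (Real.exp_pos _).le) ?_ N
    exact integral_exp_mul_le hf.aestronglyMeasurable hi hA hs1
  refine (mul_le_mul_of_nonneg_left hm (Real.exp_pos _).le).trans ?_
  rw [← Real.exp_nat_mul, ← Real.exp_add]
  refine Real.exp_le_exp.2 (le_of_eq ?_)
  rw [hs]
  field_simp
  ring

lemma measureReal_abs_avg_sub_ge_le (hf : Measurable f)
    (hi : Integrable (fun x => Real.exp (2 * |f x|)) P)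
    (hA : ∫ x, Real.exp (2 * |f x|) ∂P ≤ A) {N : ℕ} (hN : 0 < N) {t : ℝ} (ht : 0 ≤ t)
    (htA : t ≤ 2 * A) :
    (Measure.pi fun _ : Fin N => P).real {X | t ≤ |avg f X - ∫ x, f x ∂P|}
      ≤ 2 * Real.exp (-(N * t ^ 2 / (4 * A))) := by
  have h1 := measureReal_avg_sub_ge_le hf hi hA hN ht htA
  have h2 := measureReal_avg_sub_ge_le (f := fun x => -f x) hf.neg (by simpa using hi)
    (by simpa using hA) hN ht htA
  have hset : {X : Fin N → Ω | t ≤ |avg f X - ∫ x, f x ∂P|}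
      ⊆ {X | t ≤ avg f X - ∫ x, f x ∂P} ∪ {X | t ≤ avg (fun x => -f x) X - ∫ x, -f x ∂P} := by
    intro X hX
    simp only [Set.mem_ofPred_eq, Set.mem_union, avg, integral_neg, Finset.sum_neg_distrib] at hX ⊢
    rcases le_abs.1 hX with h | h
    · exact .inl h
    · exact .inr (by linarith)
  refine (measureReal_mono hset).trans ((measureReal_union_le _ _).trans ?_)
  linarith

end Chernoff

/-! ### Nets -/

section Nets

/-- A finite set of at most `5 ^ d` directions that detects the norm up to a factor `2`. -/
lemma exists_half_net (d : ℕ) :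
    ∃ U : Finset (EuclideanSpace ℝ (Fin d)), U.card ≤ 5 ^ d ∧ (∀ u ∈ U, ‖u‖ ≤ 1) ∧
      ∀ v : EuclideanSpace ℝ (Fin d), ∃ u ∈ U, ‖v‖ ≤ 2 * ⟪u, v⟫ := by
  -- A maximal `1`-separated subset of the ball of radius `2` covers that ball up to distance `1`;
  -- its halves are the required directions.
  let p : Finset (EuclideanSpace ℝ (Fin d)) → Prop := fun s =>
    (∀ c ∈ s, ‖c‖ ≤ 2) ∧ ∀ c ∈ s, ∀ e ∈ s, c ≠ e → 1 ≤ ‖c - e‖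
  have hcard : ∀ s, p s → s.card ≤ 5 ^ d := fun s hs => by
    have := Besicovitch.card_le_of_separated s hs.1 hs.2
    simpa using this
  obtain ⟨s, hs, hmax⟩ : ∃ s, p s ∧ ∀ s', p s' → s'.card ≤ s.card := by
    have hne : {n | ∃ s, p s ∧ s.card = n}.Nonempty := ⟨0, ∅, by simp [p], rfl⟩
    have hb : BddAbove {n | ∃ s, p s ∧ s.card = n} :=
      ⟨5 ^ d, by rintro n ⟨s, hs, rfl⟩; exact hcard s hs⟩
    obtain ⟨s, hs, hn⟩ := Nat.sSup_mem hne hb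
    exact ⟨s, hs, fun s' hs' => hn ▸ le_csSup hb ⟨s', hs', rfl⟩⟩
  have hcov : ∀ v : EuclideanSpace ℝ (Fin d), ‖v‖ ≤ 2 → ∃ c ∈ s, ‖c - v‖ < 1 := by
    intro v hv
    by_contra! hcon
    have hvs : v ∉ s := fun h => by have := hcon v h; simp at this; linarith
    have := hmax (insert v s) ⟨fun c hc => ?_, fun c hc e he hce => ?_⟩
    · rw [Finset.card_insert_of_notMem hvs] at this
      omega
    · rcases Finset.mem_insert.1 hc with rfl | hc'
      · exact hv
      · exact hs.1 c hc'
    · rcases Finset.mem_insert.1 hc with rfl | hc'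
      · rcases Finset.mem_insert.1 he with rfl | he'
        · exact absurd rfl hce
        · rw [norm_sub_rev]; exact hcon e he'
      · rcases Finset.mem_insert.1 he with rfl | he'
        · exact hcon c hc'
        · exact hs.2 c hc' e he' hce
  refine ⟨s.image fun c => (1 / 2 : ℝ) • c, Finset.card_image_le.trans (hcard s hs), ?_, ?_⟩
  · intro u hu
    obtain ⟨c, hc, rfl⟩ := Finset.mem_image.1 hu
    rw [norm_smul]
    have := hs.1 c hc
    norm_num
    linarith
  · intro v
    -- A point `c` within `1` of `2 v / ‖v‖` satisfies `⟪c, v⟫ ≥ 2 ‖v‖ - ‖v‖`. For `v = 0` the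
    -- convention `0⁻¹ = 0` makes the same formula work.
    obtain ⟨c, hc, hcv⟩ := hcov ((2 * ‖v‖⁻¹) • v) (by
      rw [norm_smul, norm_mul, norm_inv, norm_norm]
      rcases eq_or_ne v 0 with rfl | hv
      · simp
      · rw [mul_assoc, inv_mul_cancel₀ (norm_ne_zero_iff.2 hv)]; norm_num)
    refine ⟨_, Finset.mem_image_of_mem _ hc, ?_⟩
    have h1 : |⟪c - (2 * ‖v‖⁻¹) • v, v⟫| ≤ 1 * ‖v‖ :=
      (abs_real_inner_le_norm _ _).trans (by gcongr)
    have h2 := (abs_le.1 h1).1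
    rw [inner_sub_left, real_inner_smul_left, real_inner_self_eq_norm_sq] at h2
    have h3 : 2 * ‖v‖⁻¹ * ‖v‖ ^ 2 = 2 * ‖v‖ := by
      rcases eq_or_ne v 0 with rfl | hv
      · simp
      · field_simp [norm_ne_zero_iff.2 hv]
    rw [h3] at h2
    rw [real_inner_smul_left]
    linarith

/-- A subset of a cube contains a finite net for the sup-distance. -/
lemma exists_grid_net {ι : Type*} [Fintype ι] [DecidableEq ι] (S : Set (ι → ℝ)) {B : ℝ}
    (hB : 0 < B) (hS : ∀ s ∈ S, ∀ i, |s i| ≤ B) {n : ℕ} (hn : 0 < n) :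
    ∃ F : Finset (ι → ℝ), (∀ f ∈ F, f ∈ S) ∧ F.card ≤ (2 * n + 1) ^ Fintype.card ι ∧
      ∀ s ∈ S, ∃ f ∈ F, ∀ i, |s i - f i| ≤ B / n := by
  classical
  have hn' : (0 : ℝ) < n := by exact_mod_cast hn
  let φ : (ι → ℝ) → ι → ℤ := fun s i => ⌊s i * (n / B)⌋
  let T : Finset (ι → ℤ) := Fintype.piFinset fun _ => Finset.Icc (-(n : ℤ)) n
  have hφ : ∀ s ∈ S, φ s ∈ T := fun s hs => by
    refine Fintype.mem_piFinset.2 fun i => Finset.mem_Icc.2 ?_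
    have h := abs_le.1 (hS s hs i)
    have h1 : s i * (n / B) ≤ n := by
      rw [mul_div_assoc', div_le_iff₀ hB]; nlinarith
    have h2 : -(n : ℝ) ≤ s i * (n / B) := by
      rw [mul_div_assoc', le_div_iff₀ hB]; nlinarith
    constructor
    · exact Int.le_floor.2 (by push_cast; exact h2)
    · have := (Int.floor_le (s i * (n / B))).trans h1
      exact_mod_cast this
  have hcl : ∀ s f, φ s = φ f → ∀ i, |s i - f i| ≤ B / n := fun s f h i => by
    have h1 := Int.abs_sub_lt_one_of_floor_eq_floor (congrFun h i)
    rw [← sub_mul, abs_mul, abs_of_pos (div_pos hn' hB)] at h1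
    rw [le_div_iff₀ hn']
    have h2 : |s i - f i| * (n / B) * B < 1 * B := by gcongr
    rw [mul_assoc, div_mul_cancel₀ _ hB.ne'] at h2
    linarith
  -- Each grid cell that meets `S` is represented by a point of `S` itself, so the constraints
  -- defining `S` pass to the net.
  let T' := T.filter fun τ => ∃ s ∈ S, φ s = τ
  let c : (ι → ℤ) → ι → ℝ := fun τ => if h : ∃ s ∈ S, φ s = τ then h.choose else 0
  have hc : ∀ τ, (∃ s ∈ S, φ s = τ) → c τ ∈ S ∧ φ (c τ) = τ := fun τ h => by
    simp only [c, dif_pos h]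
    exact h.choose_spec
  refine ⟨T'.image c, ?_, ?_, ?_⟩
  · intro f hf
    obtain ⟨τ, hτ, rfl⟩ := Finset.mem_image.1 hf
    exact (hc τ (Finset.mem_filter.1 hτ).2).1
  · refine Finset.card_image_le.trans ((Finset.card_filter_le _ _).trans (le_of_eq ?_))
    simp only [T, Fintype.card_piFinset, Int.card_Icc, Finset.prod_const, Finset.card_univ]
    congr 1
    omega
  · intro s hs
    have h : ∃ s' ∈ S, φ s' = φ s := ⟨s, hs, rfl⟩
    exact ⟨c (φ s), Finset.mem_image_of_mem _ (Finset.mem_filter.2 ⟨hφ s hs, h⟩),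
      hcl _ _ (hc _ h).2.symm⟩

end Nets

namespace GMM

variable {d K : ℕ} {g : GMM d K}

/-! ### Exponential moments -/

lemma rho_le_of_leakage_le_one (i : Fin K) (hl : g.leakage ≤ 1) :
    Real.log g.rho ≤ g.Rmin ^ 2 / 40 := by
  have hρ := g.one_le_rho i
  have hK : (1 : ℝ) ≤ K := by exact_mod_cast i.pos
  rw [Real.log_le_iff_le_exp (by linarith)]
  rw [leakage, neg_div, Real.exp_neg] at hl
  have h1 : g.rho * (Real.exp (g.Rmin ^ 2 / 40))⁻¹ ≤ 1 := by
    have : 0 ≤ g.rho * (Real.exp (g.Rmin ^ 2 / 40))⁻¹ := by positivity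
    nlinarith
  rwa [← div_eq_mul_inv, div_le_one (Real.exp_pos _)] at h1

section Near

variable {lam : Fin K → ℝ} {m : Fin K → EuclideanSpace ℝ (Fin d)}

/-- Far away components contribute little, unless the noise is of the order of the separation. -/
lemma Near.resp_mul_dist_le (h : g.Near lam m) (hl : g.leakage ≤ 1) (i k : Fin K)
    (z : EuclideanSpace ℝ (Fin d)) :
    resp lam m i (g.mean k + z) * ‖g.mean i - g.mean k‖
      ≤ 1 + 5 * |⟪‖m i - m k‖⁻¹ • (m i - m k), z⟫| := by
  rcases eq_or_ne i k with rfl | hik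
  · simp
  set V := ‖m i - m k‖ with hV
  set R := ‖g.mean i - g.mean k‖ with hR
  have hV1 : 7 / 8 * R ≤ V := h.dist_lower hik
  have hRm : g.Rmin ≤ R := g.Rmin_le hik
  have h100 := h.hundred_le_Rmin
  have hVpos : 0 < V := by linarith
  -- Either the noise along `m i - m k` is small, and the responsibility is at most `exp (-R)`, or
  -- its normalized projection is at least `V / 4`, and `R ≤ 8/7 * V ≤ 32/7` times that projection.
  rcases le_total ⟪m i - m k, z⟫ (V ^ 2 / 4) with hz | hz
  · have h1 : resp lam m i (g.mean k + z) ≤ Real.exp (-R) := by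
      refine (softmax_le_exp_sub _ i k).trans (Real.exp_le_exp.2 ((h.logit_sub_le hik z).trans ?_))
      have h2 : g.logWeight i - g.logWeight k ≤ Real.log g.rho := by
        have hi := g.weight_pos i
        have hk := g.weight_pos k
        rw [GMM.logWeight, GMM.logWeight, ← Real.log_div hi.ne' hk.ne']
        refine Real.log_le_log (by positivity) ?_
        rw [div_le_iff₀ hk]
        exact g.weight_le_rho_mul k i
      have h3 := rho_le_of_leakage_le_one i hl
      nlinarith
    have h2 : Real.exp (-R) * R ≤ 1 := by
      rw [Real.exp_neg, inv_mul_le_iff₀ (Real.exp_pos _)]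
      linarith [Real.add_one_le_exp R]
    have h3 : resp lam m i (g.mean k + z) * R ≤ Real.exp (-R) * R := by gcongr
    linarith [abs_nonneg ⟪V⁻¹ • (m i - m k), z⟫]
  · have h1 : V / 4 ≤ ⟪V⁻¹ • (m i - m k), z⟫ := by
      rw [real_inner_smul_left, le_inv_mul_iff₀ hVpos]
      linarith
    have h2 := le_abs_self ⟪V⁻¹ • (m i - m k), z⟫
    have h3 : resp lam m i (g.mean k + z) * R ≤ 1 * R := by
      gcongr
      exact resp_le_one _ _ _ _
    linarith

/-- The responsibility turns the distance between the means into a noise term, so the exponent grows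
linearly in `z` with coefficients `2` and `10` independent of the separation. -/
lemma Near.exp_two_abs_le (h : g.Near lam m) (hl : g.leakage ≤ 1) (i k : Fin K)
    {u : EuclideanSpace ℝ (Fin d)} (hu : ‖u‖ ≤ 1) (z : EuclideanSpace ℝ (Fin d)) :
    Real.exp (2 * |resp lam m i (g.mean k + z) * ⟪u, g.mean k + z - g.mean i⟫|)
      ≤ 4 * Real.exp 2 * (Real.cosh ⟪(2 : ℝ) • u, z⟫ *
        Real.cosh ⟪(10 : ℝ) • ‖m i - m k‖⁻¹ • (m i - m k), z⟫) := by
  have h1 := h.resp_mul_dist_le hl i k z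
  have h2 := abs_inner_sub_mean_le (g := g) i k hu z
  have h3 := (resp_pos lam m i (g.mean k + z)).le
  have h4 := resp_le_one lam m i (g.mean k + z)
  set v := ‖m i - m k‖⁻¹ • (m i - m k)
  have h5 : |resp lam m i (g.mean k + z) * ⟪u, g.mean k + z - g.mean i⟫|
      ≤ 1 + 5 * |⟪v, z⟫| + |⟪u, z⟫| := by
    rw [abs_mul, abs_of_nonneg h3]
    refine (mul_le_mul_of_nonneg_left h2 h3).trans ?_
    rw [mul_add]
    refine add_le_add h1 (mul_le_of_le_one_left (abs_nonneg _) h4)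
  have e1 := exp_abs_le_cosh ⟪(2 : ℝ) • u, z⟫
  have e2 := exp_abs_le_cosh ⟪(10 : ℝ) • v, z⟫
  have a1 : |⟪(2 : ℝ) • u, z⟫| = 2 * |⟪u, z⟫| := by
    rw [real_inner_smul_left, abs_mul]; norm_num
  have a2 : |⟪(10 : ℝ) • v, z⟫| = 10 * |⟪v, z⟫| := by
    rw [real_inner_smul_left, abs_mul]; norm_num
  calc _ ≤ Real.exp (2 + (|⟪(2 : ℝ) • u, z⟫| + |⟪(10 : ℝ) • v, z⟫|)) := by
        apply Real.exp_le_exp.2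
        rw [a1, a2]
        linarith
    _ = Real.exp 2 * (Real.exp |⟪(2 : ℝ) • u, z⟫| * Real.exp |⟪(10 : ℝ) • v, z⟫|) := by
        rw [Real.exp_add, Real.exp_add]
    _ ≤ Real.exp 2 * ((2 * Real.cosh ⟪(2 : ℝ) • u, z⟫) * (2 * Real.cosh ⟪(10 : ℝ) • v, z⟫)) := by
        gcongr
    _ = _ := by ring

/-- A universal bound for the exponential moments. -/
def momentBound : ℝ := 4 * Real.exp 2 * Real.exp 72

lemma one_le_momentBound : 1 ≤ momentBound := by
  have h1 := Real.one_le_exp (show (0 : ℝ) ≤ 2 by norm_num)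
  have h2 := Real.one_le_exp (show (0 : ℝ) ≤ 72 by norm_num)
  unfold momentBound
  nlinarith

/-- Uniform in `d`, `K` and `R_max`; this is why no factor `R_max` stands in front of the logarithm
in the statistical error. -/
lemma Near.integral_exp_two_abs_le (h : g.Near lam m) (hl : g.leakage ≤ 1) (i : Fin K)
    {u : EuclideanSpace ℝ (Fin d)} (hu : ‖u‖ ≤ 1) :
    Integrable (fun x => Real.exp (2 * |resp lam m i x * ⟪u, x - g.mean i⟫|)) g.law ∧
      ∫ x, Real.exp (2 * |resp lam m i x * ⟪u, x - g.mean i⟫|) ∂g.law ≤ momentBound := by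
  have hc : Continuous fun x => Real.exp (2 * |resp lam m i x * ⟪u, x - g.mean i⟫|) := by
    have := continuous_resp lam m i
    fun_prop
  have hup := fun k : Fin K => (integrable_exp_cosh_cosh 0 ((2 : ℝ) • u)
    ((10 : ℝ) • ‖m i - m k‖⁻¹ • (m i - m k))).const_mul (4 * Real.exp 2)
  simp only [inner_zero_left, Real.exp_zero, one_mul] at hup
  have hk : ∀ k, Integrable (fun z => Real.exp (2 * |resp lam m i (g.mean k + z) *
      ⟪u, g.mean k + z - g.mean i⟫|)) (gauss d) := fun k =>
    (hup k).mono' (hc.comp (by fun_prop)).aestronglyMeasurable (.of_forall fun z => by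
      rw [Real.norm_of_nonneg (Real.exp_pos _).le]
      exact h.exp_two_abs_le hl i k hu z)
  refine ⟨g.integrable_law hc hk, ?_⟩
  rw [g.integral_law hc hk]
  calc _ ≤ ∑ k, g.weight k * momentBound := by
        refine Finset.sum_le_sum fun k _ => mul_le_mul_of_nonneg_left ?_ (g.weight_pos k).le
        refine (integral_mono (hk k) (hup k) fun z => h.exp_two_abs_le hl i k hu z).trans ?_
        rw [integral_const_mul, momentBound]
        gcongr
        have := integral_exp_cosh_cosh_le 0 ((2 : ℝ) • u)
          ((10 : ℝ) • ‖m i - m k‖⁻¹ • (m i - m k))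
        simp only [inner_zero_left, Real.exp_zero, one_mul, norm_zero, zero_add] at this
        refine this.trans (Real.exp_le_exp.2 ?_)
        -- `(2 + 10)² / 2 = 72`, the exponent in `momentBound`.
        have h1 : ‖(2 : ℝ) • u‖ ≤ 2 := by rw [norm_smul]; norm_num; linarith
        have h2 : ‖(10 : ℝ) • ‖m i - m k‖⁻¹ • (m i - m k)‖ ≤ 10 := by
          rw [norm_smul, norm_smul, norm_inv, norm_norm]
          norm_num
          exact inv_mul_le_one_of_le₀ le_rfl (norm_nonneg _)
        have h3 := norm_nonneg ((2 : ℝ) • u)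
        have h4 := norm_nonneg ((10 : ℝ) • ‖m i - m k‖⁻¹ • (m i - m k))
        nlinarith
    _ = momentBound := by rw [← Finset.sum_mul, g.weight_sum, one_mul]

lemma integral_exp_two_abs_resp_le (g : GMM d K) (i : Fin K) :
    Integrable (fun x => Real.exp (2 * |resp lam m i x|)) g.law ∧
      ∫ x, Real.exp (2 * |resp lam m i x|) ∂g.law ≤ momentBound := by
  have hb : ∀ x, Real.exp (2 * |resp lam m i x|) ≤ momentBound := fun x => by
    rw [abs_of_pos (resp_pos _ _ _ _)]
    have h1 : Real.exp (2 * resp lam m i x) ≤ Real.exp 2 :=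
      Real.exp_le_exp.2 (by linarith [resp_le_one lam m i x])
    have h2 := Real.one_le_exp (show (0 : ℝ) ≤ 72 by norm_num)
    have h3 := Real.exp_pos 2
    unfold momentBound
    nlinarith
  have hi : Integrable (fun x => Real.exp (2 * |resp lam m i x|)) g.law := by
    refine (integrable_const momentBound).mono' ?_ (.of_forall fun x => ?_)
    · have := continuous_resp lam m i
      exact Continuous.aestronglyMeasurable (by fun_prop)
    · rw [Real.norm_of_nonneg (Real.exp_pos _).le]
      exact hb x
  refine ⟨hi, (integral_mono hi (integrable_const momentBound) hb).trans (by simp)⟩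

end Near

/-! ### The size of the samples -/

/-- A long vector has projection at least `s` onto some direction of the half net; a union bound
over `5 ^ d` Chernoff bounds follows. -/
lemma measureReal_gauss_norm_gt_le (d : ℕ) {s : ℝ} (hs : 0 ≤ s) :
    (gauss d).real {z | 2 * s < ‖z‖} ≤ 5 ^ d * Real.exp (-(s ^ 2 / 2)) := by
  obtain ⟨U, hU, hU1, hUn⟩ := exists_half_net d
  have hsub : {z : EuclideanSpace ℝ (Fin d) | 2 * s < ‖z‖} ⊆ ⋃ u ∈ U, {z | s ≤ ⟪u, z⟫} := by
    intro z hz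
    obtain ⟨u, hu, h⟩ := hUn z
    simp only [Set.mem_iUnion, Set.mem_ofPred_eq, exists_prop] at hz ⊢
    exact ⟨u, hu, by linarith⟩
  refine (measureReal_mono hsub (measure_ne_top _ _)).trans
    ((measureReal_biUnion_finset_le _ _).trans ?_)
  calc _ ≤ ∑ _u ∈ U, Real.exp (-(s ^ 2 / 2)) := by
        refine Finset.sum_le_sum fun u hu => ?_
        have e : ∀ z, Real.exp (s * ⟪u, z⟫) = Real.exp ⟪s • u, z⟫ := fun z => by
          rw [real_inner_smul_left]
        refine (measure_ge_le_exp_mul_mgf s hs ?_).trans ?_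
        · simp_rw [e]; exact integrable_exp_inner _
        · rw [mgf]
          simp_rw [e]
          rw [integral_exp_inner, ← Real.exp_add, norm_smul, Real.norm_of_nonneg hs]
          apply Real.exp_le_exp.2
          have h1 := hU1 u hu
          have h2 : (s * ‖u‖) ^ 2 ≤ s ^ 2 := by
            refine pow_le_pow_left₀ (by positivity) (mul_le_of_le_one_right hs h1) 2
          nlinarith
    _ ≤ _ := by
        rw [Finset.sum_const, nsmul_eq_mul]
        gcongr
        exact_mod_cast hU

lemma measureReal_law_norm_gt_le (g : GMM d K) {s : ℝ} (hs : 0 ≤ s) :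
    g.law.real {x | g.Rmax + 2 * s < ‖x‖} ≤ 5 ^ d * Real.exp (-(s ^ 2 / 2)) := by
  have hm : MeasurableSet {x : EuclideanSpace ℝ (Fin d) | g.Rmax + 2 * s < ‖x‖} :=
    measurableSet_lt measurable_const measurable_norm
  have hk : ∀ k, ((gauss d).map (fun z => g.mean k + z)) {x | g.Rmax + 2 * s < ‖x‖}
      ≤ ENNReal.ofReal (5 ^ d * Real.exp (-(s ^ 2 / 2))) := fun k => by
    rw [Measure.map_apply (by fun_prop) hm]
    refine (measure_mono (t := {z | 2 * s < ‖z‖}) fun z hz => ?_).trans ?_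
    · have h1 := g.norm_mean_le_Rmax k
      have h2 := norm_add_le (g.mean k) z
      simp only [Set.mem_preimage, Set.mem_ofPred_eq] at hz ⊢
      linarith
    · rw [← ofReal_measureReal]
      exact ENNReal.ofReal_le_ofReal (measureReal_gauss_norm_gt_le d hs)
  have h : g.law {x | g.Rmax + 2 * s < ‖x‖}
      ≤ ENNReal.ofReal (5 ^ d * Real.exp (-(s ^ 2 / 2))) := by
    simp only [law, Measure.coe_finsetSum, Finset.sum_apply, Measure.smul_apply, smul_eq_mul]
    refine (Finset.sum_le_sum fun k _ => mul_le_mul_right (hk k) _).trans ?_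
    rw [← Finset.sum_mul, ← ENNReal.ofReal_sum_of_nonneg fun i _ => (g.weight_pos i).le,
      g.weight_sum, ENNReal.ofReal_one, one_mul]
  exact ENNReal.toReal_le_of_le_ofReal (by positivity) h

/-! ### The good event -/

instance (N : ℕ) : IsProbabilityMeasure (g.sampleLaw N) := by
  unfold sampleLaw; infer_instance

/-- The samples are bounded by `R_max + 2 s`, and the responsibilities for the parameters in `T`
have empirical means close to their expectations, also in the directions of `U`. -/
structure Good (g : GMM d K) (T : Finset ((Fin K → ℝ) × (Fin K → EuclideanSpace ℝ (Fin d))))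
    (U : Finset (EuclideanSpace ℝ (Fin d))) (s t : ℝ) {N : ℕ}
    (X : Fin N → EuclideanSpace ℝ (Fin d)) : Prop where
  norm_le : ∀ j, ‖X j‖ ≤ g.Rmax + 2 * s
  resp : ∀ θ ∈ T, ∀ i, |avg (resp θ.1 θ.2 i) X - ∫ x, resp θ.1 θ.2 i x ∂g.law| < t
  inner : ∀ θ ∈ T, ∀ i, ∀ u ∈ U, |avg (fun x => TGMM.resp θ.1 θ.2 i x * ⟪u, x - g.mean i⟫) X -
    ∫ x, TGMM.resp θ.1 θ.2 i x * ⟪u, x - g.mean i⟫ ∂g.law| < t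

/-- A union bound over the `N` samples, and over the parameters, the components and the `1 + U.card`
test functions of each; the two families spend `δ / 2` each. -/
lemma le_sampleLaw_good {T : Finset ((Fin K → ℝ) × (Fin K → EuclideanSpace ℝ (Fin d)))}
    {U : Finset (EuclideanSpace ℝ (Fin d))} {s t δ : ℝ} {N : ℕ} (hN : 0 < N)
    (hl : g.leakage ≤ 1) (hT : ∀ θ ∈ T, g.Near θ.1 θ.2) (hU : ∀ u ∈ U, ‖u‖ ≤ 1)
    (hs : 0 ≤ s) (ht : 0 ≤ t) (ht2 : t ≤ 2 * momentBound)
    (h1 : N * (5 ^ d * Real.exp (-(s ^ 2 / 2))) ≤ δ / 2)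
    (h2 : T.card * (K * ((1 + U.card) * (2 * Real.exp (-(N * t ^ 2 / (4 * momentBound))))))
      ≤ δ / 2) :
    ENNReal.ofReal (1 - δ) ≤ g.sampleLaw N {X | g.Good T U s t X} := by
  set ξ := 2 * Real.exp (-(N * t ^ 2 / (4 * momentBound))) with hξ
  let bad₁ : Set (Fin N → EuclideanSpace ℝ (Fin d)) :=
    ⋃ j ∈ Finset.univ, {X | g.Rmax + 2 * s < ‖X j‖}
  let f : (Fin K → ℝ) × (Fin K → EuclideanSpace ℝ (Fin d)) → Fin K →
      EuclideanSpace ℝ (Fin d) → ℝ := fun θ i => resp θ.1 θ.2 i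
  let F : (Fin K → ℝ) × (Fin K → EuclideanSpace ℝ (Fin d)) → Fin K → EuclideanSpace ℝ (Fin d) →
      EuclideanSpace ℝ (Fin d) → ℝ := fun θ i u x => resp θ.1 θ.2 i x * ⟪u, x - g.mean i⟫
  let ev : (EuclideanSpace ℝ (Fin d) → ℝ) → Set (Fin N → EuclideanSpace ℝ (Fin d)) := fun f =>
    {X | t ≤ |avg f X - ∫ x, f x ∂g.law|}
  let bad₂ : Set (Fin N → EuclideanSpace ℝ (Fin d)) :=
    ⋃ θ ∈ T, ⋃ i ∈ Finset.univ, (ev (f θ i) ∪ ⋃ u ∈ U, ev (F θ i u))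
  have hb1 : (g.sampleLaw N).real bad₁ ≤ δ / 2 := by
    refine (measureReal_biUnion_finset_le _ _).trans (le_trans ?_ h1)
    calc _ ≤ ∑ _j : Fin N, (5 ^ d * Real.exp (-(s ^ 2 / 2))) := by
          refine Finset.sum_le_sum fun j _ => ?_
          refine le_trans (le_of_eq ?_) (g.measureReal_law_norm_gt_le hs)
          have hm : MeasurableSet {x : EuclideanSpace ℝ (Fin d) | g.Rmax + 2 * s < ‖x‖} :=
            measurableSet_lt measurable_const measurable_norm
          have := (measurePreserving_eval (fun _ : Fin N => g.law) j).measure_preimage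
            hm.nullMeasurableSet
          rw [measureReal_def, measureReal_def, ← this]
          rfl
      _ = _ := by simp
  have hb2 : (g.sampleLaw N).real bad₂ ≤ δ / 2 := by
    refine le_trans ?_ h2
    refine (measureReal_biUnion_finset_le _ _).trans ?_
    rw [← nsmul_eq_mul (T.card), ← Finset.sum_const]
    refine Finset.sum_le_sum fun θ hθ => (measureReal_biUnion_finset_le _ _).trans ?_
    calc _ ≤ ∑ _i : Fin K, (1 + U.card) * ξ := by
          refine Finset.sum_le_sum fun i _ => (measureReal_union_le _ _).trans ?_
          rw [add_mul, one_mul]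
          refine add_le_add ?_ ((measureReal_biUnion_finset_le _ _).trans ?_)
          · have := integral_exp_two_abs_resp_le (lam := θ.1) (m := θ.2) g i
            exact measureReal_abs_avg_sub_ge_le (continuous_resp _ _ _).measurable this.1 this.2
              hN ht ht2
          · rw [← nsmul_eq_mul, ← Finset.sum_const]
            refine Finset.sum_le_sum fun u hu => ?_
            have := (hT θ hθ).integral_exp_two_abs_le hl i (hU u hu)
            refine measureReal_abs_avg_sub_ge_le (f := F θ i u) ?_ this.1 this.2 hN ht ht2
            have := continuous_resp θ.1 θ.2 i
            exact Continuous.measurable (by fun_prop)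
      _ = _ := by simp
  have hsub : {X | g.Good T U s t X}ᶜ ⊆ bad₁ ∪ bad₂ := by
    intro X hX
    by_contra hcon
    refine hX ⟨fun j => ?_, fun θ hθ i => ?_, fun θ hθ i u hu => ?_⟩
    · by_contra! h
      exact hcon (.inl (by simp only [bad₁, Set.mem_iUnion]; exact ⟨j, Finset.mem_univ j, h⟩))
    · by_contra! h
      exact hcon (.inr (by
        simp only [bad₂, Set.mem_iUnion]; exact ⟨θ, hθ, i, Finset.mem_univ i, .inl h⟩))
    · by_contra! h
      refine hcon (.inr ?_)
      simp only [bad₂, Set.mem_iUnion]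
      refine ⟨θ, hθ, i, Finset.mem_univ i, .inr ?_⟩
      simp only [Set.mem_iUnion]
      exact ⟨u, hu, h⟩
  have hcompl : (g.sampleLaw N).real ({X | g.Good T U s t X}ᶜ) ≤ δ :=
    (measureReal_mono hsub).trans ((measureReal_union_le _ _).trans (by linarith))
  -- Subadditivity alone passes to the complement, so measurability of the good event is not needed.
  have huniv : 1 ≤ (g.sampleLaw N).real {X | g.Good T U s t X} +
      (g.sampleLaw N).real ({X | g.Good T U s t X}ᶜ) := by
    have := measureReal_union_le (μ := g.sampleLaw N) {X | g.Good T U s t X}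
      ({X | g.Good T U s t X}ᶜ)
    rwa [Set.union_compl_self, probReal_univ] at this
  exact ENNReal.ofReal_le_of_le_toReal (by
    have : (g.sampleLaw N {X | g.Good T U s t X}).toReal
      = (g.sampleLaw N).real {X | g.Good T U s t X} := rfl
    linarith)

end GMM

lemma abs_log_sub_log_le {r r' : ℝ} (h : 1 / 2 ≤ r) (h' : 1 / 2 ≤ r') :
    |Real.log r - Real.log r'| ≤ 2 * |r - r'| := by
  have key : ∀ {x y : ℝ}, 1 / 2 ≤ x → 1 / 2 ≤ y → Real.log x - Real.log y ≤ 2 * |x - y| := by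
    intro x y hx hy
    rw [← Real.log_div (by linarith) (by linarith)]
    refine (Real.log_le_sub_one_of_pos (by positivity)).trans ?_
    rw [div_sub_one (by linarith), div_le_iff₀ (by linarith)]
    nlinarith [le_abs_self (x - y), abs_nonneg (x - y)]
  refine abs_le.2 ⟨?_, key h h'⟩
  have := key h' h
  rw [abs_sub_comm] at this
  linarith

namespace GMM

variable {d K N : ℕ} {g : GMM d K} {lam : Fin K → ℝ} {m : Fin K → EuclideanSpace ℝ (Fin d)}
  {X : Fin N → EuclideanSpace ℝ (Fin d)}

/-! ### Accuracy of the empirical EM operator -/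

/-- The empirical moments of the responsibilities agree with their values at the true parameters up
to a statistical error `t` and a fraction of the distance `D` to the truth. -/
def Conc (g : GMM d K) (X : Fin N → EuclideanSpace ℝ (Fin d)) (lam : Fin K → ℝ)
    (m : Fin K → EuclideanSpace ℝ (Fin d)) (t D : ℝ) : Prop :=
  ∀ i, |avg (resp lam m i) X - g.weight i| ≤ t + D * g.weight i * g.leakage ∧
    ‖(1 / (N : ℝ)) • ∑ j, resp lam m i (X j) • (X j - g.mean i)‖
      ≤ 2 * (t + D * g.weight i * g.leakage)

/-- Statistical error plus population bias; the factor `2` for the vector moment comes from the half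
net. -/
lemma Good.conc {T : Finset ((Fin K → ℝ) × (Fin K → EuclideanSpace ℝ (Fin d)))}
    {U : Finset (EuclideanSpace ℝ (Fin d))} {s t D : ℝ} (h : g.Good T U s t X)
    (hU1 : ∀ u ∈ U, ‖u‖ ≤ 1)
    (hU : ∀ v : EuclideanSpace ℝ (Fin d), ∃ u ∈ U, ‖v‖ ≤ 2 * ⟪u, v⟫)
    {θ : (Fin K → ℝ) × (Fin K → EuclideanSpace ℝ (Fin d))} (hθ : θ ∈ T)
    (hn : g.Near θ.1 θ.2) (hD : 0 ≤ D) (hψ : g.LogitGap θ.1 θ.2 D) :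
    g.Conc X θ.1 θ.2 t D := by
  refine fun i => ⟨?_, ?_⟩
  · have h1 := (h.resp θ hθ i).le
    have h2 := hn.abs_integral_resp_sub_weight_le hD hψ i
    exact (abs_sub_le _ _ _).trans (add_le_add h1 h2)
  · obtain ⟨u, hu, huv⟩ := hU ((1 / (N : ℝ)) • ∑ j, TGMM.resp θ.1 θ.2 i (X j) • (X j - g.mean i))
    have h1 := (abs_le.1 (h.inner θ hθ i u hu).le).2
    have h2 := (abs_le.1 (hn.abs_integral_resp_inner_le hD hψ i (hU1 u hu))).2
    have e : ⟪u, (1 / (N : ℝ)) • ∑ j, TGMM.resp θ.1 θ.2 i (X j) • (X j - g.mean i)⟫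
        = avg (fun x => TGMM.resp θ.1 θ.2 i x * ⟪u, x - g.mean i⟫) X := by
      simp only [real_inner_smul_right, inner_sum, avg]
    rw [e] at huv
    linarith

lemma avg_sub_le_of_forall {q w : Fin N → ℝ} {e : ℝ} (hN : 0 < N) (h : ∀ j, |q j - w j| ≤ e) :
    |1 / (N : ℝ) * ∑ j, q j - 1 / (N : ℝ) * ∑ j, w j| ≤ e := by
  have hN' : (0 : ℝ) < N := by exact_mod_cast hN
  rw [← mul_sub, ← Finset.sum_sub_distrib, abs_mul, abs_of_pos (by positivity),
    one_div_mul_eq_div, div_le_iff₀ hN']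
  refine (Finset.abs_sum_le_sum_abs _ _).trans ((Finset.sum_le_sum fun j _ => h j).trans_eq ?_)
  simp [mul_comm]

lemma norm_avg_smul_sub_le_of_forall {q w : Fin N → ℝ} {e b : ℝ}
    {Y : Fin N → EuclideanSpace ℝ (Fin d)} (hN : 0 < N) (h : ∀ j, |q j - w j| ≤ e)
    (hY : ∀ j, ‖Y j‖ ≤ b) :
    ‖(1 / (N : ℝ)) • ∑ j, q j • Y j - (1 / (N : ℝ)) • ∑ j, w j • Y j‖ ≤ e * b := by
  have hN' : (0 : ℝ) < N := by exact_mod_cast hN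
  rw [← smul_sub, ← Finset.sum_sub_distrib, norm_smul, Real.norm_of_nonneg (by positivity),
    one_div_mul_eq_div, div_le_iff₀ hN']
  refine (norm_sum_le _ _).trans ((Finset.sum_le_sum (g := fun _ => e * b) fun j _ => ?_).trans_eq
    (by simp [mul_comm]))
  rw [← sub_smul, norm_smul]
  exact mul_le_mul (h j) (hY j) (norm_nonneg _) ((abs_nonneg _).trans (h j))

/-- Passage from a net point to a nearby parameter. The statistical error, the increase of `D` and
the change of the responsibilities cost `t` each, which explains `3 * t`. -/
lemma Conc.perturb {lam' : Fin K → ℝ} {m' : Fin K → EuclideanSpace ℝ (Fin d)}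
    {t D D' ζ b : ℝ} (h : g.Conc X lam' m' t D') (hN : 0 < N)
    (hw : ∀ i j, |resp lam m i (X j) - resp lam' m' i (X j)| ≤ ζ)
    (hb : ∀ i j, ‖X j - g.mean i‖ ≤ b) (hb1 : 1 ≤ b) (hζ : ζ * b ≤ t)
    (hl : g.leakage ≤ 1) (hDD : D' ≤ D + t) : g.Conc X lam m (3 * t) D := by
  intro i
  obtain ⟨h1, h2⟩ := h i
  have hζ0 : 0 ≤ ζ := (abs_nonneg _).trans (hw i ⟨0, hN⟩)
  have hζ1 : ζ ≤ t := by nlinarith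
  have hπ := g.weight_pos i
  have hπ1 := g.weight_le_one i
  have hl0 : 0 ≤ g.leakage := by
    have := g.one_le_rho i
    unfold leakage; positivity
  have hc : 0 ≤ g.weight i * g.leakage := by positivity
  have hc1 : g.weight i * g.leakage ≤ 1 := by nlinarith
  have e : D' * g.weight i * g.leakage ≤ D * g.weight i * g.leakage + t := by nlinarith
  have a1 := avg_sub_le_of_forall hN (hw i)
  have a2 := norm_avg_smul_sub_le_of_forall hN (hw i) (hb i)
  constructor
  · refine (abs_sub_le _ (avg (resp lam' m' i) X) _).trans ?_
    have : |avg (resp lam m i) X - avg (resp lam' m' i) X| ≤ ζ := a1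
    linarith
  · have := norm_le_norm_add_norm_sub' ((1 / (N : ℝ)) • ∑ j, resp lam m i (X j) • (X j - g.mean i))
      ((1 / (N : ℝ)) • ∑ j, resp lam' m' i (X j) • (X j - g.mean i))
    linarith

/-- One approximate EM step. -/
lemma Conc.step {t D e b : ℝ} (h : g.Conc X lam m t D) (hN : 0 < N)
    (hb : ∀ i j, ‖X j - g.mean i‖ ≤ b) (hb1 : 1 ≤ b) (i : Fin K) {q q' : Fin N → ℝ}
    (hq : ∀ j, |q j - resp lam m i (X j)| ≤ e) (hq' : ∀ j, |q' j - resp lam m i (X j)| ≤ e)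
    (hsmall : e + t + D * g.weight i * g.leakage ≤ g.weight i / 2) :
    |1 / (N : ℝ) * ∑ j, q j - g.weight i| / g.weight i
        ≤ 2 / g.weight i * (e * b + 2 * t) + 4 * (D * g.leakage) ∧
      ‖∑ j, (q' j / ∑ l, q' l) • X j - g.mean i‖
        ≤ 2 / g.weight i * (e * b + 2 * t) + 4 * (D * g.leakage) := by
  obtain ⟨h1, h2⟩ := h i
  have hN' : (0 : ℝ) < N := by exact_mod_cast hN
  have he0 : 0 ≤ e := (abs_nonneg _).trans (hq ⟨0, hN⟩)
  have hπ := g.weight_pos i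
  set L := t + D * g.weight i * g.leakage with hL
  have hL0 : 0 ≤ L := (abs_nonneg _).trans h1
  have heb : e ≤ e * b := le_mul_of_one_le_right he0 hb1
  have E : 2 / g.weight i * (e * b + 2 * t) + 4 * (D * g.leakage)
      = 2 / g.weight i * (e * b + 2 * L) := by
    rw [hL]; field_simp; ring
  rw [E]
  constructor
  · have a1 := avg_sub_le_of_forall hN hq
    have a2 : |1 / (N : ℝ) * ∑ j, q j - g.weight i| ≤ e + L :=
      (abs_sub_le _ (avg (resp lam m i) X) _).trans (add_le_add a1 h1)
    rw [div_le_iff₀ hπ]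
    calc _ ≤ e + L := a2
      _ ≤ 2 * (e * b + 2 * L) := by linarith
      _ = _ := by field_simp
  · have a1 := avg_sub_le_of_forall hN hq'
    have a2 : |1 / (N : ℝ) * ∑ j, q' j - g.weight i| ≤ e + L :=
      (abs_sub_le _ (avg (resp lam m i) X) _).trans (add_le_add a1 h1)
    -- The normalizing mass of the new mean stays above half of the true weight; hence the factor `2
    -- / π_i`.
    have a3 : g.weight i / 2 ≤ 1 / (N : ℝ) * ∑ j, q' j := by
      have := (abs_le.1 a2).1
      linarith
    have a4 := norm_avg_smul_sub_le_of_forall hN hq' (hb i)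
    have a5 : ‖(1 / (N : ℝ)) • ∑ j, q' j • (X j - g.mean i)‖ ≤ e * b + 2 * L := by
      have := norm_le_norm_add_norm_sub' ((1 / (N : ℝ)) • ∑ j, q' j • (X j - g.mean i))
        ((1 / (N : ℝ)) • ∑ j, resp lam m i (X j) • (X j - g.mean i))
      linarith
    set S := ∑ l, q' l with hS
    have hSpos : 0 < S := by
      by_contra! hneg
      have : 1 / (N : ℝ) * S ≤ 0 := mul_nonpos_of_nonneg_of_nonpos (by positivity) hneg
      linarith
    -- The normalized weights sum to `1`, so the true mean can be subtracted inside the sum, where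
    -- the centred moment is controlled.
    have e1 : ∑ j, (q' j / S) • X j - g.mean i
        = (1 / (N : ℝ) * S)⁻¹ • ((1 / (N : ℝ)) • ∑ j, q' j • (X j - g.mean i)) := by
      have : ∑ j, q' j • (X j - g.mean i) = ∑ j, q' j • X j - S • g.mean i := by
        simp only [smul_sub, Finset.sum_sub_distrib, ← Finset.sum_smul, hS]
      rw [this, smul_smul, smul_sub, smul_smul, Finset.smul_sum]
      congr 1
      · refine Finset.sum_congr rfl fun j _ => ?_
        rw [smul_smul]
        congr 1
        field_simp
      · have : (1 / (N : ℝ) * S)⁻¹ * (1 / N) * S = 1 := by field_simp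
        rw [this, one_smul]
    rw [e1, norm_smul, norm_inv, Real.norm_of_nonneg (by linarith), inv_mul_le_iff₀ (by linarith)]
    refine a5.trans ?_
    have : 1 ≤ 1 / (N : ℝ) * S * (2 / g.weight i) := by
      rw [mul_div_assoc', le_div_iff₀ hπ]; linarith
    have hnn : 0 ≤ e * b + 2 * L := by nlinarith
    nlinarith

/-! ### A net of parameters -/

/-- The parameters with the given relative weights and displacements of the means. -/
def params (g : GMM d K) (p : Fin K × Option (Fin d) → ℝ) :
    (Fin K → ℝ) × (Fin K → EuclideanSpace ℝ (Fin d)) :=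
  (fun k => g.logWeight k + Real.log (p (k, none)),
    fun k => g.mean k + WithLp.toLp 2 fun c => p (k, some c))

lemma norm_le_mul_of_forall {v : EuclideanSpace ℝ (Fin d)} {η : ℝ} (h : ∀ c, |v c| ≤ η) :
    ‖v‖ ≤ d * η := by
  rw [← (EuclideanSpace.basisFun (Fin d) ℝ).sum_repr v]
  refine (norm_sum_le _ _).trans
    ((Finset.sum_le_sum (g := fun _ => η) fun c _ => ?_).trans_eq (by simp))
  rw [norm_smul]
  simpa using h c

lemma abs_logit_sub_le {lam' : Fin K → ℝ} {m' : Fin K → EuclideanSpace ℝ (Fin d)} {k : Fin K}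
    {r : ℝ} (hm : ‖m k‖ ≤ r) (hm' : ‖m' k‖ ≤ r) (x : EuclideanSpace ℝ (Fin d)) :
    |logit lam m x k - logit lam' m' x k|
      ≤ |lam k - lam' k| + ‖m k - m' k‖ * (‖x‖ + r) := by
  have e : logit lam m x k - logit lam' m' x k
      = (lam k - lam' k) + (⟪m k - m' k, x⟫ - (‖m k‖ - ‖m' k‖) * (‖m k‖ + ‖m' k‖) / 2) := by
    simp only [logit, inner_sub_left]
    ring
  rw [e]
  refine (abs_add_le _ _).trans (add_le_add le_rfl ((abs_sub _ _).trans ?_))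
  have h1 := abs_real_inner_le_norm (m k - m' k) x
  have h2 : |(‖m k‖ - ‖m' k‖) * (‖m k‖ + ‖m' k‖) / 2| ≤ ‖m k - m' k‖ * r := by
    rw [mul_div_assoc, abs_mul]
    refine mul_le_mul (abs_norm_sub_norm_le _ _) ?_ (abs_nonneg _) (norm_nonneg _)
    rw [abs_of_nonneg (by positivity)]
    linarith
  linarith

/-- Relative weights (index `none`) and displacements of the means live in a cube of dimension `K (d
+ 1)`. A net point inherits the distance of the approximated parameter up to the mesh, so the
contraction estimate at the net point is almost as good. -/
lemma exists_param_net (g : GMM d K) (hd : 1 ≤ d) {n : ℕ} (hn : 0 < n) :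
    ∃ T : Finset ((Fin K → ℝ) × (Fin K → EuclideanSpace ℝ (Fin d))),
      T.card ≤ (2 * n + 1) ^ (K * (d + 1)) ∧ (∀ θ ∈ T, g.Within (1 / 2) θ.1 θ.2) ∧
      ∀ (r : Fin K → ℝ) (m : Fin K → EuclideanSpace ℝ (Fin d)) (D : ℝ), 0 ≤ D → D ≤ 1 / 2 →
        (∀ k, |r k - 1| ≤ D) → (∀ k, ‖m k - g.mean k‖ ≤ D) →
        ∃ θ ∈ T, ∃ D' ≤ D + 2 * d / n, g.Within D' θ.1 θ.2 ∧
          ∀ x k, |logit (fun k => g.logWeight k + Real.log (r k)) m x k - logit θ.1 θ.2 x k|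
            ≤ 4 * d / n * (‖x‖ + g.Rmax + 2) := by
  classical
  have hn' : (0 : ℝ) < n := by exact_mod_cast hn
  have hd' : (1 : ℝ) ≤ d := by exact_mod_cast hd
  let S : Set (Fin K × Option (Fin d) → ℝ) := {p | ∀ k, |p (k, none) - 1| ≤ 1 / 2 ∧
    ‖(WithLp.toLp 2 fun c => p (k, some c) : EuclideanSpace ℝ (Fin d))‖ ≤ 1 / 2}
  have hSB : ∀ p ∈ S, ∀ i, |p i| ≤ 2 := by
    rintro p hp ⟨k, _ | c⟩
    · have := abs_le.1 (hp k).1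
      exact abs_le.2 ⟨by linarith, by linarith⟩
    · have h1 := (hp k).2
      have h2 := PiLp.norm_apply_le
        (WithLp.toLp 2 fun c => p (k, some c) : EuclideanSpace ℝ (Fin d)) c
      rw [Real.norm_eq_abs] at h2
      exact h2.trans (h1.trans (by norm_num))
  have hwithin : ∀ p ∈ S, ∀ D, 0 ≤ D → D ≤ 1 / 2 → (∀ k, |p (k, none) - 1| ≤ D) →
      (∀ k, ‖(WithLp.toLp 2 fun c => p (k, some c) : EuclideanSpace ℝ (Fin d))‖ ≤ D) →
      g.Within D (g.params p).1 (g.params p).2 := by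
    intro p hp D hD0 hD h1 h2
    refine ⟨hD0, hD, fun k => ?_, fun k => ?_⟩
    · simpa [params] using h2 k
    · have h3 := (abs_le.1 (hp k).1).1
      have := abs_log_sub_log_le (r := p (k, none)) (r' := 1) (by linarith) (by norm_num)
      rw [Real.log_one, sub_zero] at this
      simp only [params, add_sub_cancel_left]
      linarith [h1 k]
  obtain ⟨F, hFS, hFc, hF⟩ := exists_grid_net S two_pos hSB hn
  refine ⟨F.image g.params, Finset.card_image_le.trans (hFc.trans_eq ?_), ?_, ?_⟩
  · simp
  · intro θ hθ
    obtain ⟨p, hp, rfl⟩ := Finset.mem_image.1 hθ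
    have := hFS p hp
    exact hwithin p this _ (by norm_num) le_rfl (fun k => (this k).1) fun k => (this k).2
  · intro r m D hD0 hD hr hm
    let p : Fin K × Option (Fin d) → ℝ := fun i =>
      i.2.elim (r i.1) fun c => m i.1 c - g.mean i.1 c
    have hpm : ∀ k, (WithLp.toLp 2 fun c => p (k, some c) : EuclideanSpace ℝ (Fin d))
        = m k - g.mean k := fun k => by ext c; simp [p]
    have hpS : p ∈ S := fun k => ⟨(hr k).trans hD, by rw [hpm]; exact (hm k).trans hD⟩
    obtain ⟨f, hf, hpf⟩ := hF p hpS
    have hfS := hFS f hf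
    set Δ : Fin K → EuclideanSpace ℝ (Fin d) := fun k => WithLp.toLp 2 fun c => f (k, some c)
      with hΔ
    have hd2 : ∀ k, ‖(m k - g.mean k) - Δ k‖ ≤ 2 * d / n := fun k => by
      refine (norm_le_mul_of_forall (η := 2 / n) fun c => ?_).trans_eq (by ring)
      have := hpf (k, some c)
      simpa [p, hΔ] using this
    have hn2 : 2 / (n : ℝ) ≤ 2 * d / n := by gcongr; linarith
    -- The net point lies in `S`, hence within `1 / 2`, and also within the mesh of a parameter at
    -- distance `D`.
    have hw := hwithin f hfS (min (1 / 2) (D + 2 * d / n)) (by positivity) (min_le_left _ _)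
      (fun k => le_min (hfS k).1 ?_) (fun k => le_min (hfS k).2 ?_)
    · refine ⟨g.params f, Finset.mem_image_of_mem _ hf, _, min_le_right _ _, hw, fun x k => ?_⟩
      have h1 : |(g.logWeight k + Real.log (r k)) - (g.params f).1 k| ≤ 4 / n := by
        simp only [params, add_sub_add_left_eq_sub]
        have h2 := (abs_le.1 ((hr k).trans hD)).1
        have h3 := (abs_le.1 (hfS k).1).1
        refine (abs_log_sub_log_le (by linarith) (by linarith)).trans ?_
        have h4 : |r k - f (k, none)| ≤ 2 / n := by simpa [p] using hpf (k, none)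
        calc _ ≤ 2 * (2 / (n : ℝ)) := by gcongr
          _ = _ := by ring
      have h2 : ‖m k - (g.params f).2 k‖ ≤ 2 * d / n := by
        have := hd2 k
        rwa [sub_sub] at this
      have h3 : ‖m k‖ ≤ g.Rmax + 1 := by
        have := norm_le_norm_add_norm_sub' (m k) (g.mean k)
        linarith [g.norm_mean_le_Rmax k, hm k]
      have h4 : ‖(g.params f).2 k‖ ≤ g.Rmax + 1 := by
        have := norm_add_le (g.mean k) (Δ k)
        have h5 : ‖Δ k‖ ≤ 1 / 2 := (hfS k).2
        change ‖g.mean k + Δ k‖ ≤ _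
        linarith [g.norm_mean_le_Rmax k]
      refine (abs_logit_sub_le h3 h4 x).trans ?_
      have h5 : 0 ≤ g.Rmax := (norm_nonneg _).trans (g.norm_mean_le_Rmax k)
      calc _ ≤ 4 / (n : ℝ) + 2 * d / n * (‖x‖ + (g.Rmax + 1)) := by gcongr
        _ ≤ 4 * d / n * 1 + 4 * d / n * (‖x‖ + (g.Rmax + 1)) := by
          gcongr ?_ + ?_
          · rw [mul_one]; gcongr; linarith
          · gcongr; linarith
        _ = _ := by ring
    · have h1 : |r k - f (k, none)| ≤ 2 / n := by simpa [p] using hpf (k, none)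
      rw [abs_sub_comm] at h1
      have := abs_sub_le (f (k, none)) (r k) 1
      linarith [hr k]
    · have h1 := norm_le_norm_add_norm_sub (m k - g.mean k) (Δ k)
      have h2 := hd2 k
      have h3 := hm k
      change ‖Δ k‖ ≤ _
      linarith

end GMM

namespace GMM

variable {d K N : ℕ} {g : GMM d K}

/-! ### The event on which EM behaves well uniformly -/

/-- The order of magnitude of the samples. -/
def sampleScale (g : GMM d K) (N : ℕ) (δ : ℝ) : ℝ :=
  g.Rmax + d + √(2 * d * Real.log (4 * N / δ))

/-- The statistical error. -/
def statError (g : GMM d K) (N : ℕ) (δ a : ℝ) : ℝ :=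
  84 * momentBound * √(K * d * Real.log (g.logConst a * N / δ) / N)

/-- The argument `logConst * N / δ` of the logarithm dominates every scale of the problem, so powers
of it control both the mesh and the cardinality of the nets. -/
lemma logConst_facts (g : GMM d K) (hd : 1 ≤ d) (hK : 2 ≤ K) (hN : 0 < N) {δ a : ℝ} (hδ : 0 < δ)
    (hδ1 : δ < 1) (ha : a < 1) :
    1152 ≤ g.logConst a * N / δ ∧ (d : ℝ) * (N / δ) * 1152 ≤ g.logConst a * N / δ ∧
      g.Rmax ≤ g.logConst a * N / δ ∧ (K : ℝ) ≤ g.logConst a * N / δ ∧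
      N / δ ≤ g.logConst a * N / δ := by
  have hd' : (1 : ℝ) ≤ d := by exact_mod_cast hd
  have hK' : (2 : ℝ) ≤ K := by exact_mod_cast hK
  have hN' : (1 : ℝ) ≤ N := by exact_mod_cast hN
  have hR : 0 ≤ g.Rmax := (norm_nonneg _).trans (g.norm_mean_le_Rmax ⟨0, by omega⟩)
  have hsd : 1 ≤ √(d : ℝ) := by rwa [Real.one_le_sqrt]
  have hsd2 : √(d : ℝ) ^ 2 = d := Real.sq_sqrt (by positivity)
  have ha' : 0 < 1 / (1 - a) := by
    have : 0 < 1 - a := by linarith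
    positivity
  set P := √(d : ℝ) + 2 * g.Rmax + 1 / (1 - a) with hP
  have hP1 : 1 ≤ P := by linarith
  have hPd : (d : ℝ) ≤ P ^ 2 := by
    rw [← hsd2]; gcongr; linarith
  have hPR : g.Rmax ≤ P ^ 2 := by nlinarith
  have hM : 1 ≤ N / δ := by rw [le_div_iff₀ hδ]; linarith
  have e : g.logConst a * N / δ = 288 * (K : ℝ) ^ 2 * P ^ 2 * (N / δ) := by
    rw [logConst, ← hP]; ring
  set M := N / δ with hMdef
  have hK2 : 4 ≤ (K : ℝ) ^ 2 := by nlinarith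
  have hP2 : 1 ≤ P ^ 2 := by nlinarith
  have hb : 1152 * P ^ 2 * M ≤ g.logConst a * N / δ := by
    rw [e]; gcongr; linarith
  have hPM : P ^ 2 ≤ P ^ 2 * M := le_mul_of_one_le_right (by positivity) hM
  refine ⟨by nlinarith, ?_, by nlinarith, ?_, by nlinarith⟩
  · calc (d : ℝ) * M * 1152 ≤ P ^ 2 * M * 1152 := by gcongr
      _ ≤ _ := by linarith
  · rw [e]
    calc (K : ℝ) ≤ 288 * (K : ℝ) ^ 2 * 1 * 1 := by nlinarith
      _ ≤ _ := by gcongr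

lemma sampleScale_facts (g : GMM d K) (hd : 1 ≤ d) (hK : 2 ≤ K) (hN : 0 < N) {δ a : ℝ}
    (hδ : 0 < δ) (hδ1 : δ < 1) (ha : a < 1) :
    1 ≤ g.sampleScale N δ ∧ g.sampleScale N δ ≤ 3 * (g.logConst a * N / δ) ∧
      2 * g.Rmax + 2 * √(2 * Real.log (4 * N / δ) + 4 * d) ≤ 4 * g.sampleScale N δ := by
  obtain ⟨h1, h2, h3, h4, h5⟩ := g.logConst_facts hd hK hN hδ hδ1 ha
  set Z := g.logConst a * N / δ
  have hd' : (1 : ℝ) ≤ d := by exact_mod_cast hd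
  have hN' : (1 : ℝ) ≤ N := by exact_mod_cast hN
  have hR : 0 ≤ g.Rmax := (norm_nonneg _).trans (g.norm_mean_le_Rmax ⟨0, by omega⟩)
  have hM : 1 ≤ N / δ := by rw [le_div_iff₀ hδ]; linarith
  have hlog : Real.log (4 * N / δ) ≤ 4 * (N / δ) := by
    rw [mul_div_assoc]
    have := Real.log_le_sub_one_of_pos (show (0 : ℝ) < 4 * (N / δ) by positivity)
    linarith
  have hlog0 : 0 ≤ Real.log (4 * N / δ) := Real.log_nonneg (by rw [mul_div_assoc]; linarith)
  have hq0 := Real.sqrt_nonneg (2 * d * Real.log (4 * N / δ))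
  refine ⟨?_, ?_, ?_⟩
  · unfold sampleScale; linarith
  · have hdZ : (d : ℝ) ≤ Z := by nlinarith
    have : √(2 * d * Real.log (4 * N / δ)) ≤ Z := by
      rw [Real.sqrt_le_left (by linarith)]
      calc 2 * d * Real.log (4 * N / δ) ≤ 2 * d * (4 * (N / δ)) := by gcongr
        _ ≤ Z := by nlinarith
        _ ≤ Z ^ 2 := by nlinarith
    unfold sampleScale; linarith
  · have e1 : √(2 * Real.log (4 * N / δ) + 4 * d) ≤ √(2 * d * Real.log (4 * N / δ)) + 2 * d := by
      rw [Real.sqrt_le_left (by positivity)]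
      have := Real.sq_sqrt (show 0 ≤ 2 * d * Real.log (4 * N / δ) by positivity)
      nlinarith [mul_nonneg hlog0 (sub_nonneg.2 hd')]
    unfold sampleScale; linarith

lemma norm_tail_bound (d : ℕ) (hN : 0 < N) {δ : ℝ} (hδ : 0 < δ) (hδ1 : δ < 1) :
    N * (5 ^ d * Real.exp (-(√(2 * Real.log (4 * N / δ) + 4 * d) ^ 2 / 2))) ≤ δ / 2 := by
  have hN' : (1 : ℝ) ≤ N := by exact_mod_cast hN
  have hpos : (0 : ℝ) < 4 * N / δ := by positivity
  have hlog0 : 0 ≤ Real.log (4 * N / δ) := Real.log_nonneg (by rw [le_div_iff₀ hδ]; linarith)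
  -- The threshold is chosen so that the tail is `δ / (4 N)` times `exp (-2 d)`, and `exp 2 > 5`
  -- pays for the net of directions.
  rw [Real.sq_sqrt (by positivity),
    show -((2 * Real.log (4 * N / δ) + 4 * d) / 2) = -Real.log (4 * N / δ) + -(d * 2 : ℝ) by ring,
    Real.exp_add, Real.exp_neg, Real.exp_log hpos, Real.exp_neg, Real.exp_nat_mul]
  have h5 : (5 : ℝ) ^ d ≤ Real.exp 2 ^ d := by
    gcongr
    have := Real.exp_one_gt_d9
    rw [show (2 : ℝ) = 1 + 1 by norm_num, Real.exp_add]
    nlinarith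
  have h6 : (5 : ℝ) ^ d * (Real.exp 2 ^ d)⁻¹ ≤ 1 := by
    rw [← div_eq_mul_inv, div_le_one (by positivity)]
    exact h5
  calc _ = δ / 4 * ((5 : ℝ) ^ d * (Real.exp 2 ^ d)⁻¹) := by field_simp
    _ ≤ δ / 4 * 1 := by gcongr
    _ ≤ _ := by linarith

/-- Counting powers of `Z`: parameters `14 K d`, components `1`, directions `d`, constants and `1 /
δ` together `2`. The sum is at most `21 K d`, the exponent supplied by the tail, because `K d ≥ 2`.
-/
lemma union_bound_count {Z δ : ℝ} {n c u : ℕ} (hd : 1 ≤ d) (hK : 2 ≤ K) (hδ : 0 < δ)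
    (hZ : 1152 ≤ Z) (hKZ : (K : ℝ) ≤ Z) (hδZ : 1 / δ ≤ Z) (hn : (n : ℝ) ≤ Z ^ 6 + 1)
    (hc : c ≤ (2 * n + 1) ^ (K * (d + 1)) + 1) (hu : u ≤ 5 ^ d) {x : ℝ}
    (hx : 21 * (K * d * Real.log Z) ≤ x) :
    c * (K * ((1 + u) * (2 * Real.exp (-x)))) ≤ δ / 2 := by
  have hZ0 : 0 < Z := by linarith
  have hZ1 : 1 ≤ Z := by linarith
  have h1 : (2 * n + 1 : ℝ) ≤ Z ^ 7 := by
    have : (1 : ℝ) ≤ Z ^ 6 := one_le_pow₀ hZ1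
    nlinarith
  have hexp : K * (d + 1) ≤ 2 * (K * d) := by nlinarith
  have h2 : (c : ℝ) ≤ 2 * Z ^ (14 * (K * d)) := by
    calc (c : ℝ) ≤ (2 * n + 1 : ℝ) ^ (K * (d + 1)) + 1 := by exact_mod_cast hc
      _ ≤ (Z ^ 7) ^ (K * (d + 1)) + 1 := by gcongr
      _ ≤ (Z ^ 7) ^ (2 * (K * d)) + 1 := by
        gcongr
        exact one_le_pow₀ hZ1
      _ = Z ^ (14 * (K * d)) + 1 := by rw [← pow_mul]; ring_nf
      _ ≤ _ := by linarith [one_le_pow₀ (n := 14 * (K * d)) hZ1]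
  have h3 : (1 + u : ℝ) ≤ 2 * Z ^ d := by
    have : (u : ℝ) ≤ 5 ^ d := by exact_mod_cast hu
    have h5 : (5 : ℝ) ^ d ≤ Z ^ d := by gcongr; linarith
    linarith [one_le_pow₀ (n := d) hZ1]
  have h4 : Real.exp (-x) ≤ (Z ^ (21 * (K * d)))⁻¹ := by
    rw [Real.exp_neg]
    gcongr
    rw [← Real.exp_log (pow_pos hZ0 _), Real.log_pow]
    apply Real.exp_le_exp.2
    push_cast
    linarith
  have h5 : 8 * 2 / δ ≤ Z ^ 2 := by
    rw [mul_div_assoc, sq, div_eq_mul_one_div]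
    have : 0 ≤ 1 / δ := by positivity
    nlinarith
  have hKd : 2 ≤ K * d := by nlinarith
  have hdKd : d ≤ K * d := by nlinarith
  calc _ ≤ (2 * Z ^ (14 * (K * d))) * (Z * ((2 * Z ^ d) * (2 * (Z ^ (21 * (K * d)))⁻¹))) := by
        gcongr
    _ = δ / 2 * (8 * 2 / δ * Z ^ (14 * (K * d) + 1 + d) * (Z ^ (21 * (K * d)))⁻¹) := by
        rw [pow_add, pow_add]; field_simp; norm_num
    _ ≤ δ / 2 * (Z ^ 2 * Z ^ (14 * (K * d) + 1 + d) * (Z ^ (21 * (K * d)))⁻¹) := by gcongr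
    _ ≤ δ / 2 * 1 := by
        gcongr
        rw [← div_eq_mul_inv, div_le_one (by positivity), ← pow_add]
        exact pow_le_pow_right₀ hZ1 (by omega)
    _ = _ := by ring

lemma statError_facts (g : GMM d K) (hd : 1 ≤ d) (hK : 2 ≤ K) (hN : 0 < N) {δ a : ℝ} (hδ : 0 < δ)
    (hδ1 : δ < 1) (ha : a < 1) :
    1 / (N : ℝ) ≤ g.statError N δ a ∧
      21 * (K * d * Real.log (g.logConst a * N / δ))
        ≤ N * g.statError N δ a ^ 2 / (4 * momentBound) ∧
      1 ≤ K * d * Real.log (g.logConst a * N / δ) := by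
  obtain ⟨hZ, -⟩ := g.logConst_facts hd hK hN hδ hδ1 ha
  set Z := g.logConst a * N / δ with hZdef
  have hd' : (1 : ℝ) ≤ d := by exact_mod_cast hd
  have hK' : (2 : ℝ) ≤ K := by exact_mod_cast hK
  have hN' : (1 : ℝ) ≤ N := by exact_mod_cast hN
  have hA := one_le_momentBound
  have hℓ : 1 ≤ Real.log Z := by
    rw [Real.le_log_iff_exp_le (by linarith)]
    linarith [Real.exp_one_lt_d9]
  have hKd : 1 ≤ (K : ℝ) * d * Real.log Z :=
    one_le_mul_of_one_le_of_one_le (one_le_mul_of_one_le_of_one_le (by linarith) hd') hℓ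
  rw [statError, ← hZdef]
  refine ⟨?_, ?_, hKd⟩
  · have h1 : 1 / (N : ℝ) ≤ √(K * d * Real.log Z / N) := by
      apply Real.le_sqrt_of_sq_le
      rw [div_pow, one_pow, div_le_div_iff₀ (by positivity) (by positivity)]
      nlinarith
    exact h1.trans (le_mul_of_one_le_left (Real.sqrt_nonneg _) (by linarith))
  · rw [mul_pow, Real.sq_sqrt (by positivity)]
    have e : (N : ℝ) * ((84 * momentBound) ^ 2 * (K * d * Real.log Z / N)) / (4 * momentBound)
        = 1764 * momentBound * (K * d * Real.log Z) := by
      field_simp; norm_num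
    rw [e]
    gcongr
    linarith

/-- With probability at least `1 - δ`, the samples are of size `O(sampleScale)`, and the empirical
EM operator is close to the population one at the given initial value and uniformly in a
neighbourhood of the truth. -/
theorem le_sampleLaw_conc (g : GMM d K) (hd : 1 ≤ d) (hK : 2 ≤ K) (hN : 0 < N) {δ a : ℝ}
    (hδ : 0 < δ) (hδ1 : δ < 1) (ha : a < 1) (hl : g.leakage ≤ 1)
    {lam₀ : Fin K → ℝ} {m₀ : Fin K → EuclideanSpace ℝ (Fin d)} (h₀ : g.Near lam₀ m₀)
    (ht : g.statError N δ a ≤ 1) :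
    ENNReal.ofReal (1 - δ) ≤ g.sampleLaw N {X |
      (∀ i j, ‖X j - g.mean i‖ ≤ 4 * g.sampleScale N δ) ∧
      g.Conc X lam₀ m₀ (3 * g.statError N δ a) 1 ∧
      ∀ (r : Fin K → ℝ) (m : Fin K → EuclideanSpace ℝ (Fin d)) (D : ℝ), 0 ≤ D → D ≤ 1 / 2 →
        (∀ k, |r k - 1| ≤ D) → (∀ k, ‖m k - g.mean k‖ ≤ D) →
        g.Conc X (fun k => g.logWeight k + Real.log (r k)) m (3 * g.statError N δ a) D} := by
  classical
  obtain ⟨hZ, hdZ, -, hKZ, hNZ⟩ := g.logConst_facts hd hK hN hδ hδ1 ha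
  obtain ⟨hs1, hsZ, hsR⟩ := g.sampleScale_facts hd hK hN hδ hδ1 ha
  set t := g.statError N δ a with htdef
  set Z := g.logConst a * N / δ with hZdef
  set b := g.sampleScale N δ with hbdef
  set s := √(2 * Real.log (4 * N / δ) + 4 * d) with hsdef
  have hd' : (1 : ℝ) ≤ d := by exact_mod_cast hd
  have hK' : (2 : ℝ) ≤ K := by exact_mod_cast hK
  have hN' : (1 : ℝ) ≤ N := by exact_mod_cast hN
  have hR : 0 ≤ g.Rmax := (norm_nonneg _).trans (g.norm_mean_le_Rmax ⟨0, by omega⟩)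
  have hA := one_le_momentBound
  have hM : (N : ℝ) ≤ N / δ := le_div_self (by positivity) hδ hδ1.le
  have hNZ' : (N : ℝ) ≤ Z := hM.trans hNZ
  have hδZ : 1 / δ ≤ Z := by
    refine le_trans ?_ hNZ
    gcongr
  have hdZ1 : (d : ℝ) ≤ Z := by
    have h1 : (d : ℝ) * 1 * 1 ≤ d * (N / δ) * 1152 := by gcongr <;> linarith
    linarith
  obtain ⟨htN, htA, -⟩ := g.statError_facts hd hK hN hδ hδ1 ha
  rw [← htdef] at htN htA
  have ht0 : 0 ≤ t := le_trans (by positivity) htN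
  obtain ⟨U, hUc, hU1, hU⟩ := exists_half_net d
  -- Fine enough to make the discretization error at most `1 / N`, coarse enough for the logarithm
  -- of the net size to stay of order `K d log Z`.
  set n := ⌈Z ^ 6⌉₊ with hndef
  have hn6 : Z ^ 6 ≤ n := Nat.le_ceil _
  have hn6' : (n : ℝ) ≤ Z ^ 6 + 1 := (Nat.ceil_lt_add_one (by positivity)).le
  have hnpos : 0 < n := Nat.ceil_pos.2 (by positivity)
  have hn' : (0 : ℝ) < n := by exact_mod_cast hnpos
  obtain ⟨T, hTc, hTw, hT⟩ := g.exists_param_net hd hnpos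
  -- The initial value may lie outside the region covered by the net, but it does not depend on the
  -- samples, so adding this one point suffices.
  have hnear : ∀ θ ∈ insert (lam₀, m₀) T, g.Near θ.1 θ.2 := by
    intro θ hθ
    rcases Finset.mem_insert.1 hθ with rfl | h
    · exact h₀
    · exact (hTw θ h).near h₀.hundred_le_Rmin
  have hgood := le_sampleLaw_good (g := g) (T := insert (lam₀, m₀) T) (U := U) (s := s) (t := t)
    (δ := δ) hN hl hnear hU1 (Real.sqrt_nonneg _) ht0 (by linarith)
    (norm_tail_bound d hN hδ hδ1)
    (union_bound_count hd hK hδ hZ hKZ hδZ hn6'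
      ((Finset.card_insert_le _ _).trans (Nat.add_le_add_right hTc 1)) hUc htA)
  refine hgood.trans (measure_mono fun X hX => ?_)
  have hX : g.Good (insert (lam₀, m₀) T) U s t X := hX
  have hXb : ∀ i j, ‖X j - g.mean i‖ ≤ 4 * b := fun i j => by
    have h1 := hX.norm_le j
    have h2 := g.norm_mean_le_Rmax i
    have h3 := norm_sub_le (X j) (g.mean i)
    linarith
  refine ⟨hXb, ?_, ?_⟩
  · intro i
    have := hX.conc hU1 hU (Finset.mem_insert_self _ _) h₀ zero_le_one logitGap_one i
    exact ⟨this.1.trans (by linarith), this.2.trans (by linarith)⟩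
  · intro r m D hD0 hD hr hm
    obtain ⟨θ, hθ, D', hD', hW, hlog⟩ := hT r m D hD0 hD hr hm
    have hc := hX.conc hU1 hU (Finset.mem_insert_of_mem hθ) (hW.near h₀.hundred_le_Rmin) hW.nonneg
      hW.logitGap
    -- The `4` is the Lipschitz constant of the softmax; `6 * b` bounds `‖X j‖ + R_max + 2`, since
    -- `2 R_max + 2 s ≤ 4 b` and `b ≥ 1`.
    refine hc.perturb (ζ := 4 * (4 * d / n * (6 * b))) (b := 4 * b) hN (fun i j => ?_) hXb
      (by linarith) ?_ hl (hD'.trans ?_)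
    · refine abs_softmax_sub_le_of_forall _ _ (fun k => (hlog (X j) k).trans ?_) i
      gcongr
      have := hX.norm_le j
      linarith
    · refine le_trans ?_ htN
      calc 4 * (4 * d / n * (6 * b)) * (4 * b) = 384 * (d * b ^ 2) / n := by ring
        _ ≤ 384 * (Z * (3 * Z) ^ 2) / Z ^ 6 := by gcongr
        _ = 3456 / (Z ^ 2 * Z) := by field_simp; norm_num
        _ ≤ 1 / N := by
          rw [div_le_div_iff₀ (by positivity) (by positivity), one_mul]
          have h2 : 3456 ≤ Z ^ 2 := by
            calc (3456 : ℝ) ≤ 1152 ^ 2 := by norm_num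
              _ ≤ Z ^ 2 := by gcongr
          exact mul_le_mul h2 hNZ' (by positivity) (by positivity)
    · have : 2 * (d : ℝ) / n ≤ t := by
        refine le_trans ?_ htN
        calc 2 * (d : ℝ) / n ≤ 2 * Z / Z ^ 6 := by gcongr
          _ = 2 / (Z ^ 4 * Z) := by field_simp
          _ ≤ 1 / N := by
            rw [div_le_div_iff₀ (by positivity) (by positivity), one_mul]
            have h2 : 2 ≤ Z ^ 4 := by
              calc (2 : ℝ) ≤ Z := by linarith
                _ ≤ Z ^ 4 := le_self_pow₀ (by linarith) (by norm_num)
            exact mul_le_mul h2 hNZ' (by positivity) (by positivity)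
      linarith

end GMM

/-! ### Piecewise linear approximation of the logarithm and of the square -/

section Approx

/-- The nodes `e^{ε (n - M)}` of a geometric grid. -/
def logNode (ε : ℝ) (M n : ℕ) : ℝ := Real.exp (ε * (n - M))

/-- A ramp from `0` to `1` between two consecutive nodes. -/
def logRamp (ε : ℝ) (M n : ℕ) (x : ℝ) : ℝ :=
  max ((x - logNode ε M n) / (logNode ε M (n + 1) - logNode ε M n)) 0 -
    max ((x - logNode ε M (n + 1)) / (logNode ε M (n + 1) - logNode ε M n)) 0

/-- Piecewise linear interpolation of the logarithm on `[e^{-ε M}, 1]`, constant to the left. -/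
def logApprox (ε : ℝ) (M : ℕ) (x : ℝ) : ℝ := -(ε * M) + ∑ n ∈ Finset.range M, ε * logRamp ε M n x

lemma logNode_lt {ε : ℝ} (hε : 0 < ε) (M : ℕ) (n : ℕ) : logNode ε M n < logNode ε M (n + 1) := by
  apply Real.exp_lt_exp.2
  push_cast
  nlinarith

lemma logRamp_facts {ε : ℝ} (hε : 0 < ε) (M : ℕ) (n : ℕ) (x : ℝ) :
    0 ≤ logRamp ε M n x ∧ logRamp ε M n x ≤ 1 ∧
    (logNode ε M (n + 1) ≤ x → logRamp ε M n x = 1) ∧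
    (x ≤ logNode ε M n → logRamp ε M n x = 0) := by
  have h := sub_pos.2 (logNode_lt hε M n)
  have e : (x - logNode ε M (n + 1)) / (logNode ε M (n + 1) - logNode ε M n)
      = (x - logNode ε M n) / (logNode ε M (n + 1) - logNode ε M n) - 1 := by
    field_simp; ring
  rw [logRamp, e]
  set y := (x - logNode ε M n) / (logNode ε M (n + 1) - logNode ε M n) with hy
  refine ⟨?_, ?_, fun hx => ?_, fun hx => ?_⟩
  · rw [sub_nonneg]
    exact max_le_max (by linarith) le_rfl
  · rcases le_total y 1 with h1 | h1
    · rw [max_eq_right (by linarith : y - 1 ≤ 0), sub_zero]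
      exact max_le h1 zero_le_one
    · rw [max_eq_left (by linarith), max_eq_left (by linarith)]
      linarith
  · have : 1 ≤ y := by rw [hy, le_div_iff₀ h]; linarith
    rw [max_eq_left (by linarith), max_eq_left (by linarith)]
    ring
  · have : y ≤ 0 := div_nonpos_of_nonpos_of_nonneg (by linarith) h.le
    rw [max_eq_right this, max_eq_right (by linarith), sub_zero]

lemma logApprox_of_le {ε : ℝ} (hε : 0 < ε) (M : ℕ) {x : ℝ} (hx : x ≤ logNode ε M 0) :
    logApprox ε M x = -(ε * M) := by
  rw [logApprox, Finset.sum_eq_zero, add_zero]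
  intro n _
  rw [(logRamp_facts hε M n x).2.2.2, mul_zero]
  refine hx.trans (Real.exp_le_exp.2 ?_)
  push_cast
  have : (0 : ℝ) ≤ n := n.cast_nonneg
  nlinarith

/-- In the logarithmic coordinate `y`, nodes below `x` contribute full ramps and nodes above
contribute none, so the sum of the ramps lies between `⌊y⌋` and `⌈y⌉`. -/
lemma abs_logApprox_sub_log_le {ε : ℝ} (hε : 0 < ε) (M : ℕ) {x : ℝ}
    (hx : logNode ε M 0 ≤ x) (hx1 : x ≤ 1) :
    |logApprox ε M x - Real.log x| ≤ ε := by
  have hx0 : 0 < x := (Real.exp_pos _).trans_le hx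
  set y := Real.log x / ε + M with hy
  have hlog : Real.log x = ε * (y - M) := by rw [hy]; field_simp; ring
  have hy0 : 0 ≤ y := by
    have := (Real.le_log_iff_exp_le hx0).2 hx
    rw [hlog] at this
    push_cast at this
    nlinarith
  have hyM : y ≤ M := by
    have := Real.log_nonpos hx0.le hx1
    rw [hlog] at this
    nlinarith
  have hxe : x = Real.exp (ε * (y - M)) := by rw [← hlog, Real.exp_log hx0]
  have hlo : y - 1 ≤ ∑ n ∈ Finset.range M, logRamp ε M n x := by
    calc y - 1 ≤ (⌊y⌋₊ : ℝ) := by linarith [Nat.lt_floor_add_one y]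
      _ = ∑ n ∈ Finset.range ⌊y⌋₊, logRamp ε M n x := by
        rw [Finset.sum_congr rfl (g := fun _ => (1 : ℝ)) fun n hn => ?_]
        · simp
        · refine (logRamp_facts hε M n x).2.2.1 ?_
          rw [hxe]
          apply Real.exp_le_exp.2
          have h1 : n + 1 ≤ ⌊y⌋₊ := Finset.mem_range.1 hn
          have h2 : ((n + 1 : ℕ) : ℝ) ≤ y := (Nat.cast_le.2 h1).trans (Nat.floor_le hy0)
          nlinarith
      _ ≤ _ := Finset.sum_le_sum_of_subset_of_nonneg
        (Finset.range_mono (Nat.floor_le_of_le hyM)) fun n _ _ => (logRamp_facts hε M n x).1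
  have hup : ∑ n ∈ Finset.range M, logRamp ε M n x ≤ y + 1 := by
    calc ∑ n ∈ Finset.range M, logRamp ε M n x
        ≤ ∑ n ∈ Finset.range M, if n < ⌈y⌉₊ then (1 : ℝ) else 0 := by
          refine Finset.sum_le_sum fun n _ => ?_
          split_ifs with h
          · exact (logRamp_facts hε M n x).2.1
          · refine ((logRamp_facts hε M n x).2.2.2 ?_).le
            rw [hxe]
            apply Real.exp_le_exp.2
            have h1 : y ≤ n := (Nat.le_ceil y).trans (Nat.cast_le.2 (not_lt.1 h))
            nlinarith
      _ ≤ (⌈y⌉₊ : ℝ) := by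
          rw [Finset.sum_ite, Finset.sum_const_zero, add_zero, Finset.sum_const, nsmul_one]
          have : (Finset.range M).filter (fun n => n < ⌈y⌉₊) ⊆ Finset.range ⌈y⌉₊ := fun n hn =>
            Finset.mem_range.2 (Finset.mem_filter.1 hn).2
          have := Finset.card_le_card this
          rw [Finset.card_range] at this
          exact_mod_cast this
      _ ≤ y + 1 := (Nat.ceil_lt_add_one hy0).le
  rw [logApprox, hlog, ← Finset.mul_sum, abs_le]
  constructor <;> nlinarith

/-- Near `0` the logarithm itself is not approximated, but the softmax sees only its exponential,
and there the truncation costs at most the first node. -/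
lemma abs_exp_logApprox_sub_le {ε : ℝ} (hε : 0 < ε) (M : ℕ) {w : ℝ} (hε1 : ε ≤ 1)
    (hM : logNode ε M 0 ≤ ε) (hw : 0 ≤ w)
    (hw1 : w ≤ 1) : |Real.exp (logApprox ε M w) - w| ≤ 2 * ε := by
  rcases le_total w (logNode ε M 0) with h | h
  · have e : Real.exp (logApprox ε M w) = logNode ε M 0 := by
      rw [logApprox_of_le hε M h, logNode]; push_cast; ring_nf
    rw [e, abs_of_nonneg (by linarith)]
    linarith
  · have hw0 : 0 < w := (Real.exp_pos _).trans_le h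
    have h1 := abs_logApprox_sub_log_le hε M h hw1
    have e : Real.exp (logApprox ε M w) - w
        = w * (Real.exp (logApprox ε M w - Real.log w) - 1) := by
      rw [Real.exp_sub, Real.exp_log hw0]; field_simp
    rw [e, abs_mul, abs_of_pos hw0]
    have h2 := Real.abs_exp_sub_one_le (h1.trans hε1)
    have h3 : |Real.exp (logApprox ε M w - Real.log w) - 1| ≤ 2 * ε := h2.trans (by linarith)
    have h4 := abs_nonneg (Real.exp (logApprox ε M w - Real.log w) - 1)
    nlinarith

/-- Piecewise linear interpolation of `x ↦ (x⁺)²` on a grid of mesh `h`. -/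
def sqApprox (h : ℝ) (m : ℕ) (x : ℝ) : ℝ :=
  ∑ n ∈ Finset.range (m + 1), (if n = 0 then h else 2 * h) * max (x - n * h) 0

lemma sqApprox_of_nonpos {h : ℝ} (hh : 0 ≤ h) (m : ℕ) {x : ℝ} (hx : x ≤ 0) :
    sqApprox h m x = 0 := by
  refine Finset.sum_eq_zero fun n _ => ?_
  rw [max_eq_right (sub_nonpos.2 (hx.trans (by positivity))), mul_zero]

lemma sqApprox_succ (h : ℝ) (m : ℕ) (x : ℝ) :
    sqApprox h (m + 1) x = sqApprox h m x + 2 * h * max (x - (m + 1) * h) 0 := by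
  rw [sqApprox, Finset.sum_range_succ, sqApprox]
  simp

/-- The line through the values of the square at `m h` and `(m + 1) h`; beyond the last node the
approximation follows this chord. -/
lemma sqApprox_of_ge {h : ℝ} (hh : 0 ≤ h) (m : ℕ) {x : ℝ} (hx : m * h ≤ x) :
    sqApprox h m x = (2 * m + 1) * h * x - m * (m + 1) * h ^ 2 := by
  induction m with
  | zero => simp at hx; simp [sqApprox, hx]
  | succ m ih =>
    push_cast at hx
    rw [sqApprox_succ, ih (by nlinarith), max_eq_left (by linarith)]
    push_cast
    ring

lemma sqApprox_bounds {h : ℝ} (hh : 0 ≤ h) (m : ℕ) {x : ℝ} (hx0 : 0 ≤ x) (hx : x ≤ (m + 1) * h) :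
    x ^ 2 ≤ sqApprox h m x ∧ sqApprox h m x ≤ x ^ 2 + h ^ 2 := by
  induction m with
  | zero =>
    rw [sqApprox_of_ge hh 0 (by simpa using hx0)]
    push_cast at hx ⊢
    constructor <;> nlinarith
  | succ m ih =>
    rcases le_total x ((m + 1) * h) with h1 | h1
    · rw [sqApprox_succ, max_eq_right (by linarith), mul_zero, add_zero]
      exact ih h1
    · rw [sqApprox_of_ge hh (m + 1) (by push_cast; exact h1)]
      push_cast at hx ⊢
      set r := x - (m + 1) * h with hr
      have e : x = (m + 1) * h + r := by rw [hr]; ring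
      have hr0 : 0 ≤ r := by linarith
      have hrh : r ≤ h := by linarith
      rw [e]
      constructor <;> nlinarith

lemma abs_sqApprox_add_sub_le {h : ℝ} (hh : 0 ≤ h) (m : ℕ) {x : ℝ} (hx : |x| ≤ (m + 1) * h) :
    |sqApprox h m x + sqApprox h m (-x) - x ^ 2| ≤ h ^ 2 := by
  rcases le_total 0 x with h0 | h0
  · rw [abs_of_nonneg h0] at hx
    have := sqApprox_bounds hh m h0 hx
    rw [sqApprox_of_nonpos hh m (by linarith : -x ≤ 0), abs_le]
    constructor <;> linarith [sq_nonneg h]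
  · rw [abs_of_nonpos h0] at hx
    have := sqApprox_bounds hh m (by linarith) hx
    rw [neg_sq] at this
    rw [sqApprox_of_nonpos hh m h0, abs_le]
    constructor <;> linarith [sq_nonneg h]

end Approx

/-! ### Building blocks of the transformer -/

section Blocks

/-- The `ℓ²` operator norm is bounded by the number of entries times their size. -/
lemma l2_opNorm_le_card_mul {m n : Type*} [Fintype m] [Fintype n] [DecidableEq n]
    (A : Matrix m n ℝ) {c : ℝ} (h : ∀ i j, |A i j| ≤ c) (hc : 0 ≤ c) :
    ‖A‖ ≤ Fintype.card m * Fintype.card n * c := by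
  rw [Matrix.l2_opNorm_def]
  refine ContinuousLinearMap.opNorm_le_bound _ (by positivity) fun x => ?_
  have hx : ∀ i, |(A *ᵥ x.ofLp) i| ≤ Fintype.card n * c * ‖x‖ := fun i => by
    simp only [Matrix.mulVec, dotProduct]
    refine (Finset.abs_sum_le_sum_abs _ _).trans
      ((Finset.sum_le_sum (g := fun _ => c * ‖x‖) fun j _ => ?_).trans_eq ?_)
    · rw [abs_mul]
      exact mul_le_mul (h i j) (PiLp.norm_apply_le x j) (abs_nonneg _) hc
    · simp [mul_assoc]
  have hy : ∀ y : EuclideanSpace ℝ m, ‖y‖ ≤ ∑ i, |y i| := fun y => by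
    classical
    conv_lhs => rw [← (EuclideanSpace.basisFun m ℝ).sum_repr y]
    refine (norm_sum_le _ _).trans (Finset.sum_le_sum fun i _ => ?_)
    rw [norm_smul]
    simp
  refine (hy _).trans ((Finset.sum_le_sum fun i _ => hx i).trans_eq ?_)
  simp [mul_assoc]

variable {ι : Type} [Fintype ι]

/-- A layer with prescribed heads and hidden units, the latter being given by their input and
output weights. -/
def layerOf {σ : Type} [Fintype σ] (n : ℕ) (head : Fin n → Head ι) (inW outW : σ → ι → ℝ) :
    Layer ι where
  heads := n
  head := head
  width := Fintype.card σ
  W₁ := fun r => inW ((Fintype.equivFin σ).symm r)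
  W₂ := fun i r => outW ((Fintype.equivFin σ).symm r) i

lemma layerOf_mlp {σ : Type} [Fintype σ] {n : ℕ} (head : Fin n → Head ι) (inW outW : σ → ι → ℝ)
    {N : ℕ} (H : Fin N → ι → ℝ) (j : Fin N) (i : ι) :
    (layerOf n head inW outW).mlp H j i = H j i + ∑ u, outW u i * max (inW u ⬝ᵥ H j) 0 := by
  simp only [Layer.mlp, layerOf, Pi.add_apply, Matrix.mulVec, dotProduct]
  congr 1
  exact Fintype.sum_equiv (Fintype.equivFin σ).symm _ _ fun r => rfl

lemma layerOf_attn {σ : Type} [Fintype σ] {n : ℕ} (head : Fin n → Head ι) (inW outW : σ → ι → ℝ)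
    {N : ℕ} (H : Fin N → ι → ℝ) (j : Fin N) (i : ι) :
    (layerOf n head inW outW).attn H j i = H j i + ∑ h, ∑ l,
      softmax (fun l => ((head h).Q *ᵥ H j) ⬝ᵥ ((head h).K *ᵥ H l)) l * ((head h).V *ᵥ H l) i := by
  simp [Layer.attn, layerOf, Finset.sum_apply]
  rfl

variable [DecidableEq ι]

/-- The matrix whose row `r` extracts a multiple of one coordinate, or is zero. -/
def rowSelect (s : ι → Option (ι × ℝ)) : Matrix ι ι ℝ := fun r c =>
  (s r).elim 0 fun p => if c = p.1 then p.2 else 0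

lemma rowSelect_mulVec (s : ι → Option (ι × ℝ)) (h : ι → ℝ) (r : ι) :
    (rowSelect s *ᵥ h) r = (s r).elim 0 fun p => p.2 * h p.1 := by
  simp only [Matrix.mulVec, dotProduct, rowSelect]
  rcases s r with _ | p <;> simp

lemma norm_rowSelect_le (s : ι → Option (ι × ℝ)) (hs : ∀ r p, s r = some p → |p.2| ≤ 1) :
    ‖rowSelect s‖ ≤ Fintype.card ι * Fintype.card ι * 1 := by
  refine l2_opNorm_le_card_mul _ (fun r c => ?_) zero_le_one
  rw [rowSelect]
  rcases h : s r with _ | p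
  · simp
  · have := hs r p h
    simp only [Option.elim_some]
    split_ifs <;> simp [this]

/-- Counting entries is crude but harmless, since only the logarithm of the norm has to be
controlled. -/
lemma layerOf_norm_le {σ : Type} [Fintype σ] {n : ℕ} (head : Fin n → Head ι)
    (inW outW : σ → ι → ℝ) {c : ℝ} (hc : 1 ≤ c)
    (hh : ∀ h, ‖(head h).Q‖ ≤ Fintype.card ι * Fintype.card ι * 1 ∧
      ‖(head h).K‖ ≤ Fintype.card ι * Fintype.card ι * 1 ∧
      ‖(head h).V‖ ≤ Fintype.card ι * Fintype.card ι * 1)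
    (hin : ∀ u i, |inW u i| ≤ c) (hout : ∀ u i, |outW u i| ≤ c) :
    (layerOf n head inW outW).norm
      ≤ (Fintype.card ι * Fintype.card ι + 2 * (Fintype.card σ * Fintype.card ι)) * c := by
  have h1 : (⨆ m, max (max ‖(head m).Q‖ ‖(head m).K‖) ‖(head m).V‖)
      ≤ Fintype.card ι * Fintype.card ι * 1 :=
    Real.iSup_le (fun m => max_le (max_le (hh m).1 (hh m).2.1) (hh m).2.2) (by positivity)
  have h2 : ‖(layerOf n head inW outW).W₁‖ ≤ Fintype.card σ * Fintype.card ι * c := by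
    have := l2_opNorm_le_card_mul (layerOf n head inW outW).W₁ (c := c)
      (fun r i => hin _ i) (by linarith)
    rw [show Fintype.card (Fin (layerOf n head inW outW).width) = Fintype.card σ from
      Fintype.card_fin _] at this
    exact this
  have h3 : ‖(layerOf n head inW outW).W₂‖ ≤ Fintype.card ι * Fintype.card σ * c := by
    have := l2_opNorm_le_card_mul (layerOf n head inW outW).W₂ (c := c)
      (fun i r => hout _ i) (by linarith)
    rw [show Fintype.card (Fin (layerOf n head inW outW).width) = Fintype.card σ from
      Fintype.card_fin _] at this
    exact this
  have h4 : (Fintype.card ι * Fintype.card ι * 1 : ℝ) ≤ Fintype.card ι * Fintype.card ι * c := by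
    gcongr
  calc _ ≤ (Fintype.card ι * Fintype.card ι * 1 : ℝ) + Fintype.card σ * Fintype.card ι * c
        + Fintype.card ι * Fintype.card σ * c := add_le_add (add_le_add h1 h2) h3
    _ ≤ _ := by linarith

end Blocks

section Rows

variable {d₀ K₀ Dpad : ℕ}

/-- Rows as a sum type. -/
def rowEquiv : Row d₀ K₀ Dpad ≃ (Fin d₀ ⊕ Fin K₀ ⊕ Fin d₀ ⊕ Unit ⊕ Fin K₀ ⊕ Fin K₀ ⊕ Fin K₀ ⊕
    Fin Dpad ⊕ Unit ⊕ Fin K₀) where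
  toFun
    | .x i => .inl i
    | .logWeight k => .inr (.inl k)
    | .mean i => .inr (.inr (.inl i))
    | .sqNorm => .inr (.inr (.inr (.inl ())))
    | .resp k => .inr (.inr (.inr (.inr (.inl k))))
    | .logResp k => .inr (.inr (.inr (.inr (.inr (.inl k)))))
    | .weight k => .inr (.inr (.inr (.inr (.inr (.inr (.inl k))))))
    | .pad i => .inr (.inr (.inr (.inr (.inr (.inr (.inr (.inl i)))))))
    | .one => .inr (.inr (.inr (.inr (.inr (.inr (.inr (.inr (.inl ()))))))))
    | .pos k => .inr (.inr (.inr (.inr (.inr (.inr (.inr (.inr (.inr k))))))))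
  invFun
    | .inl i => .x i
    | .inr (.inl k) => .logWeight k
    | .inr (.inr (.inl i)) => .mean i
    | .inr (.inr (.inr (.inl ()))) => .sqNorm
    | .inr (.inr (.inr (.inr (.inl k)))) => .resp k
    | .inr (.inr (.inr (.inr (.inr (.inl k))))) => .logResp k
    | .inr (.inr (.inr (.inr (.inr (.inr (.inl k)))))) => .weight k
    | .inr (.inr (.inr (.inr (.inr (.inr (.inr (.inl i))))))) => .pad i
    | .inr (.inr (.inr (.inr (.inr (.inr (.inr (.inr (.inl ())))))))) => .one
    | .inr (.inr (.inr (.inr (.inr (.inr (.inr (.inr (.inr k)))))))) => .pos k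
  left_inv r := by cases r <;> rfl
  right_inv := by
    rintro (_ | _ | _ | _ | _ | _ | _ | _ | _ | _) <;> rfl

lemma sum_row (f : Row d₀ K₀ Dpad → ℝ) :
    ∑ r, f r = ∑ i, f (.x i) + (∑ k, f (.logWeight k) + (∑ i, f (.mean i) + (f .sqNorm +
      (∑ k, f (.resp k) + (∑ k, f (.logResp k) + (∑ k, f (.weight k) + (∑ i, f (.pad i) +
      (f .one + ∑ k, f (.pos k))))))))) := by
  rw [Fintype.sum_equiv rowEquiv f (fun s => f (rowEquiv.symm s)) fun r => by simp]
  simp only [Fintype.sum_sum_type, Finset.univ_unique, Finset.sum_singleton]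
  rfl

lemma card_row : Fintype.card (Row d₀ K₀ Dpad) = 2 * d₀ + 5 * K₀ + 2 + Dpad := by
  rw [Fintype.card_congr rowEquiv]
  simp only [Fintype.card_sum, Fintype.card_fin, Fintype.card_unit]
  ring

/-- The token with the given blocks. -/
def tok (x : Fin d₀ → ℝ) (lw : Fin K₀ → ℝ) (mn : Fin d₀ → ℝ) (sq : ℝ) (rs lr wt ps : Fin K₀ → ℝ) :
    Row d₀ K₀ 0 → ℝ
  | .x i => x i
  | .logWeight k => lw k
  | .mean i => mn i
  | .sqNorm => sq
  | .resp k => rs k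
  | .logResp k => lr k
  | .weight k => wt k
  | .pad _ => 0
  | .one => 1
  | .pos k => ps k

end Rows

/-! ### The two layers that perform an EM step -/

section EMLayers

variable {d₀ K₀ : ℕ}

/-- The attention head that computes responsibilities. -/
def respHead : Head (Row d₀ K₀ 0) where
  Q := rowSelect fun
    | .x i => some (.x i, 1)
    | .logWeight k => some (.logWeight k, 1)
    | .one => some (.one, -1 / 2)
    | _ => none
  K := rowSelect fun
    | .x i => some (.mean i, 1)
    | .logWeight k => some (.pos k, 1)
    | .one => some (.sqNorm, 1)
    | _ => none
  V := rowSelect fun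
    | .resp k => some (.pos k, 1)
    | _ => none

/-- The attention head that computes the new means. -/
def meanHead : Head (Row d₀ K₀ 0) where
  Q := rowSelect fun
    | .pos k => some (.pos k, 1)
    | _ => none
  K := rowSelect fun
    | .pos k => some (.logResp k, 1)
    | _ => none
  V := rowSelect fun
    | .mean i => some (.x i, 1)
    | _ => none

/-- The attention head that computes the new weights. -/
def weightHead : Head (Row d₀ K₀ 0) where
  Q := rowSelect fun _ => none
  K := rowSelect fun _ => none
  V := rowSelect fun
    | .weight k => some (.resp k, 1)
    | _ => none

/-- The hidden units of the MLPs: two per coordinate for clearing it, and those of the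
approximations of the logarithm and of the square. -/
abbrev Units (d₀ K₀ M m : ℕ) : Type :=
  (Row d₀ K₀ 0 × Bool) ⊕ Fin K₀ ⊕ (Fin K₀ × Fin M × Bool) ⊕ (Fin d₀ × Fin (m + 1) × Bool)

/-- The sign encoded by a Boolean. -/
def sgn (b : Bool) : ℝ := if b then -1 else 1

/-- The input weights of the hidden units, with the logarithm applied to the rows `src k`. -/
def inWeight (ε : ℝ) (M m : ℕ) (src : Fin K₀ → Row d₀ K₀ 0) :
    Units d₀ K₀ M m → Row d₀ K₀ 0 → ℝ
  | .inl (r, b) => Pi.single r (sgn b)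
  | .inr (.inl _) => Pi.single .one 1
  | .inr (.inr (.inl (k, n, b))) =>
      Pi.single (src k) (1 / (logNode ε M (n + 1) - logNode ε M n)) +
        Pi.single .one (-(logNode ε M (n + b.toNat) / (logNode ε M (n + 1) - logNode ε M n)))
  | .inr (.inr (.inr (i, n, b))) => Pi.single (.mean i) (sgn b) + Pi.single .one (-(n * ε))

/-- The output weights of the hidden units: the rows in `clr` are cleared, the logarithms are
added to the rows `tgt k`, and `χ` times the squared norm is added to its row. -/
def outWeight (ε : ℝ) (M m : ℕ) (clr : Row d₀ K₀ 0 → ℝ) (tgt : Fin K₀ → Row d₀ K₀ 0) (χ : ℝ) :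
    Units d₀ K₀ M m → Row d₀ K₀ 0 → ℝ
  | .inl (r, b) => Pi.single r (-(sgn b * clr r))
  | .inr (.inl k) => Pi.single (tgt k) (-(ε * M))
  | .inr (.inr (.inl (k, _, b))) => Pi.single (tgt k) (sgn b * ε)
  | .inr (.inr (.inr (_, n, _))) => Pi.single .sqNorm (χ * if (n : ℕ) = 0 then ε else 2 * ε)

/-- `y = max y 0 - max (-y) 0`: two hidden units reproduce a coordinate, which lets the network
erase what the residual connection carries along. -/
lemma sum_clear (clr h : Row d₀ K₀ 0 → ℝ) (i : Row d₀ K₀ 0) :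
    ∑ u : Row d₀ K₀ 0 × Bool, (Pi.single u.1 (-(sgn u.2 * clr u.1)) : Row d₀ K₀ 0 → ℝ) i *
      max ((Pi.single u.1 (sgn u.2) : Row d₀ K₀ 0 → ℝ) ⬝ᵥ h) 0 = -(clr i * h i) := by
  rw [Fintype.sum_prod_type]
  simp only [Fintype.sum_bool, sgn, single_dotProduct, if_true, Bool.false_eq_true, if_false]
  rw [Finset.sum_eq_single i]
  · rw [Pi.single_eq_same, Pi.single_eq_same]
    rcases le_total 0 (h i) with h0 | h0
    · rw [max_eq_right (by linarith : -1 * h i ≤ 0), max_eq_left (by linarith : 0 ≤ 1 * h i)]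
      ring
    · rw [max_eq_left (by linarith : 0 ≤ -1 * h i), max_eq_right (by linarith : 1 * h i ≤ 0)]
      ring
  · intro r _ hr
    rw [Pi.single_eq_of_ne hr.symm, Pi.single_eq_of_ne hr.symm]
    ring
  · simp

/-- Each ramp is a difference of two ReLUs with thresholds at consecutive nodes; biases are read off
the constant coordinate. -/
lemma sum_log_units (ε : ℝ) (M m : ℕ) (src tgt : Fin K₀ → Row d₀ K₀ 0) (h : Row d₀ K₀ 0 → ℝ)
    (h1 : h .one = 1) (i : Row d₀ K₀ 0) (clr : Row d₀ K₀ 0 → ℝ) (χ : ℝ) :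
    (∑ k : Fin K₀, outWeight ε M m clr tgt χ (.inr (.inl k)) i *
        max (inWeight ε M m src (.inr (.inl k)) ⬝ᵥ h) 0) +
      ∑ u : Fin K₀ × Fin M × Bool, outWeight ε M m clr tgt χ (.inr (.inr (.inl u))) i *
        max (inWeight ε M m src (.inr (.inr (.inl u))) ⬝ᵥ h) 0
      = ∑ k, (Pi.single (tgt k) (logApprox ε M (h (src k))) : Row d₀ K₀ 0 → ℝ) i := by
  rw [Fintype.sum_prod_type, ← Finset.sum_add_distrib]
  refine Finset.sum_congr rfl fun k _ => ?_
  rw [Fintype.sum_prod_type]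
  simp only [Fintype.sum_bool, outWeight, inWeight, sgn, if_true, Bool.false_eq_true, if_false,
    add_dotProduct, single_dotProduct, h1, mul_one, Bool.toNat_true, Bool.toNat_false, add_zero]
  by_cases hi : i = tgt k
  · subst hi
    simp only [Pi.single_eq_same]
    rw [logApprox, ← Fin.sum_univ_eq_sum_range (fun n => ε * logRamp ε M n (h (src k)))]
    congr 1
    · simp
    · refine Finset.sum_congr rfl fun n _ => ?_
      rw [logRamp, sub_div, sub_div]
      ring_nf
  · simp [Pi.single_eq_of_ne hi]

lemma sum_sq_units (ε : ℝ) (M m : ℕ) (src tgt : Fin K₀ → Row d₀ K₀ 0) (h : Row d₀ K₀ 0 → ℝ)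
    (h1 : h .one = 1) (i : Row d₀ K₀ 0) (clr : Row d₀ K₀ 0 → ℝ) (χ : ℝ) :
    ∑ u : Fin d₀ × Fin (m + 1) × Bool, outWeight ε M m clr tgt χ (.inr (.inr (.inr u))) i *
        max (inWeight ε M m src (.inr (.inr (.inr u))) ⬝ᵥ h) 0
      = (Pi.single .sqNorm (χ * ∑ c, (sqApprox ε m (h (.mean c)) + sqApprox ε m (-h (.mean c)))) :
        Row d₀ K₀ 0 → ℝ) i := by
  rw [Fintype.sum_prod_type]
  simp only [Fintype.sum_prod_type, Fintype.sum_bool, outWeight, inWeight, sgn, if_true,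
    Bool.false_eq_true, if_false, add_dotProduct, single_dotProduct, h1, mul_one]
  by_cases hi : i = .sqNorm
  · subst hi
    simp only [Pi.single_eq_same]
    rw [Finset.mul_sum]
    refine Finset.sum_congr rfl fun c _ => ?_
    rw [sqApprox, sqApprox, ← Fin.sum_univ_eq_sum_range
        (fun n => (if n = 0 then ε else 2 * ε) * max (h (.mean c) - n * ε) 0),
      ← Fin.sum_univ_eq_sum_range
        (fun n => (if n = 0 then ε else 2 * ε) * max (-h (.mean c) - n * ε) 0),
      ← Finset.sum_add_distrib, Finset.mul_sum]
    refine Finset.sum_congr rfl fun n _ => ?_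
    ring_nf
  · simp [Pi.single_eq_of_ne hi]

/-- The common form of the layers. -/
def emLayer (ε : ℝ) (M m n : ℕ) (head : Fin n → Head (Row d₀ K₀ 0)) (clr : Row d₀ K₀ 0 → ℝ)
    (src tgt : Fin K₀ → Row d₀ K₀ 0) (χ : ℝ) : Layer (Row d₀ K₀ 0) :=
  layerOf n head (inWeight ε M m src) (outWeight ε M m clr tgt χ)

lemma emLayer_mlp (ε : ℝ) (M m n : ℕ) (head : Fin n → Head (Row d₀ K₀ 0)) (clr : Row d₀ K₀ 0 → ℝ)
    (src tgt : Fin K₀ → Row d₀ K₀ 0) (χ : ℝ) {N : ℕ} (H : Fin N → Row d₀ K₀ 0 → ℝ) (j : Fin N)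
    (h1 : H j .one = 1) (i : Row d₀ K₀ 0) :
    (emLayer ε M m n head clr src tgt χ).mlp H j i
      = (1 - clr i) * H j i +
        ∑ k, (Pi.single (tgt k) (logApprox ε M (H j (src k))) : Row d₀ K₀ 0 → ℝ) i +
        (Pi.single .sqNorm (χ * ∑ c, (sqApprox ε m (H j (.mean c)) +
          sqApprox ε m (-H j (.mean c)))) : Row d₀ K₀ 0 → ℝ) i := by
  rw [emLayer, layerOf_mlp]
  simp only [Fintype.sum_sum_type]
  rw [← sum_log_units ε M m src tgt (H j) h1 i clr χ, ← sum_sq_units ε M m src tgt (H j) h1 i clr χ]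
  have := sum_clear clr (H j) i
  have e : ∑ u : Row d₀ K₀ 0 × Bool, outWeight ε M m clr tgt χ (.inl u) i *
      max (inWeight ε M m src (.inl u) ⬝ᵥ H j) 0 = -(clr i * H j i) := this
  rw [e]
  ring

/-- The rows cleared by the first MLP. -/
def clearOld : Row d₀ K₀ 0 → ℝ
  | .logWeight _ => 1
  | .mean _ => 1
  | .sqNorm => 1
  | .weight _ => 1
  | _ => 0

/-- The rows cleared by the second MLP. -/
def clearScratch : Row d₀ K₀ 0 → ℝ
  | .resp _ => 1
  | .logResp _ => 1
  | _ => 0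

/-- The layer for the E-step. -/
def eLayer (d₀ K₀ : ℕ) (ε : ℝ) (M m : ℕ) : Layer (Row d₀ K₀ 0) :=
  emLayer ε M m 1 (fun _ => respHead) clearOld .resp .logResp 0

/-- The layer for the M-step. -/
def mLayer (d₀ K₀ : ℕ) (ε : ℝ) (M m : ℕ) : Layer (Row d₀ K₀ 0) :=
  emLayer ε M m 2 ![meanHead, weightHead] clearScratch .weight .logWeight 1

lemma sum_single_row (c : Fin K₀ → Row d₀ K₀ 0) (hc : Function.Injective c) (a : Fin K₀ → ℝ)
    (k : Fin K₀) : ∑ l, (Pi.single (c l) (a l) : Row d₀ K₀ 0 → ℝ) (c k) = a k := by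
  rw [Finset.sum_eq_single k]
  · simp
  · intro l _ hl
    exact Pi.single_eq_of_ne (fun h => hl (hc h).symm) _
  · simp

lemma sum_single_row_of_ne (c : Fin K₀ → Row d₀ K₀ 0) (a : Fin K₀ → ℝ) {i : Row d₀ K₀ 0}
    (h : ∀ k, i ≠ c k) : ∑ l, (Pi.single (c l) (a l) : Row d₀ K₀ 0 → ℝ) i = 0 :=
  Finset.sum_eq_zero fun l _ => Pi.single_eq_of_ne (h l) _

variable {N : ℕ} (x : Fin N → Fin d₀ → ℝ) (lw : Fin K₀ → ℝ) (mn : Fin N → Fin d₀ → ℝ)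
  (sq : Fin N → ℝ) (rs lr : Fin N → Fin K₀ → ℝ) (wt : Fin K₀ → ℝ) (ps : Fin N → Fin K₀ → ℝ)
  (ε : ℝ) (M m : ℕ)

/-- The score is the logit: samples meet means, log-weights meet the position vector that selects
the carried component, and the constant coordinate meets `sqNorm` with factor `-1 / 2`. -/
lemma eLayer_attn :
    (eLayer d₀ K₀ ε M m).attn (fun j => tok (x j) lw (mn j) (sq j) 0 0 wt (ps j))
      = fun j => tok (x j) lw (mn j) (sq j) (fun k => ∑ l, softmax (fun l => ∑ i, x j i * mn l i +
          (∑ k, lw k * ps l k - sq l / 2)) l * ps l k) 0 wt (ps j) := by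
  funext j r
  rw [eLayer, emLayer, layerOf_attn]
  have hs : ∀ l, (respHead.Q *ᵥ tok (x j) lw (mn j) (sq j) 0 0 wt (ps j)) ⬝ᵥ
      (respHead.K *ᵥ tok (x l) lw (mn l) (sq l) 0 0 wt (ps l))
      = ∑ i, x j i * mn l i + (∑ k, lw k * ps l k - sq l / 2) := fun l => by
    rw [dotProduct, sum_row]
    simp only [respHead, rowSelect_mulVec, Option.elim_some, Option.elim_none, tok]
    simp
    ring
  simp only [Finset.univ_unique, Finset.sum_singleton, hs]
  cases r <;> simp [respHead, rowSelect_mulVec, tok]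

/-- Layers only add to the tokens, so the old parameters are cleared here to let the M-step write
into their rows. -/
lemma eLayer_mlp :
    (eLayer d₀ K₀ ε M m).mlp (fun j => tok (x j) lw (mn j) (sq j) (rs j) 0 wt (ps j))
      = fun j => tok (x j) 0 0 0 (rs j) (fun k => logApprox ε M (rs j k)) 0 (ps j) := by
  funext j r
  rw [eLayer, emLayer_mlp _ _ _ _ _ _ _ _ _ _ _ rfl]
  have hinj : Function.Injective (Row.logResp : Fin K₀ → Row d₀ K₀ 0) := fun a b h => by
    simpa using h
  cases r with
  | logResp k =>
    rw [sum_single_row _ hinj]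
    simp [tok, clearOld]
  | _ =>
    rw [sum_single_row_of_ne _ _ (by simp)]
    simp [tok, clearOld]

/-- The softmax over samples undoes the logarithm and normalizes, giving a responsibility-weighted
mean; the zero score gives the uniform average. -/
lemma mLayer_attn :
    (mLayer d₀ K₀ ε M m).attn (fun j => tok (x j) 0 0 0 (rs j) (lr j) 0 (ps j))
      = fun j => tok (x j) 0 (fun i => ∑ l, softmax (fun l => ∑ k, ps j k * lr l k) l * x l i) 0
          (rs j) (lr j) (fun k => ∑ l, softmax (fun _ : Fin N => (0 : ℝ)) l * rs l k) (ps j) := by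
  funext j r
  rw [mLayer, emLayer, layerOf_attn]
  have hs : ∀ l, (meanHead.Q *ᵥ tok (x j) 0 0 0 (rs j) (lr j) 0 (ps j)) ⬝ᵥ
      (meanHead.K *ᵥ tok (x l) 0 0 0 (rs l) (lr l) 0 (ps l)) = ∑ k, ps j k * lr l k := fun l => by
    rw [dotProduct, sum_row]
    simp only [meanHead, rowSelect_mulVec, Option.elim_some, Option.elim_none, tok]
    simp
  have hs' : ∀ l, (weightHead.Q *ᵥ tok (x j) 0 0 0 (rs j) (lr j) 0 (ps j)) ⬝ᵥ
      (weightHead.K *ᵥ tok (x l) 0 0 0 (rs l) (lr l) 0 (ps l)) = 0 := fun l => by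
    simp only [dotProduct, weightHead, rowSelect_mulVec, Option.elim_none, mul_zero,
      Finset.sum_const_zero]
  simp only [Fin.sum_univ_two, Matrix.cons_val_zero, Matrix.cons_val_one, hs, hs']
  cases r <;> simp [meanHead, weightHead, rowSelect_mulVec, tok]

lemma mLayer_mlp (wt : Fin N → Fin K₀ → ℝ) :
    (mLayer d₀ K₀ ε M m).mlp (fun j => tok (x j) 0 (mn j) 0 (rs j) (lr j) (wt j) (ps j))
      = fun j => tok (x j) (fun k => logApprox ε M (wt j k)) (mn j)
          (∑ c, (sqApprox ε m (mn j c) + sqApprox ε m (-mn j c))) 0 0 (wt j) (ps j) := by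
  funext j r
  rw [mLayer, emLayer_mlp _ _ _ _ _ _ _ _ _ _ _ rfl]
  have hinj : Function.Injective (Row.logWeight : Fin K₀ → Row d₀ K₀ 0) := fun a b h => by
    simpa using h
  cases r with
  | logWeight k =>
    rw [sum_single_row _ hinj]
    simp [tok, clearScratch]
  | _ =>
    rw [sum_single_row_of_ne _ _ (by simp)]
    simp [tok, clearScratch]

end EMLayers

/-! ### The transformer iterates an approximate EM step -/

section Semantics

/-- Padding by zeros. -/
def padTo {n : ℕ} (n₀ : ℕ) (a : Fin n → ℝ) (i : Fin n₀) : ℝ :=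
  if h : (i : ℕ) < n then a ⟨i, h⟩ else 0

lemma padTo_castLE {n n₀ : ℕ} (h : n ≤ n₀) (a : Fin n → ℝ) (i : Fin n) :
    padTo n₀ a (Fin.castLE h i) = a i := by
  simp [padTo]

lemma padTo_of_le {n n₀ : ℕ} (a : Fin n → ℝ) {i : Fin n₀} (hi : n ≤ i) : padTo n₀ a i = 0 := by
  simp [padTo, hi]

lemma eq_padTo {n n₀ : ℕ} (h : n ≤ n₀) (a : Fin n → ℝ) (b : Fin n₀ → ℝ)
    (h1 : ∀ i, b (Fin.castLE h i) = a i) (h2 : ∀ i : Fin n₀, n ≤ i → b i = 0) :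
    b = padTo n₀ a := by
  funext i
  rcases lt_or_ge (i : ℕ) n with hi | hi
  · rw [padTo, dif_pos hi, ← h1]
    rfl
  · rw [padTo_of_le a hi, h2 i hi]

/-- A sum whose terms vanish on the padding. -/
lemma sum_eq_sum_castLE {n n₀ : ℕ} (h : n ≤ n₀) (F : Fin n₀ → ℝ)
    (hF : ∀ i : Fin n₀, n ≤ i → F i = 0) : ∑ i, F i = ∑ i, F (Fin.castLE h i) := by
  obtain ⟨t, rfl⟩ := Nat.exists_eq_add_of_le h
  rw [Fin.sum_univ_add, Finset.sum_eq_zero (fun i _ => hF (Fin.natAdd n i) (by simp)), add_zero]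
  rfl

variable {d₀ K₀ d K N : ℕ}

/-- Every component is carried by the same number of tokens. -/
lemma sum_comp (hK : 0 < K) (hKN : K ∣ N) (F : Fin K → ℝ) :
    ∑ j : Fin N, F (comp hK j) = (N : ℝ) / K * ∑ k, F k := by
  obtain ⟨t, rfl⟩ := hKN
  rw [mul_comm K t]
  have e : ∀ p : Fin t × Fin K, F (comp hK (finProdFinEquiv p)) = F p.2 := fun p => by
    congr 1
    apply Fin.ext
    simp [comp, Nat.mod_eq_of_lt p.2.2]
  rw [← Fintype.sum_equiv finProdFinEquiv (fun p => F p.2) _ fun p => (e p).symm,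
    Fintype.sum_prod_type]
  have hK' : (K : ℝ) ≠ 0 := by positivity
  simp only [Finset.sum_const, Finset.card_univ, Fintype.card_fin, nsmul_eq_mul, Nat.cast_mul]
  field_simp

lemma sum_comp_indicator (hK : 0 < K) (hKN : K ∣ N) (F : Fin K → ℝ) (k : Fin K) :
    ∑ j : Fin N, F (comp hK j) * (if k = comp hK j then 1 else 0) = (N : ℝ) / K * F k := by
  rw [sum_comp hK hKN fun i => F i * (if k = i then 1 else 0)]
  simp

/-- The unit vector of the component carried by a token. -/
def posVec (K₀ : ℕ) (hK : 0 < K) (j : Fin N) (k : Fin K₀) : ℝ :=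
  if (k : ℕ) = comp hK j then 1 else 0

lemma posVec_castLE (h : K ≤ K₀) (hK : 0 < K) (j : Fin N) (k : Fin K) :
    posVec K₀ hK j (Fin.castLE h k) = if k = comp hK j then 1 else 0 := by
  simp [posVec, Fin.ext_iff]

lemma posVec_of_le (hK : 0 < K) (j : Fin N) {k : Fin K₀} (hk : K ≤ k) : posVec K₀ hK j k = 0 := by
  rw [posVec, if_neg]
  have := (comp hK j).2
  omega

lemma sum_mul_posVec (h : K ≤ K₀) (hK : 0 < K) (j : Fin N) (a : Fin K₀ → ℝ) :
    ∑ k, a k * posVec K₀ hK j k = a (Fin.castLE h (comp hK j)) := by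
  rw [sum_eq_sum_castLE h _ fun i hi => by rw [posVec_of_le hK j hi, mul_zero]]
  simp [posVec_castLE h]

/-- The multiplicity `N / K` of each component appears in numerator and denominator, so attention
over tokens is a softmax over components. -/
lemma sum_softmax_comp (h : K ≤ K₀) (hK : 0 < K) (hN : 0 < N) (hKN : K ∣ N) (F : Fin K → ℝ) :
    (fun k => ∑ l : Fin N, softmax (fun l => F (comp hK l)) l * posVec K₀ hK l k)
      = padTo K₀ (softmax F) := by
  refine eq_padTo h _ _ (fun k => ?_) fun k hk => ?_
  · simp only [softmax, posVec_castLE h]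
    rw [sum_comp hK hKN (fun k => Real.exp (F k)),
      sum_comp_indicator hK hKN (fun i => Real.exp (F i) / ((N : ℝ) / K * ∑ k, Real.exp (F k)))]
    have h1 := (sum_exp_pos F k).ne'
    have h2 : (N : ℝ) ≠ 0 := by positivity
    have h3 : (K : ℝ) ≠ 0 := by positivity
    field_simp
  · exact Finset.sum_eq_zero fun l _ => by rw [posVec_of_le hK l hk, mul_zero]

/-- The parameters that the transformer carries: log-weights, means, squared norms of the means,
and the weights. -/
structure EMState (d K : ℕ) where
  logWeight : Fin K → ℝ
  mean : Fin K → EuclideanSpace ℝ (Fin d)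
  sqNorm : Fin K → ℝ
  weight : Fin K → ℝ

namespace EMState

/-- The responsibilities computed from the parameters. -/
def resp (s : EMState d K) (x : EuclideanSpace ℝ (Fin d)) (k : Fin K) : ℝ :=
  softmax (fun k => s.logWeight k + ⟪s.mean k, x⟫ - s.sqNorm k / 2) k

/-- The new weights. -/
def newWeight (s : EMState d K) (X : Fin N → EuclideanSpace ℝ (Fin d)) (k : Fin K) : ℝ :=
  1 / (N : ℝ) * ∑ j, s.resp (X j) k

/-- The new means. -/
def newMean (ε : ℝ) (M : ℕ) (s : EMState d K) (X : Fin N → EuclideanSpace ℝ (Fin d)) (k : Fin K) :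
    EuclideanSpace ℝ (Fin d) :=
  ∑ j, softmax (fun l => logApprox ε M (s.resp (X l) k)) j • X j

/-- An EM step with approximate logarithms and squares. -/
def step (ε : ℝ) (M m : ℕ) (X : Fin N → EuclideanSpace ℝ (Fin d)) (s : EMState d K) :
    EMState d K where
  logWeight k := logApprox ε M (s.newWeight X k)
  mean k := s.newMean ε M X k
  sqNorm k := ∑ c, (sqApprox ε m (s.newMean ε M X k c) + sqApprox ε m (-s.newMean ε M X k c))
  weight k := s.newWeight X k

/-- The tokens that carry a state, up to the values of the log-weights on the padding. -/
def Carries (hKK : K ≤ K₀) (hK : 0 < K) (X : Fin N → EuclideanSpace ℝ (Fin d))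
    (s : EMState d K) (H : Fin N → Row d₀ K₀ 0 → ℝ) : Prop :=
  ∃ lw : Fin K₀ → ℝ, (∀ k, lw (Fin.castLE hKK k) = s.logWeight k) ∧
    H = fun j => tok (padTo d₀ (X j)) lw (padTo d₀ (s.mean (comp hK j))) (s.sqNorm (comp hK j)) 0 0
      (padTo K₀ s.weight) (posVec K₀ hK j)

lemma Carries.step (hd : d ≤ d₀) {hKK : K ≤ K₀} {hK : 0 < K} (hN : 0 < N) (hKN : K ∣ N)
    {X : Fin N → EuclideanSpace ℝ (Fin d)} {s : EMState d K} {H : Fin N → Row d₀ K₀ 0 → ℝ}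
    (h : s.Carries hKK hK X H) {ε : ℝ} (hε : 0 ≤ ε) (M m : ℕ) :
    (s.step ε M m X).Carries hKK hK X ((mLayer d₀ K₀ ε M m).mlp ((mLayer d₀ K₀ ε M m).attn
      ((eLayer d₀ K₀ ε M m).mlp ((eLayer d₀ K₀ ε M m).attn H)))) := by
  obtain ⟨lw, hlw, rfl⟩ := h
  rw [eLayer_attn, eLayer_mlp, mLayer_attn, mLayer_mlp]
  have hresp : ∀ j, (fun k => ∑ l : Fin N, softmax (fun l => ∑ i, padTo d₀ (X j) i *
      padTo d₀ (s.mean (comp hK l)) i + (∑ k, lw k * posVec K₀ hK l k - s.sqNorm (comp hK l) / 2)) l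
        * posVec K₀ hK l k) = padTo K₀ (s.resp (X j)) := fun j => by
    have e : ∀ l : Fin N, ∑ i, padTo d₀ (X j) i * padTo d₀ (s.mean (comp hK l)) i +
        (∑ k, lw k * posVec K₀ hK l k - s.sqNorm (comp hK l) / 2)
        = (fun k => s.logWeight k + ⟪s.mean k, X j⟫ - s.sqNorm k / 2) (comp hK l) := fun l => by
      rw [sum_mul_posVec hKK, hlw, sum_eq_sum_castLE hd _ fun i hi => by
        rw [padTo_of_le _ hi, zero_mul]]
      simp only [padTo_castLE, PiLp.inner_apply, RCLike.inner_apply, conj_trivial]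
      ring
    simp only [e]
    exact sum_softmax_comp hKK hK hN hKN fun k => s.logWeight k + ⟪s.mean k, X j⟫ - s.sqNorm k / 2
  have hmean : ∀ j : Fin N, (fun i => ∑ l, softmax (fun l => ∑ k, posVec K₀ hK j k *
      logApprox ε M (padTo K₀ (s.resp (X l)) k)) l * padTo d₀ (X l) i)
      = padTo d₀ (s.newMean ε M X (comp hK j)) := fun j => by
    have e : ∀ l, ∑ k, posVec K₀ hK j k * logApprox ε M (padTo K₀ (s.resp (X l)) k)
        = logApprox ε M (s.resp (X l) (comp hK j)) := fun l => by
      simp only [mul_comm (posVec K₀ hK j _)]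
      rw [sum_mul_posVec hKK, padTo_castLE]
    simp only [e]
    refine eq_padTo hd _ _ (fun i => ?_) fun i hi => ?_
    · simp [padTo_castLE, newMean, WithLp.ofLp_sum]
    · exact Finset.sum_eq_zero fun l _ => by rw [padTo_of_le _ hi, mul_zero]
  have hweight : (fun k => ∑ l, softmax (fun _ : Fin N => (0 : ℝ)) l * padTo K₀ (s.resp (X l)) k)
      = padTo K₀ (s.newWeight X) := by
    refine eq_padTo hKK _ _ (fun i => ?_) fun i hi => ?_
    · simp [padTo_castLE, newWeight, softmax, Finset.mul_sum]
    · exact Finset.sum_eq_zero fun l _ => by rw [padTo_of_le _ hi, mul_zero]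
  -- On the padding the log-weights become `logApprox` of `0` rather than `0`; the position vectors
  -- vanish there, so these values never enter a score.
  refine ⟨fun k => logApprox ε M (padTo K₀ (s.newWeight X) k),
    fun k => congrArg _ (padTo_castLE _ _ _), ?_⟩
  simp only [funext_iff] at hresp hmean hweight
  funext j
  simp only [hresp, hmean, hweight]
  congr 1
  rw [sum_eq_sum_castLE hd _ fun i hi => by
    rw [padTo_of_le _ hi, neg_zero, sqApprox_of_nonpos hε _ le_rfl, add_zero]]
  simp only [padTo_castLE]
  rfl

end EMState

/-- The transformer that performs `n` approximate EM steps. -/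
def emTransformer (d₀ K₀ : ℕ) (ε : ℝ) (M m n : ℕ) : List (Layer (Row d₀ K₀ 0)) :=
  (List.replicate n [eLayer d₀ K₀ ε M m, mLayer d₀ K₀ ε M m]).flatten

lemma length_emTransformer (ε : ℝ) (M m n : ℕ) :
    (emTransformer d₀ K₀ ε M m n).length = 2 * n := by
  simp [emTransformer, mul_comm]

lemma mem_emTransformer {ε : ℝ} {M m n : ℕ} {T : Layer (Row d₀ K₀ 0)}
    (h : T ∈ emTransformer d₀ K₀ ε M m n) : T = eLayer d₀ K₀ ε M m ∨ T = mLayer d₀ K₀ ε M m := by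
  simp only [emTransformer, List.mem_flatten, List.mem_replicate] at h
  obtain ⟨l, ⟨-, rfl⟩, h⟩ := h
  simpa using h

lemma EMState.Carries.transformer (hd : d ≤ d₀) {hKK : K ≤ K₀} {hK : 0 < K} (hN : 0 < N)
    (hKN : K ∣ N) {X : Fin N → EuclideanSpace ℝ (Fin d)} {ε : ℝ} (hε : 0 ≤ ε) (M m n : ℕ) :
    ∀ {s : EMState d K} {H : Fin N → Row d₀ K₀ 0 → ℝ}, s.Carries hKK hK X H →
      ((EMState.step ε M m X)^[n] s).Carries hKK hK X
        (TGMM.transformer (emTransformer d₀ K₀ ε M m n) H) := by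
  induction n with
  | zero => exact fun h => h
  | succ n ih => exact fun h => ih (h.step hd hN hKN hε M m)

/-- The initial state. -/
def EMState.init (π₀ : Fin K → ℝ) (μ₀ : Fin K → EuclideanSpace ℝ (Fin d)) : EMState d K where
  logWeight k := Real.log (π₀ k)
  mean := μ₀
  sqNorm k := ‖μ₀ k‖ ^ 2
  weight := 0

lemma EMState.carries_encode (hKK : K ≤ K₀) (hK : 0 < K) (π₀ : Fin K → ℝ)
    (μ₀ : Fin K → EuclideanSpace ℝ (Fin d)) (X : Fin N → EuclideanSpace ℝ (Fin d)) :
    (EMState.init π₀ μ₀).Carries hKK hK X (encode (d₀ := d₀) (Dpad := 0) hK π₀ μ₀ X) := by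
  refine ⟨padTo K₀ fun k => Real.log (π₀ k), fun k => padTo_castLE _ _ _, ?_⟩
  funext j r
  cases r <;> simp [encode, tok, padTo, posVec, EMState.init]

/-- The factor `K` in the read-out query offsets the fraction `1 / K` of tokens carrying a
component. Every token holds the same weights, so all columns agree. -/
lemma EMState.Carries.readoutWeight_eq (hd : d ≤ d₀) {hKK : K ≤ K₀} {hK : 0 < K} (hN : 0 < N)
    (hKN : K ∣ N) {X : Fin N → EuclideanSpace ℝ (Fin d)} {s : EMState d K}
    {H : Fin N → Row d₀ K₀ 0 → ℝ} (h : s.Carries hKK hK X H) :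
    readoutWeight hd hKK H = s.weight := by
  obtain ⟨lw, hlw, rfl⟩ := h
  funext k
  have h2 : (N : ℝ) ≠ 0 := by positivity
  have h3 : (K : ℝ) ≠ 0 := by positivity
  have e : ∀ i, pooled hd hKK (fun j => tok (padTo d₀ (X j)) lw (padTo d₀ (s.mean (comp hK j)))
      (s.sqNorm (comp hK j)) 0 0 (padTo K₀ s.weight) (posVec K₀ hK j)) (Sum.inl k) i
      = s.weight k := fun i => by
    simp only [pooled, readoutValue, readoutKey, readoutQuery, dotProduct, Fintype.sum_sum_type,
      Sum.elim_inl, Sum.elim_inr, tok, padTo_castLE, posVec_castLE, mul_ite, mul_zero,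
      Finset.sum_ite_eq', Finset.mem_univ, if_true, Finset.sum_const_zero, add_zero, ite_mul,
      one_mul, zero_mul]
    rw [sum_comp hK hKN fun c => if i = c then s.weight k * K else 0]
    simp
    field_simp
  simp only [readoutWeight, e, Finset.sum_const, Finset.card_univ, Fintype.card_fin, nsmul_eq_mul]
  field_simp

lemma EMState.Carries.readoutMean_eq (hd : d ≤ d₀) {hKK : K ≤ K₀} {hK : 0 < K} (hN : 0 < N)
    (hKN : K ∣ N) {X : Fin N → EuclideanSpace ℝ (Fin d)} {s : EMState d K}
    {H : Fin N → Row d₀ K₀ 0 → ℝ} (h : s.Carries hKK hK X H) :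
    readoutMean hd hKK H = s.mean := by
  obtain ⟨lw, hlw, rfl⟩ := h
  funext k
  ext c
  have h2 : (N : ℝ) ≠ 0 := by positivity
  have h3 : (K : ℝ) ≠ 0 := by positivity
  simp only [readoutMean, pooled, readoutValue, readoutKey, readoutQuery, dotProduct,
    Fintype.sum_sum_type, Sum.elim_inl, Sum.elim_inr, tok, padTo_castLE, posVec_castLE, mul_ite,
    mul_zero, Finset.sum_ite_eq', Finset.mem_univ, if_true, Finset.sum_const_zero, add_zero,
    ite_mul, one_mul, zero_mul]
  rw [sum_comp hK hKN fun i => if k = i then s.mean i c * K else 0]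
  simp
  field_simp

end Semantics

/-! ### The error of the approximate EM iteration -/

section Recursion

variable {d K N : ℕ}

namespace EMState

/-- The state carries the parameters `lam`, `m`, up to an error `ε` in the logits. -/
structure Approx (s : EMState d K) (ε : ℝ) (lam : Fin K → ℝ)
    (m : Fin K → EuclideanSpace ℝ (Fin d)) : Prop where
  mean : s.mean = m
  logWeight : ∀ k, |s.logWeight k - lam k| ≤ ε
  sqNorm : ∀ k, |s.sqNorm k - ‖m k‖ ^ 2| ≤ ε

variable {s : EMState d K} {ε : ℝ} {lam : Fin K → ℝ} {m : Fin K → EuclideanSpace ℝ (Fin d)}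

lemma Approx.abs_resp_sub_le (h : s.Approx ε lam m) (x : EuclideanSpace ℝ (Fin d)) (k : Fin K) :
    |s.resp x k - TGMM.resp lam m k x| ≤ 6 * ε := by
  refine (abs_softmax_sub_le_of_forall (η := 3 / 2 * ε) _ _ (fun k => ?_) k).trans_eq (by ring)
  have h1 := abs_le.1 (h.logWeight k)
  have h2 := abs_le.1 (h.sqNorm k)
  rw [logit, h.mean, abs_le]
  constructor <;> linarith

lemma resp_pos (s : EMState d K) (x : EuclideanSpace ℝ (Fin d)) (k : Fin K) : 0 < s.resp x k :=
  softmax_pos _ _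

lemma resp_le_one (s : EMState d K) (x : EuclideanSpace ℝ (Fin d)) (k : Fin K) : s.resp x k ≤ 1 :=
  softmax_le_one _ _

lemma newWeight_le_one (hN : 0 < N) (s : EMState d K) (X : Fin N → EuclideanSpace ℝ (Fin d))
    (k : Fin K) : s.newWeight X k ≤ 1 := by
  have hN' : (0 : ℝ) < N := by exact_mod_cast hN
  rw [newWeight, one_div, inv_mul_le_iff₀ hN']
  exact (Finset.sum_le_sum fun j _ => s.resp_le_one (X j) k).trans_eq (by simp)

/-- The state carries parameters at distance at most `D` from the truth, up to an error `ε` in the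
logits. -/
structure Accurate (s : EMState d K) (g : GMM d K) (ε D : ℝ) : Prop where
  weight : ∀ k, |s.weight k - g.weight k| / g.weight k ≤ D
  mean : ∀ k, ‖s.mean k - g.mean k‖ ≤ D
  logWeight : ∀ k, |s.logWeight k - Real.log (s.weight k)| ≤ ε
  sqNorm : ∀ k, |s.sqNorm k - ‖s.mean k‖ ^ 2| ≤ ε

lemma Accurate.estimationError_le {g : GMM d K} {D : ℝ} (h : s.Accurate g ε D) (hK : 0 < K) :
    g.estimationError s.weight s.mean ≤ D := by
  have : Nonempty (Fin K) := ⟨⟨0, hK⟩⟩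
  exact ciSup_le fun i => max_le (h.mean i) (h.weight i)

/-- The errors of the weights relative to the truth, as perturbations of the log-weights. -/
lemma Accurate.approx {g : GMM d K} {D : ℝ} (h : s.Accurate g ε D) (hD : D ≤ 1 / 2) :
    (∀ k, |s.weight k / g.weight k - 1| ≤ D) ∧
      s.Approx ε (fun k => g.logWeight k + Real.log (s.weight k / g.weight k)) s.mean := by
  have e : ∀ k, |s.weight k / g.weight k - 1| ≤ D := fun k => by
    have hw := g.weight_pos k
    have := h.weight k
    rwa [← abs_of_pos hw, ← abs_div, abs_of_pos hw, sub_div, div_self hw.ne'] at this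
  refine ⟨e, rfl, fun k => ?_, h.sqNorm⟩
  have hw := g.weight_pos k
  have h1 : 0 < s.weight k / g.weight k := by linarith [(abs_le.1 (e k)).1]
  have h2 : 0 < s.weight k := by
    have := mul_pos h1 hw
    rwa [div_mul_cancel₀ _ hw.ne'] at this
  have h3 : g.logWeight k + Real.log (s.weight k / g.weight k) = Real.log (s.weight k) := by
    rw [GMM.logWeight, Real.log_div h2.ne' hw.ne']
    ring
  rw [h3]
  exact h.logWeight k

/-- One approximate EM step at the level of errors: `η` dominates the statistical error `τ` and the
approximation error. -/
lemma Approx.accurate_step {g : GMM d K} (h : s.Approx ε lam m) {M m' : ℕ} {τ S η D R : ℝ}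
    {X : Fin N → EuclideanSpace ℝ (Fin d)} (hN : 0 < N) (hε : 0 < ε)
    (hM : logNode ε M 0 ≤ ε) (hR : g.Rmax ≤ R) (hm : R + 1 ≤ (m' + 1) * ε)
    (hS : 1 ≤ S) (hdS : d ≤ S) (hτ : 1 / (N : ℝ) ≤ τ)
    (hη : 1000 * (τ / g.piMin) + 1000 * (1 / g.piMin + N * S) * ε ≤ η) (hη1 : η ≤ 1)
    (hl : g.leakage ≤ 1 / 16) (hD : 0 ≤ D) (hD1 : D ≤ 1)
    (hX : ∀ i j, ‖X j - g.mean i‖ ≤ 4 * S) (hc : g.Conc X lam m (3 * τ) D) :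
    (s.step ε M m' X).Accurate g ε (η / 10 + 4 * (D * g.leakage)) ∧
      η / 10 + 4 * (D * g.leakage) ≤ 1 / 2 := by
  have hN' : (1 : ℝ) ≤ N := by exact_mod_cast hN
  have hl' : D * g.leakage ≤ 1 / 16 := by
    calc D * g.leakage ≤ D * (1 / 16) := by gcongr
      _ ≤ _ := by linarith
  have hE : η / 10 + 4 * (D * g.leakage) ≤ 1 / 2 := by linarith
  have hτ0 : 0 < τ := lt_of_lt_of_le (by positivity) hτ
  have key : ∀ i : Fin K, 0 < g.piMin ∧ τ ≤ g.weight i / 1000 ∧ ε ≤ g.weight i / 1000 ∧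
      1000 * (N * S * ε) ≤ 1 ∧
      2 / g.weight i * (8 * ε * (4 * S) + 2 * (3 * τ)) ≤ η / 10 := fun i => by
    have hρ := g.piMin_pos i
    have hρi := g.piMin_le i
    set ρ := g.piMin
    have h1 : 0 < τ / ρ := by positivity
    have h2 : 0 < ε / ρ := by positivity
    have h3 : 0 < N * S * ε := by positivity
    have h4 : 1000 * (τ / ρ) + 1000 * (ε / ρ) + 1000 * (N * S * ε) ≤ η := by
      refine le_trans (le_of_eq ?_) hη
      ring
    have h5 : τ / ρ ≤ 1 / 1000 := by linarith
    have h6 : ε / ρ ≤ 1 / 1000 := by linarith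
    rw [div_le_iff₀ hρ] at h5 h6
    -- From `1 / N ≤ τ` and `τ / ρ ≤ 1 / 1000`. This lets `N * S * ε` absorb the approximation error
    -- divided by a weight.
    have h7 : 1 / ρ ≤ N := by
      rw [div_le_iff₀ (by linarith)] at hτ
      rw [div_le_iff₀ hρ]
      nlinarith
    refine ⟨hρ, by linarith, by linarith, by linarith, ?_⟩
    have h8 : 1 / g.weight i ≤ 1 / ρ := one_div_le_one_div_of_le hρ hρi
    calc 2 / g.weight i * (8 * ε * (4 * S) + 2 * (3 * τ))
        = 1 / g.weight i * (64 * (S * ε) + 12 * τ) := by ring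
      _ ≤ 1 / ρ * (64 * (S * ε) + 12 * τ) := by gcongr
      _ = 64 * (1 / ρ * (S * ε)) + 12 * (τ / ρ) := by ring
      _ ≤ 64 * (N * (S * ε)) + 12 * (τ / ρ) := by gcongr
      _ ≤ _ := by linarith
  have hstep : ∀ i, |s.newWeight X i - g.weight i| / g.weight i ≤ η / 10 + 4 * (D * g.leakage) ∧
      ‖s.newMean ε M X i - g.mean i‖ ≤ η / 10 + 4 * (D * g.leakage) := fun i => by
    obtain ⟨hρ, h1, h2, h3, h4⟩ := key i
    have hε1 : ε ≤ 1 := by linarith [g.weight_le_one i]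
    have hw := g.weight_pos i
    have hres : ∀ j, |s.resp (X j) i - TGMM.resp lam m i (X j)| ≤ 8 * ε := fun j =>
      (h.abs_resp_sub_le (X j) i).trans (by linarith)
    -- The logit errors contribute `6 * ε` and the truncated logarithm `2 * ε`.
    have hres' : ∀ j, |Real.exp (logApprox ε M (s.resp (X j) i)) - TGMM.resp lam m i (X j)|
        ≤ 8 * ε := fun j => by
      have e1 := abs_exp_logApprox_sub_le hε M hε1 hM (s.resp_pos (X j) i).le
        (s.resp_le_one (X j) i)
      have e2 := h.abs_resp_sub_le (X j) i
      exact (abs_sub_le _ (s.resp (X j) i) _).trans (by linarith)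
    -- The weights average the computed responsibilities; the means use the exponentials of their
    -- approximate logarithms, whose normalization is the softmax.
    have := hc.step hN hX (by linarith) i hres hres' (by nlinarith)
    exact ⟨this.1.trans (by linarith), this.2.trans (by linarith)⟩
  refine ⟨⟨fun i => (hstep i).1, fun i => (hstep i).2, fun i => ?_, fun i => ?_⟩, hE⟩
  · obtain ⟨hρ, h1, h2, h3, h4⟩ := key i
    have hw := g.weight_pos i
    refine abs_logApprox_sub_log_le hε M (hM.trans ?_) (newWeight_le_one hN s X i)
    -- The relative error is at most `1 / 2`, so the new weight stays above `ε`, in the range where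
    -- the logarithm is approximated.
    have h5 := ((hstep i).1.trans hE)
    rw [div_le_iff₀ hw] at h5
    have h6 := (abs_le.1 h5).1
    change ε ≤ s.newWeight X i
    linarith
  · obtain ⟨hρ, h1, h2, h3, h4⟩ := key i
    have hn : ‖s.newMean ε M X i‖ ≤ (m' + 1) * ε := by
      have e1 := (hstep i).2.trans hE
      have e2 := g.norm_mean_le_Rmax i
      have e3 := norm_sub_norm_le (s.newMean ε M X i) (g.mean i)
      linarith
    -- The `d` coordinates contribute `ε²` each to the error of the squared norm, hence at most `ε`
    -- in total.
    have hdε : (d : ℝ) * ε ≤ 1 := by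
      have : (d : ℝ) * ε ≤ N * S * ε := by
        gcongr
        nlinarith
      have : 0 < N * S * ε := by positivity
      linarith
    change |∑ c, (sqApprox ε m' (s.newMean ε M X i c) + sqApprox ε m' (-s.newMean ε M X i c))
      - ‖s.newMean ε M X i‖ ^ 2| ≤ ε
    rw [EuclideanSpace.real_norm_sq_eq, ← Finset.sum_sub_distrib]
    refine (Finset.abs_sum_le_sum_abs _ _).trans ((Finset.sum_le_sum fun c _ =>
      abs_sqApprox_add_sub_le hε.le m' ((PiLp.norm_apply_le (s.newMean ε M X i) c).trans hn)).trans
      ?_)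
    simp only [Finset.sum_const, Finset.card_univ, Fintype.card_fin, nsmul_eq_mul]
    nlinarith

/-- The error after `n + 1` approximate EM steps. -/
lemma Approx.accurate_iterate {g : GMM d K} (h : s.Approx ε lam m) {M m' : ℕ} {τ S η R a β : ℝ}
    {X : Fin N → EuclideanSpace ℝ (Fin d)} (hN : 0 < N) (hε : 0 < ε)
    (hM : logNode ε M 0 ≤ ε) (hR : g.Rmax ≤ R) (hm : R + 1 ≤ (m' + 1) * ε)
    (hS : 1 ≤ S) (hdS : d ≤ S) (hτ : 1 / (N : ℝ) ≤ τ)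
    (hη : 1000 * (τ / g.piMin) + 1000 * (1 / g.piMin + N * S) * ε ≤ η) (hη0 : 0 ≤ η) (hη1 : η ≤ 1)
    (ha : 1 / 2 < a) (hβ : 0 < β) (hβ1 : β < 1) (hl : g.leakage ≤ β / 16) (hl0 : 0 ≤ g.leakage)
    (hX : ∀ i j, ‖X j - g.mean i‖ ≤ 4 * S) (hc : g.Conc X lam m (3 * τ) 1)
    (hc' : ∀ (r : Fin K → ℝ) (m : Fin K → EuclideanSpace ℝ (Fin d)) (D : ℝ), 0 ≤ D → D ≤ 1 / 2 →
        (∀ k, |r k - 1| ≤ D) → (∀ k, ‖m k - g.mean k‖ ≤ D) →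
        g.Conc X (fun k => g.logWeight k + Real.log (r k)) m (3 * τ) D) (n : ℕ) :
    ∃ D, 0 ≤ D ∧ D ≤ 1 / 2 ∧ D ≤ a * β ^ n + 1 / (1 - β) * η ∧
      ((step ε M m' X)^[n + 1] s).Accurate g ε D := by
  have hβ' : 0 < 1 - β := by linarith
  induction n with
  | zero =>
    -- One full step is spent on entering the neighbourhood of radius `1 / 2 < a`; this is why `n +
    -- 1` steps give the power `β ^ n`.
    obtain ⟨h1, h2⟩ := h.accurate_step hN hε hM hR hm hS hdS hτ hη hη1 (by linarith) zero_le_one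
      le_rfl hX hc
    have : 0 ≤ 1 / (1 - β) * η := by positivity
    exact ⟨_, by positivity, h2, by rw [pow_zero]; linarith, h1⟩
  | succ n ih =>
    obtain ⟨D, hD0, hD1, hD, hacc⟩ := ih
    obtain ⟨e1, e2⟩ := hacc.approx hD1
    have e3 := hc' _ _ D hD0 hD1 e1 hacc.mean
    obtain ⟨h1, h2⟩ := e2.accurate_step hN hε hM hR hm hS hdS hτ hη hη1 (by linarith) hD0
      (by linarith) hX e3
    refine ⟨_, by positivity, h2, ?_, by rw [Function.iterate_succ_apply']; exact h1⟩
    -- The actual factor is `4 * leakage ≤ β / 4`, and `η + β / (1 - β) * η = 1 / (1 - β) * η`.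
    calc η / 10 + 4 * (D * g.leakage) ≤ η + β * D := by nlinarith
      _ ≤ η + β * (a * β ^ n + 1 / (1 - β) * η) := by gcongr
      _ = a * β ^ (n + 1) + 1 / (1 - β) * η := by
        field_simp
        ring

end EMState

end Recursion

/-! ### Accuracy of the transformer -/

section Accuracy

variable {d₀ K₀ d K N : ℕ}

lemma GMM.leakage_nonneg (g : GMM d K) (i : Fin K) : 0 ≤ g.leakage := by
  have := g.one_le_rho i
  unfold GMM.leakage
  positivity

lemma GMM.InitAssumption.near {g : GMM d K} {C : ℝ} {π₀ : Fin K → ℝ}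
    {μ₀ : Fin K → EuclideanSpace ℝ (Fin d)} (h : g.InitAssumption C π₀ μ₀) (hK : 2 ≤ K)
    (hC : 128 ≤ C) : g.Near (fun k => Real.log (π₀ k)) μ₀ where
  hundred_le_Rmin := h.hundred_le_Rmin hK hC
  mean := h.mean_init
  logWeight k := by
    have hw := g.weight_pos k
    have h1 := abs_le.1 (h.weight_init k)
    have h2 : 0 < π₀ k := by linarith
    have h3 : Real.log (π₀ k) - g.logWeight k = Real.log (π₀ k / g.weight k) - Real.log 1 := by
      rw [GMM.logWeight, Real.log_div h2.ne' hw.ne', Real.log_one, sub_zero]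
    have h4 : |π₀ k / g.weight k - 1| ≤ 1 / 2 := by
      rw [div_sub_one hw.ne', abs_div, abs_of_pos hw, div_le_iff₀ hw]
      linarith [h.weight_init k]
    rw [h3]
    exact (abs_log_sub_log_le (by linarith [(abs_le.1 h4).1]) (by norm_num)).trans (by linarith)

lemma GMM.le_stepError {g : GMM d K} (hd : 1 ≤ d) (hK : 2 ≤ K) (hN : 0 < N) {ε δ a : ℝ}
    (hδ : 0 < δ) (hδ1 : δ < 1) (ha : 1 / 2 < a) (ha1 : a < 1) :
    1000 * (g.statError N δ a / g.piMin) + 1000 * (1 / g.piMin + N * g.sampleScale N δ) * ε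
      ≤ g.stepError (84000 * momentBound) 1000 N ε δ a := by
  have hτ := (g.statError_facts hd hK hN hδ hδ1 ha1).1
  have hτ0 : 0 ≤ g.statError N δ a := le_trans (by positivity) hτ
  have hρ := g.piMin_pos ⟨0, by omega⟩
  have ha' : 0 < 1 - a := by linarith
  have h1 : 1 ≤ 1 / (1 - a) := by
    rw [le_div_iff₀ ha']
    linarith
  have h2 : 84000 * momentBound / ((1 - a) * g.piMin) *
      √(K * d * Real.log (g.logConst a * N / δ) / N)
      = 1 / (1 - a) * (1000 * (g.statError N δ a / g.piMin)) := by
    rw [GMM.statError]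
    field_simp
    ring
  rw [GMM.stepError, h2]
  refine add_le_add (le_mul_of_one_le_left (by positivity) h1) le_rfl

/-- All randomness sits in the event of `le_sampleLaw_conc`; on it the bound is deterministic. The
network depends on `d₀`, `K₀`, `ε`, `M`, `m` and `L` but not on the mixture. -/
theorem GMM.le_sampleLaw_tfError_le (g : GMM d K) (hdd : d ≤ d₀) (hKK : K ≤ K₀) (hK0 : 0 < K)
    (hd : 1 ≤ d) (hK : 2 ≤ K) (hN : 0 < N) (hKN : K ∣ N) {C R ε δ a β : ℝ} {π₀ : Fin K → ℝ}
    {μ₀ : Fin K → EuclideanSpace ℝ (Fin d)} {M m : ℕ} (L : ℕ) (hε : 0 < ε)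
    (hM : logNode ε M 0 ≤ ε) (hR : g.Rmax ≤ R) (hm : R + 1 ≤ (m + 1) * ε)
    (hδ : 0 < δ) (hδ1 : δ < 1) (ha : 1 / 2 < a) (ha1 : a < 1) (hβ : 0 < β) (hβ1 : β < 1)
    (hC : 128 ≤ C) (hC' : 12 / (β / 16) ≤ C) (h : g.InitAssumption C π₀ μ₀)
    (hη : g.stepError (84000 * momentBound) 1000 N ε δ a < a * (1 - β)) :
    ENNReal.ofReal (1 - δ) ≤ g.sampleLaw N
      {X | tfError (emTransformer d₀ K₀ ε M m (L + 1)) g hdd hKK hK0 π₀ μ₀ X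
        ≤ a * β ^ L + 1 / (1 - β) * g.stepError (84000 * momentBound) 1000 N ε δ a} := by
  have i : Fin K := ⟨0, hK0⟩
  have hl := h.leakage_le hK hC (by positivity) hC'
  have hl0 := g.leakage_nonneg i
  have hτ := (g.statError_facts hd hK hN hδ hδ1 ha1).1
  have hτ0 : 0 ≤ g.statError N δ a := le_trans (by positivity) hτ
  have hS := (g.sampleScale_facts hd hK hN hδ hδ1 ha1).1
  have hle := g.le_stepError (N := N) (ε := ε) hd hK hN hδ hδ1 ha ha1
  set η := g.stepError (84000 * momentBound) 1000 N ε δ a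
  have hη1 : η ≤ 1 := by nlinarith
  have hρ := g.piMin_pos i
  have hρ1 : g.piMin ≤ 1 := (g.piMin_le i).trans (g.weight_le_one i)
  have h1 : 0 ≤ 1000 * (1 / g.piMin + N * g.sampleScale N δ) * ε := by positivity
  have h2 : g.statError N δ a ≤ g.statError N δ a / g.piMin := le_div_self hτ0 hρ hρ1
  have hdS : (d : ℝ) ≤ g.sampleScale N δ := by
    have : 0 ≤ g.Rmax := (norm_nonneg _).trans (g.norm_mean_le_Rmax i)
    have : 0 ≤ √(2 * d * Real.log (4 * N / δ)) := Real.sqrt_nonneg _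
    rw [GMM.sampleScale]
    linarith
  refine (g.le_sampleLaw_conc hd hK hN hδ hδ1 ha1 (by linarith) (h.near hK hC)
    (by linarith)).trans (measure_mono fun X hX => ?_)
  obtain ⟨hX, hc, hc'⟩ := hX
  have hinit : (EMState.init π₀ μ₀).Approx ε (fun k => Real.log (π₀ k)) μ₀ :=
    ⟨rfl, fun k => by simp [EMState.init, hε.le], fun k => by simp [EMState.init, hε.le]⟩
  obtain ⟨D, -, -, hD, hacc⟩ := hinit.accurate_iterate hN hε hM hR hm hS hdS hτ hle (by linarith)
    hη1 ha hβ hβ1 hl hl0 hX hc hc' L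
  have hcar := (EMState.carries_encode (d₀ := d₀) hKK hK0 π₀ μ₀ X).transformer hdd hN hKN hε.le M m
    (L + 1)
  rw [Set.mem_ofPred_eq, tfError, hcar.readoutWeight_eq hdd hN hKN, hcar.readoutMean_eq hdd hN hKN]
  exact (hacc.estimationError_le hK0).trans hD

end Accuracy

/-! ### Size of the transformer -/

section Size

variable {d₀ K₀ : ℕ}

/-- The number of nodes of the approximate logarithm. -/
def logCount (ε : ℝ) : ℕ := ⌈Real.log (1 / ε) / ε⌉₊

/-- The number of nodes of the approximate square. -/
def sqCount (ε R : ℝ) : ℕ := ⌈(R + 1) / ε⌉₊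

lemma logCount_mul_bounds {ε : ℝ} (hε : 0 < ε) (hε1 : ε ≤ 1) :
    Real.log (1 / ε) ≤ ε * logCount ε ∧ ε * logCount ε ≤ Real.log (1 / ε) + ε := by
  have h0 : 0 ≤ Real.log (1 / ε) := Real.log_nonneg (by rw [le_div_iff₀ hε]; linarith)
  have h1 := Nat.le_ceil (Real.log (1 / ε) / ε)
  have h2 := (Nat.ceil_lt_add_one (by positivity : 0 ≤ Real.log (1 / ε) / ε)).le
  have e : ε * (Real.log (1 / ε) / ε) = Real.log (1 / ε) := by field_simp
  rw [logCount]
  constructor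
  · nlinarith
  · nlinarith

lemma sqCount_mul_bounds {ε R : ℝ} (hε : 0 < ε) (hR : 1 ≤ R) :
    R + 1 ≤ (sqCount ε R + 1) * ε ∧ sqCount ε R * ε ≤ R + 1 + ε := by
  have h1 := Nat.le_ceil ((R + 1) / ε)
  have h2 := (Nat.ceil_lt_add_one (by positivity : 0 ≤ (R + 1) / ε)).le
  have e : (R + 1) / ε * ε = R + 1 := by field_simp
  rw [sqCount]
  constructor
  · nlinarith
  · nlinarith

lemma logNode_logCount_bounds {ε : ℝ} (hε : 0 < ε) (hε1 : ε ≤ 1) :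
    logNode ε (logCount ε) 0 ≤ ε ∧ ε / 3 ≤ logNode ε (logCount ε) 0 := by
  obtain ⟨h1, h2⟩ := logCount_mul_bounds hε hε1
  rw [Real.log_div one_ne_zero hε.ne', Real.log_one, zero_sub] at h1 h2
  have e : ∀ x, Real.exp (Real.log ε - x) = ε * Real.exp (-x) := fun x => by
    rw [sub_eq_add_neg, Real.exp_add, Real.exp_log hε]
  have h3 : logNode ε (logCount ε) 0 = Real.exp (-(ε * logCount ε)) := by
    rw [logNode]
    congr 1
    push_cast
    ring
  rw [h3]
  constructor
  · calc _ ≤ Real.exp (Real.log ε - 0) := Real.exp_le_exp.2 (by linarith)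
      _ = ε := by rw [e]; simp
  · calc ε / 3 ≤ ε * Real.exp (-1) := by
          rw [Real.exp_neg, div_eq_mul_inv]
          gcongr
          linarith [Real.exp_one_lt_d9]
      _ = Real.exp (Real.log ε - 1) := (e 1).symm
      _ ≤ _ := Real.exp_le_exp.2 (by linarith)

/-- Consecutive nodes differ by the factor `exp ε ≥ 1 + ε` and the first one is at least `ε / 3`;
hence ramp slopes are at most `3 / ε²`. -/
lemma logNode_gap {ε : ℝ} (hε : 0 < ε) (hε1 : ε ≤ 1) (n : ℕ) :
    ε ^ 2 / 3 ≤ logNode ε (logCount ε) (n + 1) - logNode ε (logCount ε) n := by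
  have h1 := (logNode_logCount_bounds hε hε1).2
  have h2 : logNode ε (logCount ε) 0 ≤ logNode ε (logCount ε) n := by
    rw [logNode, logNode]
    apply Real.exp_le_exp.2
    push_cast
    gcongr
    positivity
  have h3 : logNode ε (logCount ε) (n + 1) = Real.exp ε * logNode ε (logCount ε) n := by
    rw [logNode, logNode, ← Real.exp_add]
    congr 1
    push_cast
    ring
  have h4 := Real.add_one_le_exp ε
  rw [h3]
  nlinarith

lemma logNode_le_one {ε : ℝ} (hε : 0 < ε) {M n : ℕ} (hn : n ≤ M) : logNode ε M n ≤ 1 := by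
  rw [logNode, Real.exp_le_one_iff]
  have : (n : ℝ) ≤ M := by exact_mod_cast hn
  nlinarith

lemma logNode_pos (ε : ℝ) (M n : ℕ) : 0 < logNode ε M n := Real.exp_pos _

lemma abs_single_le {ι : Type*} [DecidableEq ι] {r i : ι} {v c : ℝ} (h : |v| ≤ c) :
    |(Pi.single r v : ι → ℝ) i| ≤ c := by
  rcases eq_or_ne i r with rfl | hi
  · simpa using h
  · rw [Pi.single_eq_of_ne hi, abs_zero]
    exact (abs_nonneg _).trans h

lemma abs_sgn (b : Bool) : |sgn b| = 1 := by
  cases b <;> simp [sgn]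

lemma abs_inWeight_le {ε R : ℝ} (hε : 0 < ε) (hε1 : ε ≤ 1) (hR : 1 ≤ R)
    (src : Fin K₀ → Row d₀ K₀ 0) (u : Units d₀ K₀ (logCount ε) (sqCount ε R)) (i : Row d₀ K₀ 0) :
    |inWeight ε (logCount ε) (sqCount ε R) src u i| ≤ 6 / ε ^ 2 + 4 * R := by
  have hc : 0 ≤ 6 / ε ^ 2 := by positivity
  match u with
  | .inl (r, b) => exact abs_single_le (by rw [abs_sgn]; linarith)
  | .inr (.inl _) => exact abs_single_le (by rw [abs_one]; linarith)
  | .inr (.inr (.inl (k, n, b))) =>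
    have hg := logNode_gap hε hε1 n
    set g := logNode ε (logCount ε) (n + 1) - logNode ε (logCount ε) n
    have hg0 : 0 < g := lt_of_lt_of_le (by positivity) hg
    have h1 : 1 / g ≤ 3 / ε ^ 2 := by
      rw [div_le_div_iff₀ hg0 (by positivity)]
      linarith
    have h2 : |1 / g| ≤ 3 / ε ^ 2 := by rwa [abs_of_pos (by positivity)]
    have h3 : logNode ε (logCount ε) (n + b.toNat) ≤ 1 :=
      logNode_le_one hε (by have := n.2; have := b.toNat_le; omega)
    have h4 : |-(logNode ε (logCount ε) (n + b.toNat) / g)| ≤ 3 / ε ^ 2 := by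
      have := logNode_pos ε (logCount ε) (n + b.toNat)
      rw [abs_neg, abs_of_pos (by positivity)]
      refine le_trans ?_ h1
      gcongr
    refine (abs_add_le _ _).trans ((add_le_add (abs_single_le h2) (abs_single_le h4)).trans ?_)
    have : 3 / ε ^ 2 + 3 / ε ^ 2 = 6 / ε ^ 2 := by ring
    linarith
  | .inr (.inr (.inr (c, n, b))) =>
    have h1 : |-((n : ℕ) * ε)| ≤ 3 * R := by
      rw [abs_neg, abs_of_nonneg (by positivity)]
      have : ((n : ℕ) : ℝ) ≤ sqCount ε R := by exact_mod_cast Nat.lt_succ_iff.1 n.2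
      have := (sqCount_mul_bounds hε hR).2
      nlinarith
    refine (abs_add_le _ _).trans ((add_le_add (abs_single_le (abs_sgn b).le)
      (abs_single_le h1)).trans ?_)
    linarith

lemma abs_outWeight_le {ε R : ℝ} (hε : 0 < ε) (hε1 : ε ≤ 1) (hR : 1 ≤ R)
    {clr : Row d₀ K₀ 0 → ℝ} (hclr : ∀ r, |clr r| ≤ 1) (tgt : Fin K₀ → Row d₀ K₀ 0) {χ : ℝ}
    (hχ : |χ| ≤ 1) (u : Units d₀ K₀ (logCount ε) (sqCount ε R)) (i : Row d₀ K₀ 0) :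
    |outWeight ε (logCount ε) (sqCount ε R) clr tgt χ u i| ≤ 6 / ε ^ 2 + 4 * R := by
  have hc : 6 ≤ 6 / ε ^ 2 := by
    rw [le_div_iff₀ (by positivity)]
    nlinarith
  match u with
  | .inl (r, b) =>
    refine abs_single_le ?_
    rw [abs_neg, abs_mul, abs_sgn, one_mul]
    linarith [hclr r]
  | .inr (.inl _) =>
    refine abs_single_le ?_
    rw [abs_neg, abs_of_nonneg (by positivity)]
    have h1 := (logCount_mul_bounds hε hε1).2
    have h2 := Real.log_le_sub_one_of_pos (show 0 < 1 / ε by positivity)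
    have h3 : 1 / ε ≤ 6 / ε ^ 2 := by
      rw [div_le_div_iff₀ hε (by positivity)]
      nlinarith
    linarith
  | .inr (.inr (.inl (k, n, b))) =>
    refine abs_single_le ?_
    rw [abs_mul, abs_sgn, one_mul, abs_of_pos hε]
    linarith
  | .inr (.inr (.inr (c, n, b))) =>
    refine abs_single_le ?_
    have h1 : |if (n : ℕ) = 0 then ε else 2 * ε| ≤ 2 := by
      split_ifs
      · rw [abs_of_pos hε]
        linarith
      · rw [abs_of_pos (by positivity)]
        linarith
    rw [abs_mul]
    nlinarith [abs_nonneg χ, abs_nonneg (if (n : ℕ) = 0 then ε else 2 * ε)]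

lemma emLayer_norm_le {ε R : ℝ} (hε : 0 < ε) (hε1 : ε ≤ 1) (hR : 1 ≤ R) {n : ℕ}
    {head : Fin n → Head (Row d₀ K₀ 0)}
    (hh : ∀ h, ∀ A ∈ [(head h).Q, (head h).K, (head h).V], ∃ s : Row d₀ K₀ 0 → Option (_ × ℝ),
      A = rowSelect s ∧ ∀ r p, s r = some p → |p.2| ≤ 1)
    {clr : Row d₀ K₀ 0 → ℝ} (hclr : ∀ r, |clr r| ≤ 1) (src tgt : Fin K₀ → Row d₀ K₀ 0) {χ : ℝ}
    (hχ : |χ| ≤ 1) :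
    (emLayer ε (logCount ε) (sqCount ε R) n head clr src tgt χ).norm
      ≤ (Fintype.card (Row d₀ K₀ 0) * Fintype.card (Row d₀ K₀ 0) +
        2 * (Fintype.card (Units d₀ K₀ (logCount ε) (sqCount ε R)) * Fintype.card (Row d₀ K₀ 0)))
        * (6 / ε ^ 2 + 4 * R) := by
  have hA : ∀ h, ∀ A ∈ [(head h).Q, (head h).K, (head h).V],
      ‖A‖ ≤ Fintype.card (Row d₀ K₀ 0) * Fintype.card (Row d₀ K₀ 0) * 1 := fun h A hA => by
    obtain ⟨s, rfl, hs⟩ := hh h A hA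
    exact norm_rowSelect_le s hs
  have hc : 0 ≤ 6 / ε ^ 2 := by positivity
  exact layerOf_norm_le head _ _ (by linarith)
    (fun h => ⟨hA h _ (by simp), hA h _ (by simp), hA h _ (by simp)⟩)
    (abs_inWeight_le hε hε1 hR src) (abs_outWeight_le hε hε1 hR hclr tgt hχ)

lemma eLayer_norm_le {ε R : ℝ} (hε : 0 < ε) (hε1 : ε ≤ 1) (hR : 1 ≤ R) :
    (eLayer d₀ K₀ ε (logCount ε) (sqCount ε R)).norm
      ≤ (Fintype.card (Row d₀ K₀ 0) * Fintype.card (Row d₀ K₀ 0) +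
        2 * (Fintype.card (Units d₀ K₀ (logCount ε) (sqCount ε R)) * Fintype.card (Row d₀ K₀ 0)))
        * (6 / ε ^ 2 + 4 * R) := by
  refine emLayer_norm_le hε hε1 hR (fun h A hA => ?_) (fun r => ?_) _ _ (by simp)
  · simp only [List.mem_cons, List.not_mem_nil, or_false] at hA
    rcases hA with rfl | rfl | rfl
    all_goals
      refine ⟨_, rfl, fun r p h => ?_⟩
      cases r <;> simp only [reduceCtorEq, Option.some.injEq] at h
      all_goals
        subst h
        norm_num [abs_le]
  · cases r <;> simp [clearOld]

lemma mLayer_norm_le {ε R : ℝ} (hε : 0 < ε) (hε1 : ε ≤ 1) (hR : 1 ≤ R) :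
    (mLayer d₀ K₀ ε (logCount ε) (sqCount ε R)).norm
      ≤ (Fintype.card (Row d₀ K₀ 0) * Fintype.card (Row d₀ K₀ 0) +
        2 * (Fintype.card (Units d₀ K₀ (logCount ε) (sqCount ε R)) * Fintype.card (Row d₀ K₀ 0)))
        * (6 / ε ^ 2 + 4 * R) := by
  refine emLayer_norm_le hε hε1 hR (fun h A hA => ?_) (fun r => ?_) _ _ (by simp)
  · have hm : ∀ A ∈ [(meanHead (d₀ := d₀) (K₀ := K₀)).Q, meanHead.K, meanHead.V],
        ∃ s : Row d₀ K₀ 0 → Option (_ × ℝ), A = rowSelect s ∧ ∀ r p, s r = some p → |p.2| ≤ 1 := by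
      intro A hA
      simp only [List.mem_cons, List.not_mem_nil, or_false] at hA
      rcases hA with rfl | rfl | rfl
      all_goals
        refine ⟨_, rfl, fun r p h => ?_⟩
        cases r <;> simp only [reduceCtorEq, Option.some.injEq] at h
        all_goals
          subst h
          norm_num
    have hw : ∀ A ∈ [(weightHead (d₀ := d₀) (K₀ := K₀)).Q, weightHead.K, weightHead.V],
        ∃ s : Row d₀ K₀ 0 → Option (_ × ℝ), A = rowSelect s ∧ ∀ r p, s r = some p → |p.2| ≤ 1 := by
      intro A hA
      simp only [List.mem_cons, List.not_mem_nil, or_false] at hA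
      rcases hA with rfl | rfl | rfl
      · exact ⟨fun _ => none, rfl, fun r p h => by simp at h⟩
      · exact ⟨fun _ => none, rfl, fun r p h => by simp at h⟩
      · refine ⟨_, rfl, fun r p h => ?_⟩
        cases r <;> simp only [reduceCtorEq, Option.some.injEq] at h
        subst h
        norm_num
    exact Fin.forall_fin_two (p := fun h => ∀ A ∈ [((![meanHead, weightHead] : Fin 2 → Head
      (Row d₀ K₀ 0)) h).Q, (![meanHead, weightHead] h).K, (![meanHead, weightHead] h).V],
        ∃ s : Row d₀ K₀ 0 → Option (_ × ℝ), A = rowSelect s ∧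
          ∀ r p, s r = some p → |p.2| ≤ 1).2 ⟨hm, hw⟩ h A hA
  · cases r <;> simp [clearScratch]

lemma card_units (M m : ℕ) : Fintype.card (Units d₀ K₀ M m)
    = 2 * (2 * d₀ + 5 * K₀ + 2) + K₀ + 2 * (K₀ * M) + 2 * (d₀ * (m + 1)) := by
  simp only [Units, Fintype.card_sum, Fintype.card_prod, card_row, Fintype.card_bool,
    Fintype.card_fin]
  ring

lemma foldr_max_le {l : List ℝ} {B : ℝ} (hB : 0 ≤ B) (h : ∀ x ∈ l, x ≤ B) :
    l.foldr max 0 ≤ B := by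
  induction l with
  | nil => exact hB
  | cons x l ih =>
    exact max_le (h x (by simp)) (ih fun y hy => h y (by simp [hy]))

/-- A polynomial bound is enough, its logarithm being `11 * log P`; three numerical factors are
replaced by `P ≥ 100`. -/
lemma norm_bound_le_pow {D W P i R : ℝ} (hP : 100 ≤ P) (hD0 : 0 ≤ D) (hD : D ≤ 9 * P)
    (hW : W ≤ 31 * (2 * P ^ 5)) (hi0 : 0 ≤ i) (hi : i ≤ P) (hR : R ≤ P) (hR0 : 0 ≤ R) :
    (D * D + 2 * (W * D)) * (6 * (i * i) + 4 * R) ≤ P ^ 11 := by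
  have e1 : P ^ 2 ≤ P ^ 6 := pow_le_pow_right₀ (by linarith) (by norm_num)
  have e2 : P ≤ P ^ 2 := le_self_pow₀ (by linarith) (by norm_num)
  have e3 : 0 < P ^ 6 := by positivity
  calc _ ≤ (9 * P * (9 * P) + 2 * (31 * (2 * P ^ 5) * (9 * P))) * (6 * (P * P) + 4 * P) := by
        gcongr
    _ = (81 * P ^ 2 + 1116 * P ^ 6) * (6 * P ^ 2 + 4 * P) := by ring
    _ ≤ (100 * (100 * P ^ 6)) * (100 * P ^ 2) :=
        mul_le_mul (by linarith) (by linarith) (by positivity) (by positivity)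
    _ ≤ (P * (P * P ^ 6)) * (P * P ^ 2) := by gcongr
    _ = P ^ 11 := by ring

/-- The bound on the width, and the polynomial bound on the norm. -/
lemma size_bounds {ε δ R : ℝ} (hδ : 0 < δ) (hδ1 : δ < 1) (hR : 1 ≤ R) (hd : 1 ≤ d₀) (hK : 1 ≤ K₀)
    (hε : 0 < ε) (hε1 : ε ≤ 1 / 100) :
    1 ≤ Real.log (d₀ * K₀ * R / (ε * δ)) ∧ 0 < d₀ * K₀ * R / (ε * δ) ∧
    (Fintype.card (Units d₀ K₀ (logCount ε) (sqCount ε R)) : ℝ)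
      ≤ 31 * (K₀ * R * (R + d₀) * ε⁻¹) * Real.log (d₀ * K₀ * R / (ε * δ)) ∧
    ((Fintype.card (Row d₀ K₀ 0) * Fintype.card (Row d₀ K₀ 0) +
        2 * (Fintype.card (Units d₀ K₀ (logCount ε) (sqCount ε R)) * Fintype.card (Row d₀ K₀ 0)))
        * (6 / ε ^ 2 + 4 * R) : ℝ) ≤ (d₀ * K₀ * R / (ε * δ)) ^ 11 := by
  have hd' : (1 : ℝ) ≤ d₀ := by exact_mod_cast hd
  have hK' : (1 : ℝ) ≤ K₀ := by exact_mod_cast hK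
  have hi : 100 ≤ ε⁻¹ := by
    rw [le_inv_comm₀ (by norm_num) hε]
    linarith
  set P : ℝ := d₀ * K₀ * R / (ε * δ) with hP
  have hδi : 1 ≤ δ⁻¹ := by
    rw [le_inv_comm₀ (by norm_num) hδ]
    linarith
  have hP' : P = d₀ * K₀ * R * ε⁻¹ * δ⁻¹ := by
    rw [hP]
    field_simp
  have h4 : d₀ * K₀ * R * ε⁻¹ ≤ P := by
    rw [hP']
    exact le_mul_of_one_le_right (by positivity) hδi
  have hdK : 1 ≤ (d₀ : ℝ) * K₀ := by nlinarith
  have hdKR : 1 ≤ (d₀ : ℝ) * K₀ * R := by nlinarith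
  have hiP : ε⁻¹ ≤ P := (le_mul_of_one_le_left (by positivity) hdKR).trans h4
  have h5 : (d₀ : ℝ) * K₀ * R ≤ P := le_trans (by nlinarith) h4
  have hdKP : (d₀ : ℝ) * K₀ ≤ P := le_trans (by nlinarith) h5
  have hRP : R ≤ P := le_trans (by nlinarith) h5
  have hdP : (d₀ : ℝ) ≤ P := le_trans (by nlinarith) hdKP
  have hKP : (K₀ : ℝ) ≤ P := le_trans (by nlinarith) hdKP
  have hP100 : 100 ≤ P := hi.trans hiP
  have hP0 : 0 < P := by linarith
  have hΛ1 : 1 ≤ Real.log P := by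
    rw [Real.le_log_iff_exp_le hP0]
    linarith [Real.exp_one_lt_d9]
  have hΛP : Real.log P ≤ P := (Real.log_le_sub_one_of_pos hP0).trans (by linarith)
  have hlogi : Real.log (1 / ε) ≤ Real.log P := by
    rw [one_div]
    exact Real.log_le_log (by positivity) hiP
  set Λ := Real.log P
  have hM : (logCount ε : ℝ) ≤ 2 * (Λ * ε⁻¹) := by
    have := (logCount_mul_bounds hε (by linarith)).2
    rw [← le_div_iff₀' hε] at this
    refine this.trans ?_
    rw [div_eq_mul_inv, ← mul_assoc]
    gcongr
    linarith
  have hm : (sqCount ε R + 1 : ℝ) ≤ 4 * (R * ε⁻¹) := by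
    have := (sqCount_mul_bounds hε hR).2
    rw [← le_div_iff₀ hε] at this
    have e : (R + 1 + ε) / ε = R * ε⁻¹ + ε⁻¹ + 1 := by field_simp
    rw [e] at this
    nlinarith
  set G : ℝ := K₀ * R * (R + d₀) * ε⁻¹ * Λ with hG
  have hRd : 1 ≤ R + d₀ := by linarith
  have hi1 : 1 ≤ ε⁻¹ := by linarith
  have hiΛ : 1 ≤ ε⁻¹ * Λ := one_le_mul_of_one_le_of_one_le hi1 hΛ1
  have hKR : 1 ≤ K₀ * R := one_le_mul_of_one_le_of_one_le hK' hR
  have g1 : (d₀ : ℝ) ≤ G := by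
    calc (d₀ : ℝ) ≤ R + d₀ := by linarith
      _ ≤ K₀ * R * (R + d₀) := le_mul_of_one_le_left (by positivity) hKR
      _ ≤ K₀ * R * (R + d₀) * (ε⁻¹ * Λ) := le_mul_of_one_le_right (by positivity) hiΛ
      _ = G := by rw [hG]; ring
  have g2 : (K₀ : ℝ) * (Λ * ε⁻¹) ≤ G := by
    calc (K₀ : ℝ) * (Λ * ε⁻¹) ≤ K₀ * (Λ * ε⁻¹) * (R * (R + d₀)) :=
          le_mul_of_one_le_right (by positivity) (one_le_mul_of_one_le_of_one_le hR hRd)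
      _ = G := by rw [hG]; ring
  have g3 : (d₀ : ℝ) * (R * ε⁻¹) ≤ G := by
    calc (d₀ : ℝ) * (R * ε⁻¹) ≤ (R + d₀) * (R * ε⁻¹) * (K₀ * Λ) := by
          refine le_trans ?_ (le_mul_of_one_le_right (by positivity)
            (one_le_mul_of_one_le_of_one_le hK' hΛ1))
          gcongr
          linarith
      _ = G := by rw [hG]; ring
  have g4 : (K₀ : ℝ) ≤ G := by
    refine (le_mul_of_one_le_right (by positivity) ?_).trans g2
    rwa [mul_comm]
  -- The five groups of units in `card_units` amount to `4 + 11 + 4 + 4 + 8 = 31` multiples of `G`.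
  have hW : (Fintype.card (Units d₀ K₀ (logCount ε) (sqCount ε R)) : ℝ) ≤ 31 * G := by
    rw [card_units]
    push_cast
    have e1 : (K₀ : ℝ) * logCount ε ≤ K₀ * (2 * (Λ * ε⁻¹)) := by gcongr
    have e2 : (d₀ : ℝ) * (sqCount ε R + 1) ≤ d₀ * (4 * (R * ε⁻¹)) := by gcongr
    linarith
  have hGP : G ≤ 2 * P ^ 5 := by
    calc G ≤ P * P * (P + P) * P * P := by rw [hG]; gcongr
      _ = _ := by ring
  have hD : (Fintype.card (Row d₀ K₀ 0) : ℝ) ≤ 9 * P := by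
    rw [card_row]
    push_cast
    linarith
  refine ⟨hΛ1, hP0, hW.trans_eq (by rw [hG]; ring), ?_⟩
  have hε2 : 6 / ε ^ 2 = 6 * (ε⁻¹ * ε⁻¹) := by field_simp
  rw [hε2]
  exact norm_bound_le_pow hP100 (Nat.cast_nonneg _) hD
    (hW.trans (mul_le_mul_of_nonneg_left hGP (by norm_num))) (by positivity) hiP hRP
    (by linarith)

end Size

end TGMM

end

/-! ### Choice of the constants and of the network. -/

theorem theoremC1 :
    -- universal constants; `cO` and `q` are those hidden in the `O` and `Õ` bounds
    ∃ c₁ > (0 : ℝ), ∃ c₂ > (0 : ℝ), ∃ c₃ > (0 : ℝ), ∃ c₄ > (0 : ℝ), ∃ cO > (0 : ℝ), ∃ q : ℕ,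
    ∀ a β : ℝ, 1 / 2 < a → a < 1 → 0 < β → β < 1 →
    ∃ C ≥ (128 : ℝ),
    ∀ (δ ε R : ℝ) (d₀ K₀ L : ℕ), 0 < δ → δ < 1 → 1 ≤ R → 1 ≤ d₀ → 1 ≤ K₀ →
      0 < ε → ε ≤ 1 / (100 * K₀) →
    ∃ (Dpad D' M : ℕ) (B : ℝ) (Θ : List (TGMM.Layer (TGMM.Row d₀ K₀ Dpad))),
      -- the size of the transformer
      TGMM.InClass Θ (2 * (L + 1)) D' M B ∧
      (Fintype.card (TGMM.Row d₀ K₀ Dpad) : ℝ) ≤ cO * (d₀ + K₀) ∧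
      (D' : ℝ) ≤ cO * (K₀ * R * (R + d₀) * ε⁻¹) * Real.log (d₀ * K₀ * R / (ε * δ)) ^ q ∧
      (M : ℝ) ≤ cO ∧
      0 < B ∧
      Real.log B ≤ cO * (K₀ * R * (R + d₀)) * Real.log (d₀ * K₀ * R / (ε * δ)) ^ q ∧
      -- its accuracy, for all admissible tasks simultaneously
      ∀ (d K N : ℕ) (hd : d ≤ d₀) (hK : K ≤ K₀) (hK2 : 2 ≤ K) (g : TGMM.GMM d K)
        (π₀ : Fin K → ℝ) (μ₀ : Fin K → EuclideanSpace ℝ (Fin d)),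
        1 ≤ d → 0 < N → K ∣ N →
        g.Rmax ≤ R →
        g.InitAssumption C π₀ μ₀ →
        g.firstStepError c₁ c₂ N ε δ a < 1 / 2 * (a - 1 / 2) →
        g.stepError c₃ c₄ N ε δ a < a * (1 - β) →
        ENNReal.ofReal (1 - δ) ≤ g.sampleLaw N
          {X | TGMM.tfError Θ g hd hK (Nat.lt_of_lt_of_le Nat.zero_lt_two hK2) π₀ μ₀ X
            ≤ a * β ^ L + 1 / (1 - β) * g.stepError c₃ c₄ N ε δ a} := by
  have hA := TGMM.GMM.one_le_momentBound
  -- `84000 = 1000 * 84` combines the constants of `accurate_iterate` and `statError`; `31` counts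
  -- hidden units, with a single logarithm. The summand `12 / (β / 16)` of `C` forces `leakage ≤ β /
  -- 16`.
  refine ⟨1, one_pos, 1, one_pos, 84000 * TGMM.GMM.momentBound, by positivity, 1000, by norm_num,
    31, by norm_num, 1, fun a β ha ha1 hβ hβ1 => ⟨128 + 12 / (β / 16), ?_, ?_⟩⟩
  · have : 0 < 12 / (β / 16) := by positivity
    linarith
  intro δ ε R d₀ K₀ L hδ hδ1 hR hd₀ hK₀ hε hεK
  have hd' : (1 : ℝ) ≤ d₀ := by exact_mod_cast hd₀
  have hK' : (1 : ℝ) ≤ K₀ := by exact_mod_cast hK₀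
  have hε100 : ε ≤ 1 / 100 := hεK.trans (one_div_le_one_div_of_le (by norm_num) (by linarith))
  have hε1 : ε ≤ 1 := by linarith
  obtain ⟨hΛ, hP, hW, hB⟩ := TGMM.size_bounds (d₀ := d₀) (K₀ := K₀) hδ hδ1 hR hd₀ hK₀ hε hε100
  refine ⟨0, Fintype.card (TGMM.Units d₀ K₀ (TGMM.logCount ε) (TGMM.sqCount ε R)), 2,
    (d₀ * K₀ * R / (ε * δ)) ^ 11,
    TGMM.emTransformer d₀ K₀ ε (TGMM.logCount ε) (TGMM.sqCount ε R) (L + 1),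
    ⟨TGMM.length_emTransformer _ _ _ _, ?_, fun T hT => ?_, fun T hT => ?_⟩, ?_, ?_, by norm_num,
    by positivity, ?_, ?_⟩
  · refine TGMM.foldr_max_le (by positivity) fun x hx => ?_
    obtain ⟨T, hT, rfl⟩ := List.mem_map.1 hx
    rcases TGMM.mem_emTransformer hT with rfl | rfl
    · exact (TGMM.eLayer_norm_le hε hε1 hR).trans hB
    · exact (TGMM.mLayer_norm_le hε hε1 hR).trans hB
  · rcases TGMM.mem_emTransformer hT with rfl | rfl <;> exact le_rfl
  · rcases TGMM.mem_emTransformer hT with rfl | rfl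
    · exact one_le_two
    · exact le_rfl
  · rw [TGMM.card_row]
    push_cast
    linarith
  · rwa [pow_one]
  · rw [pow_one, Real.log_pow]
    have h1 : 1 ≤ K₀ * R * (R + d₀) :=
      one_le_mul_of_one_le_of_one_le (one_le_mul_of_one_le_of_one_le hK' hR) (by linarith)
    push_cast
    gcongr
    linarith
  · intro d K N hd hK hK2 g π₀ μ₀ hd1 hN hKN hgR hinit _ hη
    have h12 : 0 < 12 / (β / 16) := by positivity
    exact g.le_sampleLaw_tfError_le hd hK _ hd1 hK2 hN hKN L hε
      (TGMM.logNode_logCount_bounds hε hε1).1 hgR (TGMM.sqCount_mul_bounds hε hR).1 hδ hδ1 ha ha1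
      hβ hβ1 (by linarith) (by linarith) hinit hη
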